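/- **Split trees.** Fix integers $b\ge 1$ and $s,s_0,s_1\ge 0$ with $s_0+bs_1\le s+1$ and $(s,s_0)\neq(0,0)$, and a random vector $\mathcal V=(V_1,\dots,V_b)$ with $V_i\ge 0$ and $\sum_i V_i=1$. Give every node $u$ of the infinite rooted $b$-ary tree an independent copy $\mathcal V_u$ of $\mathcal V$. For $n\ge 0$, the split tree $T^n$ with $n$ items is described by the numbers $n_u$ of items in the subtrees rooted at the nodes $u$: the root has $n_\varnothing=n$. If $n_v\le s$, then all $n_v$ items are stored at $v$ and the children of $v$ have $0$ items. If $n_v>s$, then $s_0$ items are stored at $v$ and, given $n_v$ and $\mathcal V_v=(V_1,\dots,V_b)$, the numbers of items of the subtrees of the $b$ children of $v$ are distributed as $$\mathrm{Mult}(n_v-s_0-bs_1;V_1,\dots,V_b)+(s_1,\dots,s_1),$$ the splits at distinct nodes being otherwise independent. The total path length $\Psi(T^n)$ is the sum of the depths of the $n$ items, the depth of an item being the depth of the node where it is stored. Let $\mu=\mathbf E\big[-\sum_i V_i\ln V_i\big]$ (with $0\ln 0=0$) and $C(\mathcal V)=1+\frac1\mu\sum_{i=1}^b V_i\ln V_i$.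 **Theorem.** Suppose that $\mathbf P(\exists i: V_i=1)<1$ and $\mathbf P(C(\mathcal V)\ne 0)>0$. Then $\mathbf E[\Psi(T^n)]<\infty$ for every $n$. Put $X_n=(\Psi(T^n)-\mathbf E[\Psi(T^n)])/n$. 1. There is exactly one probability law of a real random variable $X$ such that $\mathbf E[X]=0$, $\operatorname{Var}(X)<\infty$ and $$X\overset{d}{=}\sum_{k=1}^b V_kX^{(k)}+C(\mathcal V),$$ where $X^{(1)},\dots,X^{(b)}$ are copies of $X$ and $X^{(1)},\dots,X^{(b)},\mathcal V$ are independent. 2. $X_n\to X$ in distribution as $n\to\infty$. 3. For every $\lambda\in\mathbb R$, $\mathbf E[e^{\lambda X_n}]\to\mathbf E[e^{\lambda X}]$ in $[0,\infty]$. If moreover $e^{\lambda}\,\mathbf P(\exists i: V_i=1)<1$, then $\mathbf E[e^{\lambda X}]<\infty$ and $\mathbf E[e^{\lambda X_n}]<\infty$ for all sufficiently large $n$, so that the convergence is one of real numbers. In particular, if $\mathbf P(\exists i: V_i=1)=0$, this holds for every $\lambda\in\mathbb R$. No condition on whether $\ln V_i$ is lattice is imposed. -/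

import Mathlib

open MeasureTheory ProbabilityTheory Filter Topology

noncomputable section

namespace SplitTree

/-- Nodes of the infinite rooted `b`-ary tree, as finite words over `b` letters. A word is stored
with its last letter first: `[]` is the root, `i :: v` is the `i`-th child of `v`, and the depth of
a node is the length of the word. -/
abbrev Node (b : ℕ) : Type := List (Fin b)

/-- Probability that the multinomial distribution `Mult(m; v₁, …, v_b)` gives to `k`. -/
def multinomialProb {b : ℕ} (m : ℕ) (v : Fin b → ℝ) (k : Fin b → ℕ) : ℝ :=
  if ∑ i, k i = m then (Nat.multinomial Finset.univ k : ℝ) * ∏ i, v i ^ k i else 0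

/-- `ν` is the law of a split vector `(V₁, …, V_b)`: a probability measure on vectors with
nonnegative coordinates that sum to one. -/
structure IsSplitLaw {b : ℕ} (ν : Measure (Fin b → ℝ)) : Prop where
  isProbabilityMeasure : IsProbabilityMeasure ν
  mem_simplex : ∀ᵐ v ∂ν, v ∈ stdSimplex ℝ (Fin b)

/-- Admissible parameters: `s` is the capacity of an external node, `s₀` the number of items kept
by an internal node, `s₁` the number of items that each child receives for sure. For `s = s₀ = 0`
no node could ever store an item, so that case is left out. -/
structure IsAdmissible (b s s₀ s₁ : ℕ) : Prop where
  le : s₀ + b * s₁ ≤ s + 1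
  pos : 0 < s ∨ 0 < s₀

/-- The randomness of split trees, on a probability space `(Ω, P)`. Node `u` carries a split vector
`𝒱 u` with law `ν` and, for each `m`, a way `M u m` to throw `m` items into its `b` children;
given `𝒱 u`, the vector `M u m` has law `Mult(m; 𝒱 u)`. Distinct nodes are independent. -/
structure IsSplitRandomness {b : ℕ} {Ω : Type*} [MeasurableSpace Ω] (P : Measure Ω)
    (ν : Measure (Fin b → ℝ)) (𝒱 : Node b → Ω → (Fin b → ℝ))
    (M : Node b → ℕ → Ω → (Fin b → ℕ)) : Prop where
  measurable_vector : ∀ u, Measurable (𝒱 u)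
  measurable_throw : ∀ u m, Measurable (M u m)
  law_vector : ∀ u, P.map (𝒱 u) = ν
  law_throw : ∀ u m (k : Fin b → ℕ) (A : Set (Fin b → ℝ)), MeasurableSet A →
    P {ω | 𝒱 u ω ∈ A ∧ M u m ω = k} = ∫⁻ v in A, ENNReal.ofReal (multinomialProb m v k) ∂ν
  indep : iIndepFun (fun (u : Node b) (ω : Ω) => (𝒱 u ω, fun m => M u m ω)) P

/-- The number `n_u` of items in the subtree rooted at `u`, in the split tree `Tⁿ`; `M u m` is the
outcome of throwing `m` items at node `u`. The root has `n` items. A node `v` with `n_v > s` splits: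
its children get `Mult(n_v - s₀ - b s₁; V₁, …, V_b) + (s₁, …, s₁)`. Otherwise all its items stay. -/
def card {b : ℕ} (s s₀ s₁ : ℕ) (M : Node b → ℕ → (Fin b → ℕ)) (n : ℕ) : Node b → ℕ
  | [] => n
  | i :: v =>
      if s < card s s₀ s₁ M n v then
        M v (card s s₀ s₁ M n v - s₀ - b * s₁) i + s₁
      else 0

/-- The number of items stored at the node `u` itself: `s₀` at an internal node, all `n_u` items
otherwise. -/
def stored {b : ℕ} (s s₀ s₁ : ℕ) (M : Node b → ℕ → (Fin b → ℕ)) (n : ℕ) (u : Node b) : ℕ :=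
  if s < card s s₀ s₁ M n u then s₀ else card s s₀ s₁ M n u

/-- The total path length `Ψ(Tⁿ)`: the sum over all items of their depths. -/
def pathLength {b : ℕ} (s s₀ s₁ : ℕ) (M : Node b → ℕ → (Fin b → ℕ)) (n : ℕ) : ENNReal :=
  ∑' u : Node b, (stored s s₀ s₁ M n u : ENNReal) * (u.length : ENNReal)

/-- The normalized total path length `X_n = (Ψ(Tⁿ) - E Ψ(Tⁿ)) / n`. -/
def normalizedPathLength {b : ℕ} {Ω : Type*} [MeasurableSpace Ω] (P : Measure Ω) (s s₀ s₁ : ℕ)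
    (M : Node b → ℕ → Ω → (Fin b → ℕ)) (n : ℕ) (ω : Ω) : ℝ :=
  ((pathLength s s₀ s₁ (fun u m => M u m ω) n).toReal
    - ∫ ω', (pathLength s s₀ s₁ (fun u m => M u m ω') n).toReal ∂P) / n

/-- `μ = E[-ln Δ]`, where `Δ = V_j` with conditional probability `V_j` given `(V₁, …, V_b)`.
The convention `0 ln 0 = 0` is built into `Real.log`. -/
def meanLog {b : ℕ} (ν : Measure (Fin b → ℝ)) : ℝ :=
  ∫ v, ∑ j, v j * (-Real.log (v j)) ∂ν

/-- The cost `C(v) = 1 + μ⁻¹ ∑ v_i ln v_i`. -/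
def cost {b : ℕ} (ν : Measure (Fin b → ℝ)) (v : Fin b → ℝ) : ℝ :=
  1 + (meanLog ν)⁻¹ * ∑ i, v i * Real.log (v i)

/-- The law of `∑ V_k X⁽ᵏ⁾ + C(𝒱)`, where `𝒱` has law `ν`, the `X⁽ᵏ⁾` have law `φ`, and
`𝒱, X⁽¹⁾, …, X⁽ᵇ⁾` are independent. -/
def fixedPointMap {b : ℕ} (ν : Measure (Fin b → ℝ)) (φ : Measure ℝ) : Measure ℝ :=
  (ν.prod (Measure.pi fun _ : Fin b => φ)).map
    fun p => ∑ k, p.1 k * p.2 k + cost ν p.1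

/-- `φ` is the law of a solution `X` of the fixed point equation with `E[X] = 0`, `Var(X) < ∞`. -/
structure IsCenteredSolution {b : ℕ} (ν : Measure (Fin b → ℝ)) (φ : ProbabilityMeasure ℝ) :
    Prop where
  fixed : fixedPointMap ν (φ : Measure ℝ) = φ
  finite_variance : MemLp (fun x : ℝ => x) 2 (φ : Measure ℝ)
  mean_zero : ∫ x, x ∂(φ : Measure ℝ) = 0

end SplitTree

end

/-!
The path length satisfies `Ψ(Tⁿ) = ∑ (n_i + Ψ(T^{n_i}))`, so the normalized path length `Y_n` obeys
`Y_n = ∑ (n_i / n) Y_{n_i} + C_n` with the toll `C_n = (∑ (n_i + e(n_i)) - e(n)) / n`, where `e(n)`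
is the mean path length. The theorem follows by contraction in mean square once `C_n` is close to the
cost `C(𝒱)`.

The toll (`tendsto_integral_toll_sub_cost_sq`). A maximum principle for the recursion of the
increments of `e` gives `e(n) = n ln n / μ + f(n)` with a Lipschitz function `f`
(`abs_meanRest_sub_le`). Hence `C_n` is `C(𝒱)` plus a small error plus the effect
`∑ V_i (G(n V_i) - G(n))` of the oscillations `G(x) = f(⌊x⌋) / x`. No precise asymptotics of `G` are
available, but as `C_n` and `C(𝒱)` are centred, `G` is asymptotically harmonic for the
multiplicative walk with the size-biased step, and a quantitative Choquet–Deny argument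
(`tendsto_scaleFluct`) shows that `G` varies little over one step, in mean square. This works in the
lattice case as well.

Exponential moments (`exists_lintegral_exp_path_le`). Write `p = P(∃ i, V_i = 1)`. If
`exp (hi) p < 1`, then for a constant `K` and `θ n` in a bounded interval `[lo, hi]` one shows
`E exp (θ (Ψ(Tⁿ) - e(n))) ≤ exp (K θ² n²)` by induction along the tree. The inductive inequality
(`exists_integral_exp_toll_le`) concerns one split: the toll is compensated by the loss `n² - ∑ n_i²`
of squared size, which vanishes in the limit only where some `V_i` is one; there the cost is one,
and the condition on `hi` takes over.

The limit. On the canonical space of environments, the iterates of the fixed point equation along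
the tree converge to a variable `limitVar`, and `Y_n` converges to it in mean square, as one step
contracts by the factor `E ∑ V_i² < 1` (`exists_integral_sq_sub_le`). The characteristic functions
of two centred solutions are contracted by the same factor, which gives uniqueness
(`eq_of_mixMap_class`).

Exponential moments of the limit. If `exp (t) p < 1`, a slightly larger exponent still has bounded
moments, so the moments at `t` converge (`tendsto_lintegral_exp_of_bound`). Otherwise the fixed
point equation on the event `∃ i, V_i = 1`, where it reads `X = X⁽ⁱ⁾ + 1`, forces `E exp (t X) = ∞`
(`lintegral_exp_eq_top`), and lower semicontinuity makes the moments of `Y_n` tend to infinity.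

Independence of the subtrees of the root enters through `IsEnvLaw.map_root_subtree`. The law of the
whole environment need not be unique, as nothing is assumed about the joint law of the throws
`M u m` of different numbers `m` at the same node; therefore the estimates are uniform over all laws
with `IsEnvLaw`, a class that is closed under passing to subtrees.
-/

noncomputable section

namespace SplitTree

/-! ### Moments of the multinomial distribution -/

/-- The mean of `g` under the multinomial distribution `Mult(m; v₁, …, v_b)`. -/
def multMean {b : ℕ} (m : ℕ) (v : Fin b → ℝ) (g : (Fin b → ℕ) → ℝ) : ℝ :=
  ∑ k ∈ Finset.piAntidiag Finset.univ m, multinomialProb m v k * g k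

lemma mem_piAntidiag_univ {b m : ℕ} {k : Fin b → ℕ} :
    k ∈ Finset.piAntidiag Finset.univ m ↔ ∑ i, k i = m := by
  simp [Finset.mem_piAntidiag]

lemma multinomialProb_nonneg {b : ℕ} {v : Fin b → ℝ} (hv : ∀ i, 0 ≤ v i) (m : ℕ)
    (k : Fin b → ℕ) : 0 ≤ multinomialProb m v k := by
  unfold multinomialProb
  split_ifs
  · exact mul_nonneg (Nat.cast_nonneg _) (Finset.prod_nonneg fun i _ => pow_nonneg (hv i) _)
  · exact le_rfl

lemma measurable_multinomialProb {b : ℕ} (m : ℕ) (k : Fin b → ℕ) :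
    Measurable fun v : Fin b → ℝ => multinomialProb m v k := by
  unfold multinomialProb
  split_ifs <;> fun_prop

lemma sum_add_single {b m : ℕ} {k : Fin b → ℕ} (j : Fin b) (hk : ∑ i, k i = m) :
    ∑ i, (k + Pi.single j 1 : Fin b → ℕ) i = m + 1 := by
  simp [Finset.sum_add_distrib, hk]

/-- The multinomial weights at `k + e_j` and `k`: this identity drives all moment computations. -/
lemma multinomialProb_add_single {b : ℕ} {m : ℕ} (v : Fin b → ℝ) {k : Fin b → ℕ}
    (hk : ∑ i, k i = m) (j : Fin b) :
    multinomialProb (m + 1) v (k + Pi.single j 1) * (((k + Pi.single j 1 : Fin b → ℕ) j : ℕ) : ℝ)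
      = (m + 1) * v j * multinomialProb m v k := by
  have hk' := sum_add_single j hk
  have h1 : (∏ i, ((k + Pi.single j 1 : Fin b → ℕ) i).factorial) = (k j + 1) * ∏ i, (k i).factorial := by
    rw [← Finset.mul_prod_erase _ _ (Finset.mem_univ j),
      ← Finset.mul_prod_erase _ (fun i => (k i).factorial) (Finset.mem_univ j), ← mul_assoc]
    congr 1
    · simp [Nat.factorial_succ]
    · refine Finset.prod_congr rfl fun i hi => ?_
      simp [Finset.ne_of_mem_erase hi]
  have h2 : (∏ i, v i ^ (k + Pi.single j 1 : Fin b → ℕ) i) = v j * ∏ i, v i ^ k i := by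
    rw [← Finset.mul_prod_erase _ _ (Finset.mem_univ j),
      ← Finset.mul_prod_erase _ (fun i => v i ^ (k i)) (Finset.mem_univ j), ← mul_assoc]
    congr 1
    · simp [pow_succ, mul_comm]
    · refine Finset.prod_congr rfl fun i hi => ?_
      simp [Finset.ne_of_mem_erase hi]
  have h3 := Nat.multinomial_spec Finset.univ (k + Pi.single j 1)
  have h4 := Nat.multinomial_spec Finset.univ k
  rw [hk', h1, Nat.factorial_succ] at h3
  rw [hk] at h4
  have h5 : (k j + 1) * Nat.multinomial Finset.univ (k + Pi.single j 1)
      = (m + 1) * Nat.multinomial Finset.univ k := by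
    have hpos : 0 < ∏ i, (k i).factorial := Finset.prod_pos fun i _ => Nat.factorial_pos _
    apply Nat.eq_of_mul_eq_mul_left hpos
    rw [← h4] at h3
    linarith
  have h6 : ((k j : ℝ) + 1) * (Nat.multinomial Finset.univ (k + Pi.single j 1) : ℝ)
      = (m + 1) * (Nat.multinomial Finset.univ k : ℝ) := by exact_mod_cast h5
  unfold multinomialProb
  rw [if_pos hk', if_pos hk, h2]
  simp only [Pi.add_apply, Pi.single_eq_same, Nat.cast_add, Nat.cast_one]
  linear_combination (v j * ∏ i, v i ^ k i) * h6

/-- Size-biasing the `j`-th coordinate of `Mult(m + 1; v)`. -/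
lemma multMean_succ_mul {b : ℕ} (m : ℕ) (v : Fin b → ℝ) (j : Fin b) (g : (Fin b → ℕ) → ℝ) :
    multMean (m + 1) v (fun k => k j * g k)
      = (m + 1) * v j * multMean m v (fun k => g (k + Pi.single j 1)) := by
  classical
  have hinj : Function.Injective fun k : Fin b → ℕ => k + Pi.single j 1 :=
    fun a c h => add_right_cancel h
  have hsub : (Finset.piAntidiag Finset.univ m).image (fun k : Fin b → ℕ => k + Pi.single j 1)
      ⊆ Finset.piAntidiag Finset.univ (m + 1) := by
    intro k hk
    obtain ⟨k', hk', rfl⟩ := Finset.mem_image.1 hk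
    exact mem_piAntidiag_univ.2 (sum_add_single j (mem_piAntidiag_univ.1 hk'))
  unfold multMean
  rw [← Finset.sum_subset hsub, Finset.sum_image fun _ _ _ _ h => hinj h, Finset.mul_sum]
  · refine Finset.sum_congr rfl fun k hk => ?_
    rw [← mul_assoc, multinomialProb_add_single v (mem_piAntidiag_univ.1 hk), mul_assoc]
  · intro k hk hk'
    have : k j = 0 := by
      by_contra h0
      apply hk'
      rw [Finset.mem_image]
      have hle : Pi.single j 1 ≤ k := by
        intro i
        by_cases h : i = j
        · subst h; simp; omega
        · simp [h]
      refine ⟨k - Pi.single j 1, ?_, tsub_add_cancel_of_le hle⟩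
      rw [mem_piAntidiag_univ] at hk ⊢
      have := sum_add_single (k := k - Pi.single j 1) j rfl
      rw [tsub_add_cancel_of_le hle, hk] at this
      omega
    simp [this]

lemma multMean_congr {b m : ℕ} {v : Fin b → ℝ} {g g' : (Fin b → ℕ) → ℝ}
    (h : ∀ k, ∑ i, k i = m → g k = g' k) : multMean m v g = multMean m v g' :=
  Finset.sum_congr rfl fun k hk => by rw [h k (mem_piAntidiag_univ.1 hk)]

lemma multMean_add {b m : ℕ} (v : Fin b → ℝ) (g g' : (Fin b → ℕ) → ℝ) :
    multMean m v (fun k => g k + g' k) = multMean m v g + multMean m v g' := by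
  simp [multMean, mul_add, Finset.sum_add_distrib]

lemma multMean_sub {b m : ℕ} (v : Fin b → ℝ) (g g' : (Fin b → ℕ) → ℝ) :
    multMean m v (fun k => g k - g' k) = multMean m v g - multMean m v g' := by
  simp [multMean, mul_sub, Finset.sum_sub_distrib]

lemma multMean_const_mul {b m : ℕ} (v : Fin b → ℝ) (c : ℝ) (g : (Fin b → ℕ) → ℝ) :
    multMean m v (fun k => c * g k) = c * multMean m v g := by
  simp [multMean, Finset.mul_sum, mul_left_comm]

lemma multMean_sum {b m : ℕ} {ι : Type*} (t : Finset ι) (v : Fin b → ℝ)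
    (g : ι → (Fin b → ℕ) → ℝ) :
    multMean m v (fun k => ∑ i ∈ t, g i k) = ∑ i ∈ t, multMean m v (g i) := by
  simp only [multMean, Finset.mul_sum]
  rw [Finset.sum_comm]

lemma multMean_mono {b m : ℕ} {v : Fin b → ℝ} (hv : ∀ i, 0 ≤ v i) {g g' : (Fin b → ℕ) → ℝ}
    (h : ∀ k, ∑ i, k i = m → g k ≤ g' k) : multMean m v g ≤ multMean m v g' :=
  Finset.sum_le_sum fun k hk => mul_le_mul_of_nonneg_left (h k (mem_piAntidiag_univ.1 hk))
    (multinomialProb_nonneg hv m k)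

lemma multMean_one {b : ℕ} {v : Fin b → ℝ} (hv : v ∈ stdSimplex ℝ (Fin b)) (m : ℕ) :
    multMean m v (fun _ => 1) = 1 := by
  have h := Finset.sum_pow_eq_sum_piAntidiag (Finset.univ) v m
  rw [hv.2, one_pow] at h
  refine Eq.trans ?_ h.symm
  refine Finset.sum_congr rfl fun k hk => ?_
  rw [multinomialProb, if_pos (mem_piAntidiag_univ.1 hk), mul_one]

lemma multMean_const {b : ℕ} {v : Fin b → ℝ} (hv : v ∈ stdSimplex ℝ (Fin b)) (m : ℕ) (c : ℝ) :
    multMean m v (fun _ => c) = c := by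
  have := multMean_const_mul (m := m) v c (fun _ => 1)
  simpa [multMean_one hv] using this

/-- Throwing one more item: it goes to the child `j` with probability `v_j`. -/
lemma multMean_succ {b : ℕ} (m : ℕ) (v : Fin b → ℝ) (g : (Fin b → ℕ) → ℝ) :
    multMean (m + 1) v g = ∑ j, v j * multMean m v (fun k => g (k + Pi.single j 1)) := by
  have h1 : multMean (m + 1) v (fun k => ∑ j, (k j : ℝ) * g k)
      = ((m : ℝ) + 1) * multMean (m + 1) v g := by
    rw [← multMean_const_mul]
    refine multMean_congr fun k hk => ?_
    rw [← Finset.sum_mul, ← Nat.cast_sum, hk]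
    push_cast
    ring
  rw [multMean_sum] at h1
  simp only [multMean_succ_mul, mul_assoc, ← Finset.mul_sum] at h1
  exact (mul_left_cancel₀ (by positivity) h1).symm

lemma multMean_apply {b : ℕ} {v : Fin b → ℝ} (hv : v ∈ stdSimplex ℝ (Fin b)) (m : ℕ)
    (j : Fin b) : multMean m v (fun k => (k j : ℝ)) = m * v j := by
  cases m with
  | zero => simp [multMean, Finset.piAntidiag_zero]
  | succ m =>
    have := multMean_succ_mul m v j (fun _ => 1)
    simp only [mul_one, multMean_one hv] at this
    rw [this]; push_cast; ring

lemma multMean_sq {b : ℕ} {v : Fin b → ℝ} (hv : v ∈ stdSimplex ℝ (Fin b)) (m : ℕ)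
    (j : Fin b) : multMean m v (fun k => (k j : ℝ) ^ 2) = m * v j + m * (m - 1) * v j ^ 2 := by
  cases m with
  | zero => simp [multMean, Finset.piAntidiag_zero]
  | succ m =>
    have := multMean_succ_mul m v j (fun k => (k j : ℝ))
    simp only [Pi.add_apply, Pi.single_eq_same, Nat.cast_add, Nat.cast_one] at this
    rw [multMean_add, multMean_apply hv, multMean_one hv] at this
    simp only [pow_two, this]
    push_cast; ring

lemma multMean_sub_sq_le {b : ℕ} {v : Fin b → ℝ} (hv : v ∈ stdSimplex ℝ (Fin b)) (m : ℕ)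
    (j : Fin b) : multMean m v (fun k => ((k j : ℝ) - m * v j) ^ 2) ≤ m := by
  have h : (fun k : Fin b → ℕ => ((k j : ℝ) - m * v j) ^ 2)
      = fun k => ((k j : ℝ) ^ 2 - (2 * m * v j) * k j) + (m * v j) ^ 2 := by
    ext k; ring
  rw [h, multMean_add, multMean_sub, multMean_const_mul, multMean_const hv, multMean_apply hv,
    multMean_sq hv]
  have h0 := hv.1 j
  have h1 : v j ≤ 1 := (mem_Icc_of_mem_stdSimplex hv j).2
  have hm : (0 : ℝ) ≤ m := Nat.cast_nonneg m
  nlinarith [mul_nonneg hm h0, mul_nonneg hm (sub_nonneg.2 h1), mul_nonneg hm (mul_nonneg h0 h0)]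

/-- Size-biasing turns `1 / (k_j + 1)` into an indicator, so its mean is at most `1 / ((m + 1) v_j)`. -/
lemma mul_multMean_inv_le {b : ℕ} {v : Fin b → ℝ} (hv : v ∈ stdSimplex ℝ (Fin b)) (m : ℕ)
    (j : Fin b) : (m + 1) * v j * multMean m v (fun k => ((k j : ℝ) + 1)⁻¹) ≤ 1 := by
  have h := multMean_succ_mul m v j (fun k => ((k j : ℝ))⁻¹)
  simp only [Pi.add_apply, Pi.single_eq_same, Nat.cast_add, Nat.cast_one] at h
  rw [← h, ← multMean_one hv (m + 1)]
  refine multMean_mono hv.1 fun k _ => ?_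
  by_cases h0 : (k j : ℝ) = 0
  · simp [h0]
  · rw [mul_inv_cancel₀ h0]

/-! ### The joint law of a split vector and a throw -/

/-- The joint law of a split vector and of the way `m` items are thrown according to it. -/
def throwLaw {b : ℕ} (ν : Measure (Fin b → ℝ)) (m : ℕ) :
    Measure ((Fin b → ℝ) × (Fin b → ℕ)) :=
  ∑ k ∈ Finset.piAntidiag Finset.univ m,
    (ν.withDensity fun v => ENNReal.ofReal (multinomialProb m v k)).map fun v => (v, k)

lemma lintegral_throwLaw {b : ℕ} (ν : Measure (Fin b → ℝ)) (m : ℕ)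
    {F : (Fin b → ℝ) × (Fin b → ℕ) → ENNReal} (hF : Measurable F) :
    ∫⁻ p, F p ∂throwLaw ν m = ∫⁻ v, ∑ k ∈ Finset.piAntidiag Finset.univ m,
      ENNReal.ofReal (multinomialProb m v k) * F (v, k) ∂ν := by
  rw [throwLaw, lintegral_finsetSum_measure, lintegral_finsetSum]
  · refine Finset.sum_congr rfl fun k _ => ?_
    rw [lintegral_map hF (by fun_prop), lintegral_withDensity_eq_lintegral_mul _
      (measurable_multinomialProb m k).ennreal_ofReal (by fun_prop)]
    rfl
  · intro k _
    have := (measurable_multinomialProb m k).ennreal_ofReal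
    fun_prop

/-- A function of a split vector and a throw that is measurable, and for each throw bounded on the
simplex. -/
structure IsTame {b : ℕ} (F : (Fin b → ℝ) × (Fin b → ℕ) → ℝ) : Prop where
  measurable : Measurable F
  bounded : ∀ k, ∃ c, ∀ v ∈ stdSimplex ℝ (Fin b), |F (v, k)| ≤ c

section

variable {b : ℕ} {ν : Measure (Fin b → ℝ)}

lemma ae_throwLaw (hν : IsSplitLaw ν) (m : ℕ) :
    ∀ᵐ p ∂throwLaw ν m, p.1 ∈ stdSimplex ℝ (Fin b) ∧ ∑ i, p.2 i = m := by
  have hS : MeasurableSet (stdSimplex ℝ (Fin b)) := (isClosed_stdSimplex (𝕜 := ℝ) (Fin b)).measurableSet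
  have hT : MeasurableSet {p : (Fin b → ℝ) × (Fin b → ℕ) |
      ¬ (p.1 ∈ stdSimplex ℝ (Fin b) ∧ ∑ i, p.2 i = m)} := by
    have h1 : MeasurableSet {p : (Fin b → ℝ) × (Fin b → ℕ) | p.1 ∈ stdSimplex ℝ (Fin b)} :=
      measurable_fst hS
    have h2 : MeasurableSet {p : (Fin b → ℝ) × (Fin b → ℕ) | ∑ i, p.2 i = m} := by
      have : Measurable fun p : (Fin b → ℝ) × (Fin b → ℕ) => ∑ i, p.2 i := by fun_prop
      exact this (measurableSet_singleton m)
    exact (h1.inter h2).compl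
  rw [ae_iff, ← lintegral_indicator_one hT, lintegral_throwLaw ν m (measurable_one.indicator hT)]
  rw [lintegral_eq_zero_iff']
  · filter_upwards [hν.mem_simplex] with v hv
    refine Finset.sum_eq_zero fun k hk => ?_
    rw [Set.indicator_of_notMem, mul_zero]
    simp [hv, mem_piAntidiag_univ.1 hk]
  · refine Measurable.aemeasurable ?_
    refine Finset.measurable_sum _ fun k _ => ?_
    exact (measurable_multinomialProb m k).ennreal_ofReal.mul
      ((measurable_one.indicator hT).comp (by fun_prop))

lemma isProbabilityMeasure_throwLaw (hν : IsSplitLaw ν) (m : ℕ) :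
    IsProbabilityMeasure (throwLaw ν m) := by
  have := hν.isProbabilityMeasure
  constructor
  have h := lintegral_throwLaw ν m (F := fun _ => 1) measurable_const
  simp only [lintegral_const, one_mul, mul_one] at h
  rw [h, ← measure_univ (μ := ν), ← lintegral_one]
  refine lintegral_congr_ae ?_
  filter_upwards [hν.mem_simplex] with v hv
  rw [← ENNReal.ofReal_sum_of_nonneg fun k _ => multinomialProb_nonneg hv.1 m k]
  have := multMean_one hv m
  simp only [multMean, mul_one] at this
  simp [this]

lemma IsTame.integrable (hν : IsSplitLaw ν) {F : (Fin b → ℝ) × (Fin b → ℕ) → ℝ}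
    (hF : IsTame F) (m : ℕ) : Integrable F (throwLaw ν m) := by
  have := isProbabilityMeasure_throwLaw hν m
  choose c hc using hF.bounded
  refine Integrable.of_bound hF.measurable.aestronglyMeasurable
    (∑ k ∈ Finset.piAntidiag Finset.univ m, |c k|) ?_
  filter_upwards [ae_throwLaw hν m] with p hp
  refine (hc p.2 p.1 hp.1).trans ((le_abs_self _).trans ?_)
  exact Finset.single_le_sum (f := fun k => |c k|) (fun _ _ => abs_nonneg _)
    (mem_piAntidiag_univ.2 hp.2)

lemma IsTame.integral_eq (hν : IsSplitLaw ν) {F : (Fin b → ℝ) × (Fin b → ℕ) → ℝ}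
    (hF : IsTame F) (m : ℕ) :
    ∫ p, F p ∂throwLaw ν m = ∫ v, multMean m v (fun k => F (v, k)) ∂ν := by
  have hi := hF.integrable hν m
  have hk : ∀ k : Fin b → ℕ, Measurable fun v : Fin b → ℝ => F (v, k) := fun k =>
    hF.measurable.comp (by fun_prop)
  have := hν.isProbabilityMeasure
  have hle : ∀ v ∈ stdSimplex ℝ (Fin b), ∀ k ∈ Finset.piAntidiag Finset.univ m,
      |multinomialProb m v k| ≤ 1 := by
    intro v hv k hk
    rw [abs_of_nonneg (multinomialProb_nonneg hv.1 m k), ← multMean_one hv m]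
    simp only [multMean, mul_one]
    exact Finset.single_le_sum (fun k _ => multinomialProb_nonneg hv.1 m k) hk
  unfold multMean
  rw [integral_finsetSum]
  · rw [throwLaw] at hi ⊢
    rw [integrable_finsetSum_measure] at hi
    rw [integral_finsetSum_measure hi]
    refine Finset.sum_congr rfl fun k hk' => ?_
    rw [integral_map (by fun_prop) hF.measurable.aestronglyMeasurable,
      integral_withDensity_eq_integral_toReal_smul
        (measurable_multinomialProb m k).ennreal_ofReal (by simp)]
    refine integral_congr_ae ?_
    filter_upwards [hν.mem_simplex] with v hv
    simp [ENNReal.toReal_ofReal (multinomialProb_nonneg hv.1 m k)]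
  · intro k hk'
    obtain ⟨c, hc⟩ := hF.bounded k
    refine Integrable.of_bound
      ((measurable_multinomialProb m k).mul (hk k)).aestronglyMeasurable c ?_
    filter_upwards [hν.mem_simplex] with v hv
    rw [Real.norm_eq_abs, abs_mul]
    calc _ ≤ 1 * |F (v, k)| := mul_le_mul_of_nonneg_right (hle v hv k hk') (abs_nonneg _)
      _ ≤ c := by rw [one_mul]; exact hc v hv

lemma IsTame.add {F G : (Fin b → ℝ) × (Fin b → ℕ) → ℝ} (hF : IsTame F) (hG : IsTame G) :
    IsTame fun p => F p + G p := by
  refine ⟨hF.1.add hG.1, fun k => ?_⟩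
  obtain ⟨c, hc⟩ := hF.2 k
  obtain ⟨d, hd⟩ := hG.2 k
  exact ⟨c + d, fun v hv => (abs_add_le _ _).trans (add_le_add (hc v hv) (hd v hv))⟩

lemma IsTame.neg {F : (Fin b → ℝ) × (Fin b → ℕ) → ℝ} (hF : IsTame F) :
    IsTame fun p => - F p := by
  refine ⟨hF.1.neg, fun k => ?_⟩
  obtain ⟨c, hc⟩ := hF.2 k
  exact ⟨c, fun v hv => by simpa using hc v hv⟩

lemma IsTame.sub {F G : (Fin b → ℝ) × (Fin b → ℕ) → ℝ} (hF : IsTame F) (hG : IsTame G) :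
    IsTame fun p => F p - G p := by
  simpa [sub_eq_add_neg] using hF.add hG.neg

lemma IsTame.mul {F G : (Fin b → ℝ) × (Fin b → ℕ) → ℝ} (hF : IsTame F) (hG : IsTame G) :
    IsTame fun p => F p * G p := by
  refine ⟨hF.1.mul hG.1, fun k => ?_⟩
  obtain ⟨c, hc⟩ := hF.2 k
  obtain ⟨d, hd⟩ := hG.2 k
  refine ⟨c * d, fun v hv => ?_⟩
  rw [abs_mul]
  exact mul_le_mul (hc v hv) (hd v hv) (abs_nonneg _) ((abs_nonneg _).trans (hc v hv))

lemma IsTame.sum {ι : Type*} {t : Finset ι} {F : ι → (Fin b → ℝ) × (Fin b → ℕ) → ℝ}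
    (hF : ∀ i, IsTame (F i)) : IsTame fun p => ∑ i ∈ t, F i p := by
  refine ⟨Finset.measurable_sum _ fun i _ => (hF i).1, fun k => ?_⟩
  choose c hc using fun i => (hF i).2 k
  exact ⟨∑ i ∈ t, c i, fun v hv => (Finset.abs_sum_le_sum_abs _ _).trans
    (Finset.sum_le_sum fun i _ => hc i v hv)⟩

lemma IsTame.abs {F : (Fin b → ℝ) × (Fin b → ℕ) → ℝ} (hF : IsTame F) :
    IsTame fun p => |F p| :=
  ⟨hF.1.abs, fun k => by simpa using hF.2 k⟩

lemma IsTame.pow {F : (Fin b → ℝ) × (Fin b → ℕ) → ℝ} (hF : IsTame F) (n : ℕ) :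
    IsTame fun p => F p ^ n := by
  refine ⟨hF.1.pow_const n, fun k => ?_⟩
  obtain ⟨c, hc⟩ := hF.2 k
  exact ⟨c ^ n, fun v hv => by rw [abs_pow]; exact pow_le_pow_left₀ (abs_nonneg _) (hc v hv) n⟩

lemma IsTame.exp {F : (Fin b → ℝ) × (Fin b → ℕ) → ℝ} (hF : IsTame F) :
    IsTame fun p => Real.exp (F p) := by
  refine ⟨hF.1.exp, fun k => ?_⟩
  obtain ⟨c, hc⟩ := hF.2 k
  refine ⟨Real.exp c, fun v hv => ?_⟩
  rw [abs_of_pos (Real.exp_pos _)]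
  exact Real.exp_le_exp.2 ((le_abs_self _).trans (hc v hv))

lemma IsTame.const_mul {F : (Fin b → ℝ) × (Fin b → ℕ) → ℝ} (hF : IsTame F) (c : ℝ) :
    IsTame fun p => c * F p := by
  refine ⟨hF.1.const_mul c, fun k => ?_⟩
  obtain ⟨d, hd⟩ := hF.2 k
  exact ⟨|c| * d, fun v hv => by
    rw [abs_mul]; exact mul_le_mul_of_nonneg_left (hd v hv) (abs_nonneg c)⟩

lemma IsTame.integral_add (hν : IsSplitLaw ν) {F G : (Fin b → ℝ) × (Fin b → ℕ) → ℝ}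
    (hF : IsTame F) (hG : IsTame G) (m : ℕ) :
    ∫ p, (F p + G p) ∂throwLaw ν m = ∫ p, F p ∂throwLaw ν m + ∫ p, G p ∂throwLaw ν m :=
  MeasureTheory.integral_add (hF.integrable hν m) (hG.integrable hν m)

lemma isTame_throw (g : (Fin b → ℕ) → ℝ) :
    IsTame fun p : (Fin b → ℝ) × (Fin b → ℕ) => g p.2 :=
  ⟨(measurable_of_countable g).comp measurable_snd, fun k => ⟨|g k|, fun _ _ => le_rfl⟩⟩

lemma isTame_const (c : ℝ) : IsTame fun _ : (Fin b → ℝ) × (Fin b → ℕ) => c :=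
  ⟨measurable_const, fun _ => ⟨|c|, fun _ _ => le_rfl⟩⟩

lemma isTame_vector {g : (Fin b → ℝ) → ℝ} (hg : Measurable g) {c : ℝ}
    (hc : ∀ v ∈ stdSimplex ℝ (Fin b), |g v| ≤ c) :
    IsTame fun p : (Fin b → ℝ) × (Fin b → ℕ) => g p.1 :=
  ⟨hg.comp measurable_fst, fun _ => ⟨c, hc⟩⟩

lemma isTame_coord (i : Fin b) : IsTame fun p : (Fin b → ℝ) × (Fin b → ℕ) => p.1 i :=
  isTame_vector (g := fun v => v i) (by fun_prop) (c := 1) fun v hv => by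
    rw [abs_of_nonneg (hv.1 i)]; exact (mem_Icc_of_mem_stdSimplex hv i).2

lemma integral_throwLaw_vector (hν : IsSplitLaw ν) (m : ℕ) {g : (Fin b → ℝ) → ℝ}
    (hg : Measurable g) {c : ℝ} (hc : ∀ v ∈ stdSimplex ℝ (Fin b), |g v| ≤ c) :
    ∫ p, g p.1 ∂throwLaw ν m = ∫ v, g v ∂ν := by
  rw [(isTame_vector hg hc).integral_eq hν m]
  refine integral_congr_ae ?_
  filter_upwards [hν.mem_simplex] with v hv
  exact multMean_const hv m _

lemma integrable_vector (hν : IsSplitLaw ν) {g : (Fin b → ℝ) → ℝ}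
    (hg : Measurable g) {c : ℝ} (hc : ∀ v ∈ stdSimplex ℝ (Fin b), |g v| ≤ c) :
    Integrable g ν := by
  have := hν.isProbabilityMeasure
  refine Integrable.of_bound hg.aestronglyMeasurable c ?_
  filter_upwards [hν.mem_simplex] with v hv using hc v hv

/-- Comparison of integrals, when the conditional means given the split vector compare. -/
lemma IsTame.integral_mono (hν : IsSplitLaw ν) {F G : (Fin b → ℝ) × (Fin b → ℕ) → ℝ}
    (hF : IsTame F) (hG : IsTame G) (m : ℕ)
    (h : ∀ v ∈ stdSimplex ℝ (Fin b),
      multMean m v (fun k => F (v, k)) ≤ multMean m v (fun k => G (v, k))) :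
    ∫ p, F p ∂throwLaw ν m ≤ ∫ p, G p ∂throwLaw ν m := by
  rw [← sub_nonneg, ← integral_sub (hG.integrable hν m) (hF.integrable hν m),
    (hG.sub hF).integral_eq hν]
  refine integral_nonneg_of_ae ?_
  filter_upwards [hν.mem_simplex] with v hv
  rw [multMean_sub]
  exact sub_nonneg.2 (h v hv)

end

/-! ### Basic estimates for one split -/

lemma coord_le_one {b : ℕ} {v : Fin b → ℝ} (hv : v ∈ stdSimplex ℝ (Fin b)) (i : Fin b) :
    v i ≤ 1 := (mem_Icc_of_mem_stdSimplex hv i).2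

lemma sum_sq_le_one {b : ℕ} {v : Fin b → ℝ} (hv : v ∈ stdSimplex ℝ (Fin b)) :
    ∑ i, v i ^ 2 ≤ 1 := by
  rw [← hv.2]
  exact Finset.sum_le_sum fun i _ => by nlinarith [hv.1 i, coord_le_one hv i]

lemma eq_zero_of_eq_one {b : ℕ} {v : Fin b → ℝ} (hv : v ∈ stdSimplex ℝ (Fin b)) {i j : Fin b}
    (hi : v i = 1) (hij : j ≠ i) : v j = 0 := by
  have h := hv.2
  rw [← Finset.add_sum_erase _ _ (Finset.mem_univ i), hi] at h
  have h0 : ∑ x ∈ Finset.univ.erase i, v x = 0 := by linarith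
  exact (Finset.sum_eq_zero_iff_of_nonneg fun i _ => hv.1 i).1 h0 j
    (Finset.mem_erase.2 ⟨hij, Finset.mem_univ j⟩)

lemma exists_eq_one_of_forall {b : ℕ} {v : Fin b → ℝ} (hv : v ∈ stdSimplex ℝ (Fin b))
    (h : ∀ i, v i = 0 ∨ v i = 1) : ∃ i, v i = 1 := by
  by_contra! hne
  have : ∑ i, v i = 0 := Finset.sum_eq_zero fun i _ => (h i).resolve_right (hne i)
  rw [hv.2] at this
  exact one_ne_zero this

lemma sum_sq_lt_one {b : ℕ} {v : Fin b → ℝ} (hv : v ∈ stdSimplex ℝ (Fin b))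
    (h : ¬ ∃ i, v i = 1) : ∑ i, v i ^ 2 < 1 := by
  refine lt_of_le_of_ne (sum_sq_le_one hv) fun heq => h (exists_eq_one_of_forall hv fun i => ?_)
  rw [← hv.2] at heq
  have := (Finset.sum_eq_sum_iff_of_le fun i _ => by
    nlinarith [hv.1 i, coord_le_one hv i]).1 heq i (Finset.mem_univ i)
  have h2 : v i * (v i - 1) = 0 := by linarith
  rcases mul_eq_zero.1 h2 with h | h
  · exact Or.inl h
  · exact Or.inr (by linarith)

lemma abs_mul_log_le_one {x : ℝ} (h0 : 0 ≤ x) (h1 : x ≤ 1) : |x * Real.log x| ≤ 1 := by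
  rcases h0.eq_or_lt with rfl | h0
  · simp
  · rw [mul_comm]; exact (Real.abs_log_mul_self_lt x h0 h1).le

section

variable {b s s₀ s₁ : ℕ} {ν : Measure (Fin b → ℝ)}

lemma measurableSet_exists_eq_one : MeasurableSet {v : Fin b → ℝ | ∃ i, v i = 1} := by
  have : {v : Fin b → ℝ | ∃ i, v i = 1} = ⋃ i, (fun v => v i) ⁻¹' {1} := by ext; simp
  rw [this]
  exact MeasurableSet.iUnion fun i => (measurable_pi_apply i) (measurableSet_singleton 1)

/-- Non-degeneracy in measure form: with positive probability no `V_i` equals one. -/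
lemma measure_not_exists_pos (hν : IsSplitLaw ν) (hV : ν {v | ∃ i, v i = 1} < 1) :
    0 < ν {v | ¬ ∃ i, v i = 1} := by
  have := hν.isProbabilityMeasure
  have h : {v : Fin b → ℝ | ¬ ∃ i, v i = 1} = {v | ∃ i, v i = 1}ᶜ := rfl
  rw [h, prob_compl_eq_one_sub measurableSet_exists_eq_one]
  exact tsub_pos_of_lt hV

/-- A function that is nonnegative, and positive where no `V_i` equals one, has a positive mean. -/
lemma integral_pos_of_pos (hν : IsSplitLaw ν) (hV : ν {v | ∃ i, v i = 1} < 1)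
    {g : (Fin b → ℝ) → ℝ} (hg : Integrable g ν)
    (h0 : ∀ v ∈ stdSimplex ℝ (Fin b), 0 ≤ g v)
    (h1 : ∀ v ∈ stdSimplex ℝ (Fin b), (¬ ∃ i, v i = 1) → 0 < g v) : 0 < ∫ v, g v ∂ν := by
  rw [integral_pos_iff_support_of_nonneg_ae _ hg]
  · refine (measure_not_exists_pos hν hV).trans_le (measure_mono_ae ?_)
    filter_upwards [hν.mem_simplex] with v hv h
    exact (h1 v hv h).ne'
  · filter_upwards [hν.mem_simplex] with v hv using h0 v hv

lemma abs_sum_sq_le (v : Fin b → ℝ) (hv : v ∈ stdSimplex ℝ (Fin b)) : |∑ i, v i ^ 2| ≤ 1 := by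
  rw [abs_of_nonneg (Finset.sum_nonneg fun _ _ => sq_nonneg _)]
  exact sum_sq_le_one hv

lemma integral_sum_sq_lt_one (hν : IsSplitLaw ν) (hV : ν {v | ∃ i, v i = 1} < 1) :
    ∫ v, ∑ i, v i ^ 2 ∂ν < 1 := by
  have := hν.isProbabilityMeasure
  have hi : Integrable (fun v : Fin b → ℝ => ∑ i, v i ^ 2) ν :=
    integrable_vector hν (by fun_prop) abs_sum_sq_le
  have h := integral_pos_of_pos hν hV (g := fun v => 1 - ∑ i, v i ^ 2)
    ((integrable_const 1).sub hi) (fun v hv => sub_nonneg.2 (sum_sq_le_one hv))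
    (fun v hv h => sub_pos.2 (sum_sq_lt_one hv h))
  rw [integral_sub (integrable_const 1) hi] at h
  simp at h
  linarith

lemma integral_sum_sq_nonneg : 0 ≤ ∫ v, ∑ i, v i ^ 2 ∂ν :=
  integral_nonneg fun _ => Finset.sum_nonneg fun _ _ => sq_nonneg _

lemma abs_sum_mul_log_le (v : Fin b → ℝ) (hv : v ∈ stdSimplex ℝ (Fin b)) :
    |∑ i, v i * Real.log (v i)| ≤ b := by
  refine (Finset.abs_sum_le_sum_abs _ _).trans ?_
  refine (Finset.sum_le_sum fun i _ => abs_mul_log_le_one (hv.1 i) (coord_le_one hv i)).trans ?_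
  simp

lemma measurable_sum_mul_log : Measurable fun v : Fin b → ℝ => ∑ i, v i * Real.log (v i) := by
  fun_prop

lemma meanLog_eq : meanLog ν = - ∫ v, ∑ i, v i * Real.log (v i) ∂ν := by
  rw [meanLog, ← integral_neg]
  congr 1; ext v; simp

lemma meanLog_pos (hν : IsSplitLaw ν) (hV : ν {v | ∃ i, v i = 1} < 1) : 0 < meanLog ν := by
  have hi := integrable_vector hν measurable_sum_mul_log abs_sum_mul_log_le
  have hn : ∀ v ∈ stdSimplex ℝ (Fin b), ∀ i, 0 ≤ v i * (-Real.log (v i)) := fun v hv i =>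
    mul_nonneg (hv.1 i) (by linarith [Real.log_nonpos (hv.1 i) (coord_le_one hv i)])
  refine integral_pos_of_pos hν hV ?_ (fun v hv => Finset.sum_nonneg fun i _ => hn v hv i) ?_
  · simpa using hi.neg
  · intro v hv h
    refine lt_of_le_of_ne (Finset.sum_nonneg fun i _ => hn v hv i) fun heq => h ?_
    refine exists_eq_one_of_forall hv fun i => ?_
    have := (Finset.sum_eq_zero_iff_of_nonneg fun i _ => hn v hv i).1 heq.symm i
      (Finset.mem_univ i)
    rcases mul_eq_zero.1 this with h | h
    · exact Or.inl h
    · rcases Real.log_eq_zero.1 (neg_eq_zero.1 h) with h | h | h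
      · exact Or.inl h
      · exact Or.inr h
      · linarith [hv.1 i]

lemma two_le (hν : IsSplitLaw ν) (hV : ν {v | ∃ i, v i = 1} < 1) : 2 ≤ b := by
  have := hν.isProbabilityMeasure
  by_contra! hb
  refine hV.ne ((mem_ae_iff_prob_eq_one measurableSet_exists_eq_one).1 ?_)
  filter_upwards [hν.mem_simplex] with v hv
  have h2 := hv.2
  interval_cases b
  · simp at h2
  · exact ⟨0, by simpa using h2⟩

lemma throws_add_eq (hs : IsAdmissible b s s₀ s₁) {n : ℕ} (hn : s < n) :
    n - s₀ - b * s₁ + s₀ + b * s₁ = n := by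
  have := hs.le
  omega

lemma sum_child (hs : IsAdmissible b s s₀ s₁) {n : ℕ} (hn : s < n) {k : Fin b → ℕ}
    (hk : ∑ i, k i = n - s₀ - b * s₁) : ∑ i, (k i + s₁) + s₀ = n := by
  have := throws_add_eq hs hn
  rw [Finset.sum_add_distrib, hk]
  simp
  omega

lemma child_le (hs : IsAdmissible b s s₀ s₁) {n : ℕ} (hn : s < n) {k : Fin b → ℕ}
    (hk : ∑ i, k i = n - s₀ - b * s₁) (i : Fin b) : k i + s₁ ≤ n := by
  have h1 := sum_child hs hn hk
  have h2 : k i + s₁ ≤ ∑ i, (k i + s₁) :=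
    Finset.single_le_sum (f := fun i => k i + s₁) (fun _ _ => Nat.zero_le _) (Finset.mem_univ i)
  omega

/-- The squared sizes of the children lose a fixed proportion in the mean. -/
lemma integral_child_sq_le (hs : IsAdmissible b s s₀ s₁) (hν : IsSplitLaw ν)
    (hV : ν {v | ∃ i, v i = 1} < 1) {n : ℕ} (hn : s < n) :
    ∫ p, ∑ i, ((p.2 i + s₁ : ℕ) : ℝ) ^ 2 ∂throwLaw ν (n - s₀ - b * s₁)
      ≤ (1 - (1 - ∫ v, ∑ i, v i ^ 2 ∂ν) / 4) * (n : ℝ) ^ 2 := by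
  have := hν.isProbabilityMeasure
  have hb := two_le hν hV
  have hρ := integral_sum_sq_lt_one hν hV
  have hρ0 := integral_sum_sq_nonneg (ν := ν)
  have hi : Integrable (fun v : Fin b → ℝ => ∑ i, v i ^ 2) ν :=
    integrable_vector hν (by fun_prop) abs_sum_sq_le
  have hnm := throws_add_eq hs hn
  set m := n - s₀ - b * s₁ with hm
  rw [(isTame_throw fun k => ∑ i, ((k i + s₁ : ℕ) : ℝ) ^ 2).integral_eq hν]
  have h1 : ∫ v, multMean m v (fun k => ∑ i, ((k i + s₁ : ℕ) : ℝ) ^ 2) ∂ν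
      = ∫ v, ((m + 2 * s₁ * m + b * s₁ ^ 2 : ℝ) + m * (m - 1) * ∑ i, v i ^ 2) ∂ν := by
    refine integral_congr_ae ?_
    filter_upwards [hν.mem_simplex] with v hv
    have h2 : ∀ i, multMean m v (fun k => ((k i + s₁ : ℕ) : ℝ) ^ 2)
        = (m + 2 * s₁ * m) * v i + m * (m - 1) * v i ^ 2 + s₁ ^ 2 := by
      intro i
      have : (fun k : Fin b → ℕ => ((k i + s₁ : ℕ) : ℝ) ^ 2)
          = fun k => ((k i : ℝ) ^ 2 + 2 * s₁ * k i) + (s₁ : ℝ) ^ 2 := by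
        ext k; push_cast; ring
      rw [this, multMean_add, multMean_add, multMean_const hv, multMean_const_mul,
        multMean_apply hv, multMean_sq hv]
      ring
    rw [multMean_sum]
    simp only [h2, Finset.sum_add_distrib, ← Finset.mul_sum, hv.2]
    simp
    ring
  rw [h1, integral_add (integrable_const _) (hi.const_mul _), integral_const_mul]
  simp only [integral_const, probReal_univ, one_smul]
  set ρ := ∫ v, ∑ i, v i ^ 2 ∂ν
  have hnr : (n : ℝ) = m + s₀ + b * s₁ := by exact_mod_cast hnm.symm
  have hbr : (2 : ℝ) ≤ b := by exact_mod_cast hb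
  have hmr : (0 : ℝ) ≤ m := Nat.cast_nonneg m
  have hs0r : (0 : ℝ) ≤ s₀ := Nat.cast_nonneg _
  have hs1r : (0 : ℝ) ≤ s₁ := Nat.cast_nonneg _
  rw [hnr]
  set κ := 1 - ρ with hκ
  have hκ0 : 0 < κ := sub_pos.2 hρ
  have hκ1 : κ ≤ 1 := by linarith
  have hρκ : ρ = 1 - κ := by ring
  rw [hρκ]
  by_cases ht : s₀ + b * s₁ = 0
  · have h0 : s₀ = 0 := by omega
    have h1 : b * s₁ = 0 := by omega
    have h1' : s₁ = 0 := by
      rcases Nat.mul_eq_zero.1 h1 with h | h <;> omega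
    have hm2 : 2 ≤ m := by
      rcases hs.pos with h | h <;> omega
    have hm2r : (2 : ℝ) ≤ m := by exact_mod_cast hm2
    simp only [h0, h1', Nat.cast_zero]
    nlinarith [mul_nonneg hκ0.le (mul_nonneg hmr (sub_nonneg.2 hm2r)),
      mul_nonneg hκ0.le (mul_nonneg hmr hmr)]
  · have hq : 1 ≤ s₀ + (b - 1) * s₁ := by
      rcases Nat.eq_zero_or_pos s₀ with h | h
      · have : 0 < s₁ := by
          rcases Nat.eq_zero_or_pos s₁ with h' | h'
          · simp [h, h'] at ht
          · exact h'
        have : 0 < (b - 1) * s₁ := Nat.mul_pos (by omega) this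
        omega
      · omega
    have hqr : (1 : ℝ) ≤ s₀ + (b - 1) * s₁ := by
      have : ((1 : ℕ) : ℝ) ≤ ((s₀ + (b - 1) * s₁ : ℕ) : ℝ) := by exact_mod_cast hq
      rw [Nat.cast_add, Nat.cast_mul, Nat.cast_sub (by omega)] at this
      simpa using this
    set t : ℝ := s₀ + b * s₁ with htr
    have hbs : (b : ℝ) * s₁ ^ 2 ≤ t ^ 2 / 2 := by
      have h3 : ((b : ℝ) * s₁) ^ 2 ≤ t ^ 2 := by
        apply pow_le_pow_left₀ (by positivity); linarith
      nlinarith [mul_nonneg (sub_nonneg.2 hbr) (mul_nonneg (Nat.cast_nonneg (α := ℝ) b)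
        (sq_nonneg (s₁ : ℝ)))]
    have h4 : m * κ ≤ m * (s₀ + (b - 1) * s₁) :=
      mul_le_mul_of_nonneg_left (hκ1.trans hqr) hmr
    have h5 : κ * t ^ 2 ≤ t ^ 2 := by nlinarith [sq_nonneg t]
    have h6 : κ * (m + t) ^ 2 ≤ κ * (2 * (m ^ 2 + t ^ 2)) :=
      mul_le_mul_of_nonneg_left (by nlinarith [sq_nonneg ((m : ℝ) - t)]) hκ0.le
    have h7 : (m : ℝ) + s₀ + b * s₁ = m + t := by rw [htr]; ring
    rw [h7]
    have h8 : (m + t) ^ 2 - (m + 2 * s₁ * m + b * s₁ ^ 2 + m * (m - 1) * (1 - κ))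
      = κ * m ^ 2 - κ * m + 2 * (m * (s₀ + (b - 1) * s₁)) + t ^ 2 - b * s₁ ^ 2 := by
      rw [htr]; ring
    nlinarith [mul_nonneg hκ0.le (mul_nonneg hmr hmr), mul_nonneg hκ0.le hmr]

/-- The child that contains a random item is smaller by a fixed proportion in the mean. -/
lemma le_integral_sizeBiased_loss (hs : IsAdmissible b s s₀ s₁) (hν : IsSplitLaw ν)
    (hV : ν {v | ∃ i, v i = 1} < 1) {n : ℕ} (hn : s < n) :
    (1 - ∫ v, ∑ i, v i ^ 2 ∂ν) / 2 * n
      ≤ ∫ p, ∑ i, p.1 i * ((n : ℝ) - (p.2 i + s₁ : ℕ)) ∂throwLaw ν (n - s₀ - b * s₁) := by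
  have := hν.isProbabilityMeasure
  have hb := two_le hν hV
  have hρ := integral_sum_sq_lt_one hν hV
  have hρ0 := integral_sum_sq_nonneg (ν := ν)
  have hi : Integrable (fun v : Fin b → ℝ => ∑ i, v i ^ 2) ν :=
    integrable_vector hν (by fun_prop) abs_sum_sq_le
  have hnm := throws_add_eq hs hn
  set m := n - s₀ - b * s₁ with hm
  have htame : IsTame fun p : (Fin b → ℝ) × (Fin b → ℕ) =>
      ∑ i, p.1 i * ((n : ℝ) - (p.2 i + s₁ : ℕ)) :=
    IsTame.sum fun i => (isTame_coord i).mul (isTame_throw fun k => (n : ℝ) - (k i + s₁ : ℕ))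
  rw [htame.integral_eq hν]
  have h1 : ∫ v, multMean m v (fun k => ∑ i, v i * ((n : ℝ) - (k i + s₁ : ℕ))) ∂ν
      = ∫ v, ((n - s₁ : ℝ) - m * ∑ i, v i ^ 2) ∂ν := by
    refine integral_congr_ae ?_
    filter_upwards [hν.mem_simplex] with v hv
    have h2 : ∀ i, multMean m v (fun k => v i * ((n : ℝ) - (k i + s₁ : ℕ)))
        = (n - s₁) * v i - m * v i ^ 2 := by
      intro i
      have : (fun k : Fin b → ℕ => v i * ((n : ℝ) - (k i + s₁ : ℕ)))
          = fun k => v i * (n - s₁) - v i * k i := by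
        ext k; push_cast; ring
      rw [this, multMean_sub, multMean_const hv, multMean_const_mul,
        multMean_apply hv]
      ring
    rw [multMean_sum]
    simp only [h2, Finset.sum_sub_distrib, ← Finset.mul_sum, hv.2]
    simp
  rw [h1, integral_sub (integrable_const _) (hi.const_mul _), integral_const_mul]
  simp only [integral_const, probReal_univ, one_smul]
  set ρ := ∫ v, ∑ i, v i ^ 2 ∂ν
  have hnr : (n : ℝ) = m + s₀ + b * s₁ := by exact_mod_cast hnm.symm
  have hbr : (2 : ℝ) ≤ b := by exact_mod_cast hb
  have hmr : (0 : ℝ) ≤ m := Nat.cast_nonneg m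
  have hs0r : (0 : ℝ) ≤ s₀ := Nat.cast_nonneg _
  have hs1r : (0 : ℝ) ≤ s₁ := Nat.cast_nonneg _
  have hbs := mul_nonneg (sub_nonneg.2 hbr) hs1r
  rw [hnr]
  nlinarith [mul_nonneg (sub_nonneg.2 hρ.le) hmr, mul_nonneg hρ0 hs0r,
    mul_nonneg hρ0 (mul_nonneg (Nat.cast_nonneg (α := ℝ) b) hs1r)]

/-! ### The mean path length -/

/-- The mean of the path length truncated at depth `d`, as a recursion in `d`. -/
def meanTrunc (s s₀ s₁ : ℕ) {b : ℕ} (ν : Measure (Fin b → ℝ)) : ℕ → ℕ → ENNReal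
  | 0, _ => 0
  | d + 1, n => if s < n then
      ∫⁻ p, ∑ i, (((p.2 i + s₁ : ℕ) : ENNReal) + meanTrunc s s₀ s₁ ν d (p.2 i + s₁))
        ∂throwLaw ν (n - s₀ - b * s₁)
    else 0

/-- The mean path length of a split tree with `n` items, as the limit of the truncated means. It is
defined without reference to a probability space; `toReal` loses nothing, by
`iSup_meanTrunc_ne_top`. -/
def meanPath (s s₀ s₁ : ℕ) {b : ℕ} (ν : Measure (Fin b → ℝ)) (n : ℕ) : ℝ :=
  (⨆ d, meanTrunc s s₀ s₁ ν d n).toReal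

lemma meanTrunc_mono (n : ℕ) : Monotone fun d => meanTrunc s s₀ s₁ ν d n := by
  refine monotone_nat_of_le_succ fun d => ?_
  induction d generalizing n with
  | zero => simp [meanTrunc]
  | succ d ih =>
    rw [meanTrunc, meanTrunc]
    split_ifs
    · refine lintegral_mono fun p => Finset.sum_le_sum fun i _ => ?_
      gcongr
      exact ih _
    · exact le_rfl

/-- A quadratic bound, uniform in the truncation: the squared sizes of the children lose a fixed
proportion in the mean, which pays for the `n` items that move down. -/
lemma meanTrunc_le (hs : IsAdmissible b s s₀ s₁) (hν : IsSplitLaw ν)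
    (hV : ν {v | ∃ i, v i = 1} < 1) (d n : ℕ) :
    meanTrunc s s₀ s₁ ν d n
      ≤ ENNReal.ofReal (((1 - ∫ v, ∑ i, v i ^ 2 ∂ν) / 4)⁻¹ * (n : ℝ) ^ 2) := by
  have hρ := integral_sum_sq_lt_one hν hV
  set κ := (1 - ∫ v, ∑ i, v i ^ 2 ∂ν) / 4 with hκ
  have hκ0 : 0 < κ := by rw [hκ]; linarith
  induction d generalizing n with
  | zero => simp [meanTrunc]
  | succ d ih =>
    rw [meanTrunc]
    split_ifs with hn
    · have hsq := integral_child_sq_le hs hν hV hn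
      rw [← hκ] at hsq
      have hP := isProbabilityMeasure_throwLaw hν (n - s₀ - b * s₁)
      have hi := (isTame_throw (b := b) fun k => ∑ i, ((k i + s₁ : ℕ) : ℝ) ^ 2).integrable hν
        (n - s₀ - b * s₁)
      calc _ ≤ ∫⁻ p, ENNReal.ofReal (n + κ⁻¹ * ∑ i, ((p.2 i + s₁ : ℕ) : ℝ) ^ 2)
            ∂throwLaw ν (n - s₀ - b * s₁) := by
            refine lintegral_mono_ae ?_
            filter_upwards [ae_throwLaw hν (n - s₀ - b * s₁)] with p hp
            have hsum : (∑ i, ((p.2 i + s₁ : ℕ) : ℝ)) ≤ n := by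
              rw [← Nat.cast_sum]
              have := sum_child hs hn hp.2
              exact_mod_cast (by omega)
            refine (Finset.sum_le_sum fun i _ => add_le_add le_rfl (ih _)).trans ?_
            have : ∀ i, ((p.2 i + s₁ : ℕ) : ENNReal)
                + ENNReal.ofReal (κ⁻¹ * ((p.2 i + s₁ : ℕ) : ℝ) ^ 2)
                = ENNReal.ofReal (((p.2 i + s₁ : ℕ) : ℝ) + κ⁻¹ * ((p.2 i + s₁ : ℕ) : ℝ) ^ 2) := by
              intro i
              rw [ENNReal.ofReal_add (by positivity) (by positivity), ENNReal.ofReal_natCast]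
            simp only [this]
            rw [← ENNReal.ofReal_sum_of_nonneg fun i _ => by positivity]
            refine ENNReal.ofReal_le_ofReal ?_
            rw [Finset.sum_add_distrib, ← Finset.mul_sum]
            linarith
        _ = ENNReal.ofReal (n + κ⁻¹ * ∫ p, ∑ i, ((p.2 i + s₁ : ℕ) : ℝ) ^ 2
            ∂throwLaw ν (n - s₀ - b * s₁)) := by
            have hi' : Integrable (fun p : (Fin b → ℝ) × (Fin b → ℕ) =>
                (n : ℝ) + κ⁻¹ * ∑ i, ((p.2 i + s₁ : ℕ) : ℝ) ^ 2) (throwLaw ν (n - s₀ - b * s₁)) :=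
              (integrable_const _).add (hi.const_mul _)
            rw [← ofReal_integral_eq_lintegral_ofReal hi' (ae_of_all _ fun p => by positivity),
              integral_add (integrable_const _) (hi.const_mul _), integral_const_mul]
            simp
        _ ≤ _ := by
            refine ENNReal.ofReal_le_ofReal ?_
            have hn1 : (1 : ℝ) ≤ n := by exact_mod_cast (by omega : 1 ≤ n)
            have h3 : κ⁻¹ * ∫ p, ∑ i, ((p.2 i + s₁ : ℕ) : ℝ) ^ 2 ∂throwLaw ν (n - s₀ - b * s₁)
                ≤ κ⁻¹ * ((1 - κ) * (n : ℝ) ^ 2) :=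
              mul_le_mul_of_nonneg_left hsq (inv_nonneg.2 hκ0.le)
            have h4 : κ⁻¹ * ((1 - κ) * (n : ℝ) ^ 2) = κ⁻¹ * (n : ℝ) ^ 2 - (n : ℝ) ^ 2 := by
              field_simp
            nlinarith
    · simp

lemma iSup_meanTrunc_ne_top (hs : IsAdmissible b s s₀ s₁) (hν : IsSplitLaw ν)
    (hV : ν {v | ∃ i, v i = 1} < 1) (n : ℕ) : ⨆ d, meanTrunc s s₀ s₁ ν d n ≠ ⊤ :=
  ((iSup_le fun d => meanTrunc_le hs hν hV d n).trans_lt ENNReal.ofReal_lt_top).ne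

lemma ofReal_meanPath (hs : IsAdmissible b s s₀ s₁) (hν : IsSplitLaw ν)
    (hV : ν {v | ∃ i, v i = 1} < 1) (n : ℕ) :
    ENNReal.ofReal (meanPath s s₀ s₁ ν n) = ⨆ d, meanTrunc s s₀ s₁ ν d n :=
  ENNReal.ofReal_toReal (iSup_meanTrunc_ne_top hs hν hV n)

lemma meanPath_nonneg (n : ℕ) : 0 ≤ meanPath s s₀ s₁ ν n := ENNReal.toReal_nonneg

lemma meanPath_of_le {n : ℕ} (hn : n ≤ s) : meanPath s s₀ s₁ ν n = 0 := by
  have : ∀ d, meanTrunc s s₀ s₁ ν d n = 0 := by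
    intro d
    cases d <;> simp [meanTrunc, hn.not_gt]
  simp [meanPath, this]

lemma meanPath_eq_integral (hs : IsAdmissible b s s₀ s₁) (hν : IsSplitLaw ν)
    (hV : ν {v | ∃ i, v i = 1} < 1) {n : ℕ} (hn : s < n) :
    meanPath s s₀ s₁ ν n = ∫ p, ∑ i, (((p.2 i + s₁ : ℕ) : ℝ) + meanPath s s₀ s₁ ν (p.2 i + s₁))
      ∂throwLaw ν (n - s₀ - b * s₁) := by
  have h0 : ∀ k : Fin b → ℕ,
      0 ≤ ∑ i, (((k i + s₁ : ℕ) : ℝ) + meanPath s s₀ s₁ ν (k i + s₁)) := fun k =>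
    Finset.sum_nonneg fun i _ => add_nonneg (Nat.cast_nonneg _) (meanPath_nonneg _)
  have h2 : ∀ k : Fin b → ℕ,
      ENNReal.ofReal (∑ i, (((k i + s₁ : ℕ) : ℝ) + meanPath s s₀ s₁ ν (k i + s₁)))
        = ⨆ d, ∑ i, (((k i + s₁ : ℕ) : ENNReal) + meanTrunc s s₀ s₁ ν d (k i + s₁)) := by
    intro k
    rw [ENNReal.ofReal_sum_of_nonneg fun i _ => add_nonneg (Nat.cast_nonneg _) (meanPath_nonneg _)]
    rw [← ENNReal.finsetSum_iSup_of_monotone]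
    · refine Finset.sum_congr rfl fun i _ => ?_
      rw [ENNReal.ofReal_add (Nat.cast_nonneg _) (meanPath_nonneg _), ofReal_meanPath hs hν hV,
        ENNReal.ofReal_natCast, ENNReal.add_iSup]
    · intro i d d' hd
      exact add_le_add le_rfl (meanTrunc_mono _ hd)
  have h1 : (⨆ d, meanTrunc s s₀ s₁ ν d n) = ⨆ d, meanTrunc s s₀ s₁ ν (d + 1) n :=
    ((meanTrunc_mono n).iSup_nat_add 1).symm
  set F : (Fin b → ℕ) → ℝ := fun k =>
    ∑ i, (((k i + s₁ : ℕ) : ℝ) + meanPath s s₀ s₁ ν (k i + s₁)) with hF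
  have h3 : ∫ p, F p.2 ∂throwLaw ν (n - s₀ - b * s₁)
      = (∫⁻ p, ENNReal.ofReal (F p.2) ∂throwLaw ν (n - s₀ - b * s₁)).toReal :=
    integral_eq_lintegral_of_nonneg_ae (ae_of_all _ fun p => h0 p.2)
      (isTame_throw F).measurable.aestronglyMeasurable
  refine Eq.trans ?_ h3.symm
  simp only [show ∀ k, ENNReal.ofReal (F k) = _ from h2]
  rw [meanPath, h1]
  simp only [meanTrunc, if_pos hn]
  rw [← lintegral_iSup]
  · intro d
    refine (measurable_of_countable (fun k : Fin b → ℕ => ∑ i, (((k i + s₁ : ℕ) : ENNReal)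
      + meanTrunc s s₀ s₁ ν d (k i + s₁)))).comp measurable_snd
  · intro d d' hd p
    exact Finset.sum_le_sum fun i _ => add_le_add le_rfl (meanTrunc_mono _ hd)

end

/-! ### Growth of the mean path length -/

section

variable {b s s₀ s₁ : ℕ} {ν : Measure (Fin b → ℝ)}

lemma meanPath_rec (hs : IsAdmissible b s s₀ s₁) (hν : IsSplitLaw ν)
    (hV : ν {v | ∃ i, v i = 1} < 1) {n : ℕ} (hn : s < n) :
    meanPath s s₀ s₁ ν n = (n - s₀) +
      ∫ p, ∑ i, meanPath s s₀ s₁ ν (p.2 i + s₁) ∂throwLaw ν (n - s₀ - b * s₁) := by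
  have hP := isProbabilityMeasure_throwLaw hν (n - s₀ - b * s₁)
  have hi := (isTame_throw (b := b) fun k => ∑ i, meanPath s s₀ s₁ ν (k i + s₁)).integrable hν
    (n - s₀ - b * s₁)
  have h1 : ∫ p, ((n - s₀ : ℝ) + ∑ i, meanPath s s₀ s₁ ν (p.2 i + s₁))
      ∂throwLaw ν (n - s₀ - b * s₁) = (n - s₀) +
      ∫ p, ∑ i, meanPath s s₀ s₁ ν (p.2 i + s₁) ∂throwLaw ν (n - s₀ - b * s₁) := by
    rw [integral_add (integrable_const _) hi]
    simp
  rw [meanPath_eq_integral hs hν hV hn, ← h1]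
  refine integral_congr_ae ?_
  filter_upwards [ae_throwLaw hν (n - s₀ - b * s₁)] with p hp
  rw [Finset.sum_add_distrib, ← Nat.cast_sum]
  have : ((∑ i, (p.2 i + s₁) : ℕ) : ℝ) + s₀ = n := by exact_mod_cast sum_child hs hn hp.2
  rw [← this]
  ring

/-- One more item adds one to the path length and then goes to the child `j` with
probability `V_j`. -/
lemma meanPath_succ_sub (hs : IsAdmissible b s s₀ s₁) (hν : IsSplitLaw ν)
    (hV : ν {v | ∃ i, v i = 1} < 1) {n : ℕ} (hn : s < n) :
    meanPath s s₀ s₁ ν (n + 1) - meanPath s s₀ s₁ ν n = 1 +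
      ∫ p, ∑ j, p.1 j * (meanPath s s₀ s₁ ν (p.2 j + s₁ + 1) - meanPath s s₀ s₁ ν (p.2 j + s₁))
        ∂throwLaw ν (n - s₀ - b * s₁) := by
  set e := meanPath s s₀ s₁ ν with he
  have hnm := throws_add_eq hs hn
  have hm1 : n + 1 - s₀ - b * s₁ = n - s₀ - b * s₁ + 1 := by omega
  have h1 := meanPath_rec hs hν hV hn
  have h2 := meanPath_rec hs hν hV (n := n + 1) (by omega)
  rw [hm1] at h2
  set m := n - s₀ - b * s₁
  have ht := isTame_throw (b := b) fun k => ∑ i, e (k i + s₁)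
  have ht' : IsTame fun p : (Fin b → ℝ) × (Fin b → ℕ) =>
      ∑ j, p.1 j * (e (p.2 j + s₁ + 1) - e (p.2 j + s₁)) := IsTame.sum fun j =>
    (isTame_coord j).mul (isTame_throw fun k => e (k j + s₁ + 1) - e (k j + s₁))
  have h3 : ∫ p, ∑ i, e (p.2 i + s₁) ∂throwLaw ν (m + 1)
      = ∫ p, ∑ i, e (p.2 i + s₁) ∂throwLaw ν m
        + ∫ p, ∑ j, p.1 j * (e (p.2 j + s₁ + 1) - e (p.2 j + s₁)) ∂throwLaw ν m := by
    rw [← integral_add (ht.integrable hν m) (ht'.integrable hν m),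
      (ht.add ht').integral_eq hν, ht.integral_eq hν]
    refine integral_congr_ae ?_
    filter_upwards [hν.mem_simplex] with v hv
    rw [multMean_succ, multMean_add, multMean_sum (v := v) (m := m)
      (g := fun j k => v j * (e (k j + s₁ + 1) - e (k j + s₁)))]
    have h4 : ∀ j, multMean m v (fun k => ∑ i, e ((k + Pi.single j 1 : Fin b → ℕ) i + s₁))
        = multMean m v (fun k => ∑ i, e (k i + s₁))
          + multMean m v (fun k => e (k j + s₁ + 1) - e (k j + s₁)) := by
      intro j
      rw [← multMean_add]
      refine multMean_congr fun k _ => ?_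
      rw [← Finset.add_sum_erase _ _ (Finset.mem_univ j),
        ← Finset.add_sum_erase _ (fun i => e (k i + s₁)) (Finset.mem_univ j)]
      have h5 : ∑ i ∈ Finset.univ.erase j, e ((k + Pi.single j 1 : Fin b → ℕ) i + s₁)
          = ∑ i ∈ Finset.univ.erase j, e (k i + s₁) :=
        Finset.sum_congr rfl fun i hi => by simp [Finset.ne_of_mem_erase hi]
      rw [h5]
      have h6 : (k + Pi.single j 1 : Fin b → ℕ) j + s₁ = k j + s₁ + 1 := by simp; omega
      rw [h6]; ring
    simp only [h4, mul_add, Finset.sum_add_distrib, ← Finset.sum_mul, hv.2, one_mul,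
      multMean_const_mul]
  rw [← he] at h1 h2
  rw [h2, h1, h3]
  push_cast
  ring

/-- In the recursion for the increments, `ln (n + 1) / μ` is a solution up to an error `O(1/n)`. -/
lemma abs_log_defect_le (hs : IsAdmissible b s s₀ s₁) (hν : IsSplitLaw ν)
    {n : ℕ} (hn : s < n) :
    |∫ p, ∑ j, p.1 j * (Real.log ((p.2 j + s₁ : ℕ) + 1) - Real.log (n + 1) - Real.log (p.1 j))
        ∂throwLaw ν (n - s₀ - b * s₁)|
      ≤ b * (s₁ + 1 + (s₀ + b * s₁) * (s₀ + b * s₁ + 1)) / (n + 1) := by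
  have hprob := hν.isProbabilityMeasure
  have hnm := throws_add_eq hs hn
  set m := n - s₀ - b * s₁ with hm
  have hnr : (n : ℝ) = m + (s₀ + b * s₁) := by
    have : (n : ℝ) = m + s₀ + b * s₁ := by exact_mod_cast hnm.symm
    rw [this]; ring
  set t : ℝ := s₀ + b * s₁ with ht
  have ht0 : 0 ≤ t := by positivity
  have hm0 : (0 : ℝ) ≤ m := Nat.cast_nonneg m
  have htame : ∀ j, IsTame fun p : (Fin b → ℝ) × (Fin b → ℕ) =>
      p.1 j * (Real.log ((p.2 j + s₁ : ℕ) + 1) - Real.log (n + 1) - Real.log (p.1 j)) := by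
    intro j
    have h1 := ((isTame_coord j).mul (isTame_throw fun k : Fin b → ℕ =>
      Real.log ((k j + s₁ : ℕ) + 1) - Real.log (n + 1))).sub
      (isTame_vector (g := fun v : Fin b → ℝ => v j * Real.log (v j)) (by fun_prop) (c := 1)
        fun v hv => abs_mul_log_le_one (hv.1 j) (coord_le_one hv j))
    simpa only [mul_sub] using h1
  -- the upper bound, by `ln x ≤ x - 1`
  have hup : ∀ v ∈ stdSimplex ℝ (Fin b), ∀ j, multMean m v (fun k =>
      v j * (Real.log ((k j + s₁ : ℕ) + 1) - Real.log (n + 1) - Real.log (v j)))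
        ≤ (s₁ + 1) / (n + 1) := by
    intro v hv j
    have hle : multMean m v (fun k =>
        v j * (Real.log ((k j + s₁ : ℕ) + 1) - Real.log (n + 1) - Real.log (v j)))
        ≤ multMean m v (fun k => (n + 1 : ℝ)⁻¹ * k j + ((s₁ + 1) / (n + 1) - v j)) := by
      refine multMean_mono hv.1 fun k _ => ?_
      have heq : (n + 1 : ℝ)⁻¹ * k j + ((s₁ + 1) / (n + 1) - v j)
          = ((k j + s₁ : ℕ) + 1 : ℝ) / (n + 1) - v j := by push_cast; field_simp; ring
      rw [heq]
      rcases (hv.1 j).eq_or_lt with h0 | h0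
      · rw [← h0]; simp; positivity
      · have h1 := Real.log_le_sub_one_of_pos
          (x := ((k j + s₁ : ℕ) + 1 : ℝ) / ((n + 1) * v j)) (by positivity)
        rw [Real.log_div (by positivity) (by positivity), Real.log_mul (by positivity) h0.ne'] at h1
        have h2 := mul_le_mul_of_nonneg_left h1 h0.le
        have h3 : v j * (((k j + s₁ : ℕ) + 1 : ℝ) / ((n + 1) * v j) - 1)
            = ((k j + s₁ : ℕ) + 1 : ℝ) / (n + 1) - v j := by field_simp
        rw [h3] at h2
        linarith
    refine hle.trans ?_
    rw [multMean_add, multMean_const hv, multMean_const_mul, multMean_apply hv]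
    have h4 : (n + 1 : ℝ)⁻¹ * (m * v j) ≤ v j := by
      rw [inv_mul_le_iff₀ (by positivity), hnr]
      nlinarith [hv.1 j, mul_nonneg ht0 (hv.1 j)]
    linarith
  -- the lower bound, by `1 - 1 / x ≤ ln x` and `mul_multMean_inv_le`
  have hlo : ∀ v ∈ stdSimplex ℝ (Fin b), ∀ j, - (t * (t + 1) / (n + 1)) ≤ multMean m v (fun k =>
      v j * (Real.log ((k j + s₁ : ℕ) + 1) - Real.log (n + 1) - Real.log (v j))) := by
    intro v hv j
    have hle : multMean m v (fun k => v j - v j ^ 2 * (n + 1) * ((k j : ℝ) + 1)⁻¹)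
        ≤ multMean m v (fun k =>
        v j * (Real.log ((k j + s₁ : ℕ) + 1) - Real.log (n + 1) - Real.log (v j))) := by
      refine multMean_mono hv.1 fun k _ => ?_
      rcases (hv.1 j).eq_or_lt with h0 | h0
      · rw [← h0]; simp
      · have h1 := Real.one_sub_inv_le_log_of_pos
          (x := ((k j + s₁ : ℕ) + 1 : ℝ) / ((n + 1) * v j)) (by positivity)
        rw [Real.log_div (by positivity) (by positivity), Real.log_mul (by positivity) h0.ne',
          inv_div] at h1
        have h2 := mul_le_mul_of_nonneg_left h1 h0.le
        have h5 : (n + 1) * v j / ((k j + s₁ : ℕ) + 1 : ℝ) ≤ (n + 1) * v j * ((k j : ℝ) + 1)⁻¹ := by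
          rw [div_eq_mul_inv]
          gcongr
          linarith [Nat.cast_nonneg (α := ℝ) s₁]
        have h6 := mul_le_mul_of_nonneg_left h5 h0.le
        have h7 : v j * ((n + 1) * v j * ((k j : ℝ) + 1)⁻¹)
          = v j ^ 2 * (n + 1) * ((k j : ℝ) + 1)⁻¹ := by ring
        rw [h7] at h6
        linarith
    refine le_trans ?_ hle
    rw [multMean_sub, multMean_const hv, multMean_const_mul]
    have h8 := mul_multMean_inv_le hv m j
    set x := multMean m v (fun k => ((k j : ℝ) + 1)⁻¹)
    have h9 : v j ^ 2 * (n + 1) * x ≤ v j * ((n + 1) / (m + 1)) := by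
      have : v j ^ 2 * (n + 1) * x = v j * ((n + 1) / (m + 1)) * ((m + 1) * v j * x) := by
        field_simp
      rw [this]
      refine mul_le_of_le_one_right ?_ h8
      have := hv.1 j
      positivity
    have h10 : v j * ((n + 1) / (m + 1)) ≤ v j + t * (t + 1) / (n + 1) := by
      have h11 : ((n : ℝ) + 1) / (m + 1) = 1 + t / (m + 1) := by rw [hnr]; field_simp; ring
      have h12 : t / (m + 1) ≤ t * (t + 1) / (n + 1) := by
        rw [div_le_div_iff₀ (by positivity) (by positivity), hnr]
        nlinarith [mul_nonneg ht0 (mul_nonneg ht0 hm0)]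
      have h13 : v j * (t / (m + 1)) ≤ 1 * (t / (m + 1)) :=
        mul_le_mul_of_nonneg_right (coord_le_one hv j) (by positivity)
      rw [h11]
      linarith
    linarith
  rw [(IsTame.sum htame).integral_eq hν]
  have hbd : ∀ v ∈ stdSimplex ℝ (Fin b), |multMean m v (fun k => ∑ j,
      v j * (Real.log ((k j + s₁ : ℕ) + 1) - Real.log (n + 1) - Real.log (v j)))|
      ≤ b * (s₁ + 1 + t * (t + 1)) / (n + 1) := by
    intro v hv
    rw [multMean_sum (g := fun j k =>
      v j * (Real.log ((k j + s₁ : ℕ) + 1) - Real.log (n + 1) - Real.log (v j)))]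
    refine (Finset.abs_sum_le_sum_abs _ _).trans ?_
    have : ∀ j, |multMean m v (fun k =>
        v j * (Real.log ((k j + s₁ : ℕ) + 1) - Real.log (n + 1) - Real.log (v j)))|
        ≤ (s₁ + 1 + t * (t + 1)) / (n + 1) := by
      intro j
      have a1 := hup v hv j
      have a2 := hlo v hv j
      have a3 : (0 : ℝ) ≤ (s₁ + 1) / (n + 1) := by positivity
      have a4 : 0 ≤ t * (t + 1) / (n + 1) := by positivity
      rw [add_div, abs_le]
      constructor <;> linarith
    refine (Finset.sum_le_sum fun j _ => this j).trans ?_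
    simp
    rw [mul_div_assoc]
  have := norm_integral_le_of_norm_le_const (μ := ν) (C := b * (s₁ + 1 + t * (t + 1)) / (n + 1))
    (f := fun v => multMean m v (fun k => ∑ j,
      v j * (Real.log ((k j + s₁ : ℕ) + 1) - Real.log (n + 1) - Real.log (v j))))
    (by filter_upwards [hν.mem_simplex] with v hv using hbd v hv)
  simpa using this

/-- A maximum principle: a sequence that is dominated by its size-biased mean over the children,
up to an error `O(1/n)`, is bounded. The function `-1/(n+1)` compensates the error. -/
lemma bounded_of_le_integral (hs : IsAdmissible b s s₀ s₁) (hν : IsSplitLaw ν)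
    (hV : ν {v | ∃ i, v i = 1} < 1) {y : ℕ → ℝ} {c : ℝ} (hc : 0 ≤ c)
    (hy : ∀ n, s < n → |y n| ≤ ∫ p, ∑ j, p.1 j * |y (p.2 j + s₁)|
      ∂throwLaw ν (n - s₀ - b * s₁) + c / (n + 1)) :
    ∃ B, ∀ n, |y n| ≤ B := by
  have hρ := integral_sum_sq_lt_one hν hV
  set κ := (1 - ∫ v, ∑ i, v i ^ 2 ∂ν) / 2 with hκ
  have hκ0 : 0 < κ := by rw [hκ]; linarith
  set A := 2 * (c + 1) / κ with hA
  have hA0 : 0 < A := by positivity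
  set z : ℕ → ℝ := fun n => |y n| + A / (n + 1) with hz
  obtain ⟨n₁, -, hn₁⟩ := Finset.exists_max_image (Finset.range (s + 1)) z ⟨0, by simp⟩
  refine ⟨z n₁, fun N => ?_⟩
  have hyz : ∀ n, |y n| ≤ z n := fun n => by
    have : 0 ≤ A / ((n : ℝ) + 1) := by positivity
    simp only [hz]; linarith
  refine (hyz N).trans ?_
  -- the maximum of `z` up to `N` cannot be attained at an internal size `n > s`: there the drift of
  -- `A / (n + 1)` under passing to a size-biased child exceeds the error `c / (n + 1)`
  obtain ⟨n, hnN, hmax⟩ := Finset.exists_max_image (Finset.range (N + 1)) z ⟨0, by simp⟩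
  refine (hmax N (by simp)).trans ?_
  by_cases hn : s < n
  swap
  · exact hn₁ n (by simp; omega)
  exfalso
  have hnm := throws_add_eq hs hn
  set m := n - s₀ - b * s₁ with hm
  have hn1 : (1 : ℝ) ≤ n := by exact_mod_cast (by omega : 1 ≤ n)
  have hP := isProbabilityMeasure_throwLaw hν m
  have ht1 : IsTame fun p : (Fin b → ℝ) × (Fin b → ℕ) => ∑ j, p.1 j * |y (p.2 j + s₁)| :=
    IsTame.sum fun j => (isTame_coord j).mul (isTame_throw fun k => |y (k j + s₁)|)
  have ht2 : IsTame fun p : (Fin b → ℝ) × (Fin b → ℕ) =>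
      ∑ i, p.1 i * ((n : ℝ) - (p.2 i + s₁ : ℕ)) :=
    IsTame.sum fun i => (isTame_coord i).mul (isTame_throw fun k => (n : ℝ) - (k i + s₁ : ℕ))
  have hdrift := le_integral_sizeBiased_loss hs hν hV hn
  rw [← hκ, ← hm] at hdrift
  have hle : ∫ p, ∑ j, p.1 j * |y (p.2 j + s₁)| ∂throwLaw ν m
      ≤ ∫ p, (|y n| - A / (n + 1) ^ 2 * ∑ i, p.1 i * ((n : ℝ) - (p.2 i + s₁ : ℕ)))
        ∂throwLaw ν m := by
    refine integral_mono_ae (ht1.integrable hν m)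
      ((integrable_const _).sub ((ht2.integrable hν m).const_mul _)) ?_
    filter_upwards [ae_throwLaw hν m] with p hp
    rw [Finset.mul_sum]
    have h1 : |y n| = ∑ j, p.1 j * |y n| := by rw [← Finset.sum_mul, hp.1.2, one_mul]
    rw [h1, ← Finset.sum_sub_distrib]
    refine Finset.sum_le_sum fun j _ => ?_
    have hI := child_le hs hn hp.2 j
    have h2 := hmax (p.2 j + s₁) (by simp at hnN ⊢; omega)
    simp only [hz] at h2
    have hIr : ((p.2 j + s₁ : ℕ) : ℝ) ≤ n := by exact_mod_cast hI
    set I := p.2 j + s₁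
    have hI0 : (0 : ℝ) ≤ I := Nat.cast_nonneg I
    -- convexity of `x ↦ A / (x + 1)`
    have h3 : A / ((n : ℝ) + 1) + A / (n + 1) ^ 2 * ((n : ℝ) - I) ≤ A / ((I : ℝ) + 1) := by
      have : A / ((I : ℝ) + 1) - A / ((n : ℝ) + 1) - A / (n + 1) ^ 2 * ((n : ℝ) - I)
          = A * (n - I) ^ 2 / ((I + 1) * (n + 1) ^ 2) := by field_simp; ring
      have : 0 ≤ A * (n - I) ^ 2 / (((I : ℝ) + 1) * (n + 1) ^ 2) := by positivity
      linarith
    have h4 : |y I| ≤ |y n| - A / (n + 1) ^ 2 * ((n : ℝ) - I) := by linarith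
    have := mul_le_mul_of_nonneg_left h4 (hp.1.1 j)
    linarith
  rw [integral_sub (integrable_const _) ((ht2.integrable hν m).const_mul _),
    integral_const_mul] at hle
  simp only [integral_const, probReal_univ, one_smul] at hle
  have h5 : A / ((n : ℝ) + 1) ^ 2 * (κ * n) ≤ A / (n + 1) ^ 2 *
      ∫ p, ∑ i, p.1 i * ((n : ℝ) - (p.2 i + s₁ : ℕ)) ∂throwLaw ν m :=
    mul_le_mul_of_nonneg_left hdrift (by positivity)
  have h6 : (c + 1) / (n + 1) ≤ A / ((n : ℝ) + 1) ^ 2 * (κ * n) := by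
    rw [hA, div_le_iff₀ (by positivity)]
    have : 2 * (c + 1) / κ / ((n : ℝ) + 1) ^ 2 * (κ * n) * (n + 1)
      = (c + 1) * (2 * n / (n + 1)) := by field_simp
    rw [this]
    refine le_mul_of_one_le_right (by linarith) ?_
    rw [le_div_iff₀ (by positivity)]
    linarith
  have h7 : c / ((n : ℝ) + 1) < (c + 1) / (n + 1) :=
    div_lt_div_of_pos_right (by linarith) (by positivity)
  have h8 := hy n hn
  linarith

/-- The mean path length minus its leading term `n ln n / μ`. -/
def meanRest (s s₀ s₁ : ℕ) {b : ℕ} (ν : Measure (Fin b → ℝ)) (n : ℕ) : ℝ :=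
  meanPath s s₀ s₁ ν n - n * Real.log n / meanLog ν

/-- The increments of the mean path length are `ln n / μ + O(1)`: the difference satisfies the
recursion of the increments up to `O(1/n)`, so the maximum principle applies. -/
lemma exists_abs_increment_le (hs : IsAdmissible b s s₀ s₁) (hν : IsSplitLaw ν)
    (hV : ν {v | ∃ i, v i = 1} < 1) : ∃ B, ∀ n : ℕ,
      |meanPath s s₀ s₁ ν (n + 1) - meanPath s s₀ s₁ ν n - Real.log (n + 1) / meanLog ν| ≤ B := by
  set e := meanPath s s₀ s₁ ν with he
  have hμ := meanLog_pos hν hV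
  set μ := meanLog ν with hμd
  set c : ℝ := b * (s₁ + 1 + (s₀ + b * s₁) * (s₀ + b * s₁ + 1)) with hc
  refine bounded_of_le_integral hs hν hV
    (y := fun n => e (n + 1) - e n - Real.log (n + 1) / μ) (c := c / μ) (by positivity) ?_
  intro n hn
  have hdef := abs_log_defect_le hs hν hn
  rw [← hc] at hdef
  have hinc := meanPath_succ_sub hs hν hV hn
  rw [← he] at hinc
  set m := n - s₀ - b * s₁ with hm
  have hP := isProbabilityMeasure_throwLaw hν m
  set y : ℕ → ℝ := fun n => e (n + 1) - e n - Real.log (n + 1) / μ with hy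
  have ht1 : IsTame fun p : (Fin b → ℝ) × (Fin b → ℕ) => ∑ j, p.1 j * y (p.2 j + s₁) :=
    IsTame.sum fun j => (isTame_coord j).mul (isTame_throw fun k => y (k j + s₁))
  have ht2 : IsTame fun p : (Fin b → ℝ) × (Fin b → ℕ) =>
      ∑ j, p.1 j * (Real.log ((p.2 j + s₁ : ℕ) + 1) - Real.log (n + 1) - Real.log (p.1 j)) := by
    refine IsTame.sum fun j => ?_
    have h1 := ((isTame_coord j).mul (isTame_throw fun k : Fin b → ℕ =>
      Real.log ((k j + s₁ : ℕ) + 1) - Real.log (n + 1))).sub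
      (isTame_vector (g := fun v : Fin b → ℝ => v j * Real.log (v j)) (by fun_prop) (c := 1)
        fun v hv => abs_mul_log_le_one (hv.1 j) (coord_le_one hv j))
    simpa only [mul_sub] using h1
  have ht3 := isTame_vector (b := b) measurable_sum_mul_log abs_sum_mul_log_le
  have hent : ∫ p, ∑ i, p.1 i * Real.log (p.1 i) ∂throwLaw ν m = -μ := by
    rw [integral_throwLaw_vector hν m measurable_sum_mul_log abs_sum_mul_log_le, hμd, meanLog_eq,
      neg_neg]
  have hkey : y n = ∫ p, ∑ j, p.1 j * y (p.2 j + s₁) ∂throwLaw ν m + μ⁻¹ *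
      ∫ p, ∑ j, p.1 j * (Real.log ((p.2 j + s₁ : ℕ) + 1) - Real.log (n + 1) - Real.log (p.1 j))
        ∂throwLaw ν m := by
    have h1 : ∫ p, ∑ j, p.1 j * (e (p.2 j + s₁ + 1) - e (p.2 j + s₁)) ∂throwLaw ν m
        = ∫ p, (∑ j, p.1 j * y (p.2 j + s₁) + μ⁻¹ * (∑ j, p.1 j *
          (Real.log ((p.2 j + s₁ : ℕ) + 1) - Real.log (n + 1) - Real.log (p.1 j)))
          + μ⁻¹ * (∑ j, p.1 j * Real.log (p.1 j)) + μ⁻¹ * Real.log (n + 1)) ∂throwLaw ν m := by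
      refine integral_congr_ae ?_
      filter_upwards [ae_throwLaw hν m] with p hp
      have h2 : μ⁻¹ * Real.log (n + 1) = ∑ j, p.1 j * (μ⁻¹ * Real.log (n + 1)) := by
        rw [← Finset.sum_mul, hp.1.2, one_mul]
      rw [h2, Finset.mul_sum, Finset.mul_sum, ← Finset.sum_add_distrib, ← Finset.sum_add_distrib,
        ← Finset.sum_add_distrib]
      refine Finset.sum_congr rfl fun j _ => ?_
      simp only [hy]
      ring
    have i2 := ht2.const_mul μ⁻¹
    have i3 := ht3.const_mul μ⁻¹
    rw [((ht1.add i2).add i3).integral_add hν (isTame_const _), (ht1.add i2).integral_add hν i3,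
      ht1.integral_add hν i2, integral_const_mul, integral_const_mul, hent] at h1
    simp only [integral_const, probReal_univ, one_smul] at h1
    have h3 : y n = e (n + 1) - e n - Real.log (n + 1) / μ := rfl
    have h4 : μ⁻¹ * -μ = -1 := by field_simp
    rw [h3, hinc, h1, h4, div_eq_mul_inv]
    ring
  have h5 : |y n| ≤ |∫ p, ∑ j, p.1 j * y (p.2 j + s₁) ∂throwLaw ν m| + μ⁻¹ * (c / (n + 1)) := by
    rw [hkey]
    refine (abs_add_le _ _).trans (add_le_add le_rfl ?_)
    rw [abs_mul, abs_of_pos (inv_pos.2 hμ)]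
    exact mul_le_mul_of_nonneg_left hdef (inv_nonneg.2 hμ.le)
  refine h5.trans (add_le_add ?_ (le_of_eq ?_))
  · have ht4 : IsTame fun p : (Fin b → ℝ) × (Fin b → ℕ) => ∑ j, p.1 j * |y (p.2 j + s₁)| :=
      IsTame.sum fun j => (isTame_coord j).mul (isTame_throw fun k => |y (k j + s₁)|)
    refine abs_integral_le_integral_abs.trans ?_
    refine integral_mono_ae (ht1.abs.integrable hν m) (ht4.integrable hν m) ?_
    filter_upwards [ae_throwLaw hν m] with p hp
    refine (Finset.abs_sum_le_sum_abs _ _).trans (Finset.sum_le_sum fun j _ => ?_)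
    rw [abs_mul, abs_of_nonneg (hp.1.1 j)]
  · rw [div_div, div_eq_mul_inv, div_eq_mul_inv, mul_inv]
    ring

/-- The mean path length is `n ln n / μ` up to a Lipschitz function. This replaces an asymptotic
expansion of the mean, which would depend on whether `ln V_i` is lattice. -/
lemma abs_meanRest_sub_le (hs : IsAdmissible b s s₀ s₁) (hν : IsSplitLaw ν)
    (hV : ν {v | ∃ i, v i = 1} < 1) : ∃ L, 0 ≤ L ∧ ∀ j k : ℕ,
      |meanRest s s₀ s₁ ν j - meanRest s s₀ s₁ ν k| ≤ L * |(j : ℝ) - k| := by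
  obtain ⟨B, hB⟩ := exists_abs_increment_le hs hν hV
  have hμ := meanLog_pos hν hV
  have hB0 : 0 ≤ B := (abs_nonneg _).trans (hB 0)
  set f := meanRest s s₀ s₁ ν with hf
  have hstep : ∀ n, |f (n + 1) - f n| ≤ B + (meanLog ν)⁻¹ := by
    intro n
    have h1 : f (n + 1) - f n = (meanPath s s₀ s₁ ν (n + 1) - meanPath s s₀ s₁ ν n
        - Real.log (n + 1) / meanLog ν)
        - (meanLog ν)⁻¹ * (n * (Real.log (n + 1) - Real.log n)) := by
      simp only [hf, meanRest]; push_cast; ring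
    rw [h1]
    refine (abs_sub _ _).trans (add_le_add (hB n) ?_)
    rw [abs_mul, abs_of_pos (inv_pos.2 hμ)]
    refine mul_le_of_le_one_right (inv_nonneg.2 hμ.le) ?_
    rcases Nat.eq_zero_or_pos n with h0 | h0
    · simp [h0]
    · have hn : (0 : ℝ) < n := by exact_mod_cast h0
      have h2 : Real.log n ≤ Real.log (n + 1) := Real.log_le_log hn (by linarith)
      rw [abs_of_nonneg (mul_nonneg hn.le (by linarith)), ← Real.log_div (by positivity) hn.ne']
      have h3 := Real.log_le_sub_one_of_pos (x := ((n : ℝ) + 1) / n) (by positivity)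
      calc (n : ℝ) * Real.log ((n + 1) / n) ≤ n * ((n + 1) / n - 1) :=
            mul_le_mul_of_nonneg_left h3 hn.le
        _ = 1 := by field_simp; ring
  have hinv := inv_pos.2 hμ
  refine ⟨B + (meanLog ν)⁻¹, by linarith, ?_⟩
  have hup : ∀ j d : ℕ, |f (j + d) - f j| ≤ (B + (meanLog ν)⁻¹) * d := by
    intro j d
    induction d with
    | zero => simp
    | succ d ih =>
      have h1 : f (j + (d + 1)) - f j = (f (j + d + 1) - f (j + d)) + (f (j + d) - f j) := by
        rw [← add_assoc]; ring
      rw [h1]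
      refine (abs_add_le _ _).trans ?_
      have := hstep (j + d)
      push_cast
      linarith
  intro j k
  rcases le_total k j with h | h
  · obtain ⟨d, rfl⟩ := Nat.exists_eq_add_of_le h
    refine (hup k d).trans (le_of_eq ?_)
    push_cast
    rw [add_sub_cancel_left, abs_of_nonneg (Nat.cast_nonneg d)]
  · obtain ⟨d, rfl⟩ := Nat.exists_eq_add_of_le h
    rw [abs_sub_comm, abs_sub_comm (j : ℝ)]
    refine (hup j d).trans (le_of_eq ?_)
    push_cast
    rw [add_sub_cancel_left, abs_of_nonneg (Nat.cast_nonneg d)]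

end

/-! ### Asymptotically harmonic functions on the multiplicative half-line -/

/-- A bounded measurable function on the line. -/
structure IsBoundedMeasurable (f : ℝ → ℝ) : Prop where
  measurable : Measurable f
  bounded : ∃ c, ∀ x, |f x| ≤ c

/-- The averaging operator `f ↦ E f(x ξ)`, for `ξ` with law `σ`. -/
def scaleMean (σ : Measure ℝ) (f : ℝ → ℝ) (x : ℝ) : ℝ := ∫ ξ, f (x * ξ) ∂σ

lemma scaleMean_const_mul {σ : Measure ℝ} {f : ℝ → ℝ} (c x : ℝ) :
    scaleMean σ (fun x => c * f x) x = c * scaleMean σ f x :=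
  integral_const_mul _ _

section

variable {σ : Measure ℝ} [IsProbabilityMeasure σ] {f g : ℝ → ℝ}

lemma IsBoundedMeasurable.integrable (hf : IsBoundedMeasurable f) (x : ℝ) :
    Integrable (fun ξ => f (x * ξ)) σ := by
  obtain ⟨c, hc⟩ := hf.bounded
  exact Integrable.of_bound
    (hf.measurable.comp (measurable_const_mul x)).aestronglyMeasurable c (ae_of_all _ fun _ => hc _)

lemma abs_scaleMean_le {c : ℝ} (hc : ∀ x, |f x| ≤ c) (x : ℝ) : |scaleMean σ f x| ≤ c := by
  have := norm_integral_le_of_norm_le_const (μ := σ) (f := fun ξ => f (x * ξ))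
    (ae_of_all _ fun ξ => hc (x * ξ))
  simpa [scaleMean] using this

lemma IsBoundedMeasurable.scaleMean (hf : IsBoundedMeasurable f) :
    IsBoundedMeasurable (scaleMean σ f) := by
  refine ⟨?_, ?_⟩
  · have h : StronglyMeasurable (Function.uncurry fun x ξ : ℝ => f (x * ξ)) :=
      (hf.measurable.comp measurable_mul).stronglyMeasurable
    exact h.integral_prod_right.measurable
  · obtain ⟨c, hc⟩ := hf.bounded
    exact ⟨c, fun x => abs_scaleMean_le hc x⟩

lemma IsBoundedMeasurable.add (hf : IsBoundedMeasurable f) (hg : IsBoundedMeasurable g) :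
    IsBoundedMeasurable fun x => f x + g x := by
  obtain ⟨c, hc⟩ := hf.bounded
  obtain ⟨d, hd⟩ := hg.bounded
  exact ⟨hf.1.add hg.1, c + d, fun x => (abs_add_le _ _).trans (add_le_add (hc x) (hd x))⟩

lemma IsBoundedMeasurable.mul (hf : IsBoundedMeasurable f) (hg : IsBoundedMeasurable g) :
    IsBoundedMeasurable fun x => f x * g x := by
  obtain ⟨c, hc⟩ := hf.bounded
  obtain ⟨d, hd⟩ := hg.bounded
  refine ⟨hf.1.mul hg.1, c * d, fun x => ?_⟩
  rw [abs_mul]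
  exact mul_le_mul (hc x) (hd x) (abs_nonneg _) ((abs_nonneg _).trans (hc x))

lemma isBoundedMeasurable_const (c : ℝ) : IsBoundedMeasurable fun _ => c :=
  ⟨measurable_const, |c|, fun _ => le_rfl⟩

lemma IsBoundedMeasurable.abs (hf : IsBoundedMeasurable f) :
    IsBoundedMeasurable fun x => |f x| :=
  ⟨hf.1.abs, by simpa using hf.2⟩

lemma IsBoundedMeasurable.sub (hf : IsBoundedMeasurable f) (hg : IsBoundedMeasurable g) :
    IsBoundedMeasurable fun x => f x - g x := by
  have := hf.add ((isBoundedMeasurable_const (-1)).mul hg)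
  simpa [sub_eq_add_neg] using this

lemma scaleMean_mono (hf : IsBoundedMeasurable f) (hg : IsBoundedMeasurable g)
    (h : ∀ x, f x ≤ g x) (x : ℝ) : scaleMean σ f x ≤ scaleMean σ g x :=
  integral_mono (hf.integrable x) (hg.integrable x) fun _ => h _

lemma scaleMean_add (hf : IsBoundedMeasurable f) (hg : IsBoundedMeasurable g) (x : ℝ) :
    scaleMean σ (fun x => f x + g x) x = scaleMean σ f x + scaleMean σ g x :=
  integral_add (hf.integrable x) (hg.integrable x)

lemma scaleMean_sub (hf : IsBoundedMeasurable f) (hg : IsBoundedMeasurable g) (x : ℝ) :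
    scaleMean σ (fun x => f x - g x) x = scaleMean σ f x - scaleMean σ g x :=
  integral_sub (hf.integrable x) (hg.integrable x)

lemma IsBoundedMeasurable.tendsto_scaleMean (hσ : ∀ᵐ ξ ∂σ, 0 < ξ) (hf : IsBoundedMeasurable f)
    (h : Tendsto f atTop (𝓝 0)) : Tendsto (SplitTree.scaleMean σ f) atTop (𝓝 0) := by
  obtain ⟨c, hc⟩ := hf.bounded
  have h0 : (0 : ℝ) = ∫ _, (0 : ℝ) ∂σ := by simp
  rw [h0]
  refine tendsto_integral_filter_of_dominated_convergence (fun _ => c) ?_ ?_ ?_ ?_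
  · exact Eventually.of_forall fun x => (hf.integrable x).aestronglyMeasurable
  · exact Eventually.of_forall fun x => ae_of_all _ fun ξ => hc _
  · exact integrable_const c
  · filter_upwards [hσ] with ξ hξ
    exact h.comp (tendsto_id.atTop_mul_const hξ)

/-- The mean square fluctuation of `f` over one multiplicative step. -/
def scaleFluct (σ : Measure ℝ) (f : ℝ → ℝ) (x : ℝ) : ℝ := ∫ ξ, (f (x * ξ) - f x) ^ 2 ∂σ

lemma scaleFluct_eq (hf : IsBoundedMeasurable f) (x : ℝ) :
    scaleFluct σ f x = scaleMean σ (fun x => f x * f x) x - f x * f x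
      + 2 * f x * (f x - scaleMean σ f x) := by
  have h1 : ∀ ξ, (f (x * ξ) - f x) ^ 2
      = (f (x * ξ) * f (x * ξ) - 2 * f x * f (x * ξ)) + f x * f x := fun ξ => by ring
  have i1 := (hf.mul hf).integrable (σ := σ) x
  have i2 := (hf.integrable (σ := σ) x).const_mul (2 * f x)
  have i3 : Integrable (fun ξ => f (x * ξ) * f (x * ξ) - 2 * f x * f (x * ξ)) σ := i1.sub i2
  simp only [scaleFluct, h1]
  rw [integral_add i3 (integrable_const _), integral_sub i1 i2, integral_const_mul]
  simp [scaleMean]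
  ring

lemma IsBoundedMeasurable.scaleFluct (hf : IsBoundedMeasurable f) :
    IsBoundedMeasurable (scaleFluct σ f) := by
  have h : SplitTree.scaleFluct σ f = fun x => (SplitTree.scaleMean σ (fun x => f x * f x) x
      - f x * f x) + 2 * f x * (f x - SplitTree.scaleMean σ f x) :=
    funext fun x => scaleFluct_eq hf x
  rw [h]
  exact ((hf.mul hf).scaleMean.sub (hf.mul hf)).add
    (((isBoundedMeasurable_const 2).mul hf).mul (hf.sub hf.scaleMean))

/-- Multiplicative steps commute, so a step of `ξ` from `x` is also a step of `ξ` made after an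
independent step `ξ'`; by Jensen's inequality the fluctuation of an asymptotically harmonic
function can only grow when `ξ'` is averaged out afterwards. -/
lemma scaleFluct_le_scaleMean (hf : IsBoundedMeasurable f) {c : ℝ} (hc : ∀ x, |f x| ≤ c) (x : ℝ) :
    scaleFluct σ f x ≤ scaleMean σ (scaleFluct σ f) x
      + 4 * c * (scaleMean σ (fun x => |f x - scaleMean σ f x|) x + |f x - scaleMean σ f x|) := by
  set η : ℝ → ℝ := fun x => f x - scaleMean σ f x with hη
  have hηb : IsBoundedMeasurable η := hf.sub hf.scaleMean
  have hc0 : 0 ≤ c := (abs_nonneg _).trans (hc 0)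
  set Φ : ℝ → ℝ → ℝ := fun ξ ξ' => (f (x * ξ' * ξ) - f (x * ξ')) ^ 2 with hΦ
  have hΦm : Measurable (Function.uncurry Φ) := by
    have h1 : Measurable fun p : ℝ × ℝ => f (x * p.2 * p.1) := hf.measurable.comp (by fun_prop)
    have h2 : Measurable fun p : ℝ × ℝ => f (x * p.2) := hf.measurable.comp (by fun_prop)
    exact (h1.sub h2).pow_const 2
  have hΦb : ∀ ξ ξ', |Φ ξ ξ'| ≤ (2 * c) ^ 2 := by
    intro ξ ξ'
    rw [abs_pow]
    refine pow_le_pow_left₀ (abs_nonneg _) ((abs_sub _ _).trans ?_) 2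
    have := hc (x * ξ' * ξ)
    have := hc (x * ξ')
    linarith
  have hΦi : Integrable (Function.uncurry Φ) (σ.prod σ) :=
    Integrable.of_bound hΦm.aestronglyMeasurable ((2 * c) ^ 2) (ae_of_all _ fun p => hΦb p.1 p.2)
  have hpt : ∀ ξ, (f (x * ξ) - f x) ^ 2 ≤ ∫ ξ', Φ ξ ξ' ∂σ + 4 * c * (|η (x * ξ)| + |η x|) := by
    intro ξ
    have i1 : Integrable (fun ξ' => f (x * ξ' * ξ)) σ := by
      have := hf.integrable (σ := σ) (x * ξ)
      exact this.congr (ae_of_all _ fun ξ' => by ring_nf)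
    have i2 := hf.integrable (σ := σ) x
    set a := ∫ ξ', (f (x * ξ' * ξ) - f (x * ξ')) ∂σ with ha
    have ha2 : a = scaleMean σ f (x * ξ) - scaleMean σ f x := by
      rw [ha, integral_sub i1 i2]
      congr 1
      exact integral_congr_ae (ae_of_all _ fun ξ' => by ring_nf)
    -- Jensen, as nonnegativity of a variance
    have hjen : a ^ 2 ≤ ∫ ξ', Φ ξ ξ' ∂σ := by
      have hm : Measurable fun ξ' => f (x * ξ' * ξ) - f (x * ξ') :=
        (hf.measurable.comp (by fun_prop)).sub (hf.measurable.comp (by fun_prop))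
      have i3 : Integrable (fun ξ' => Φ ξ ξ') σ :=
        Integrable.of_bound (hm.pow_const 2).aestronglyMeasurable ((2 * c) ^ 2)
          (ae_of_all _ fun ξ' => hΦb ξ ξ')
      have h4 : 0 ≤ ∫ ξ', (f (x * ξ' * ξ) - f (x * ξ') - a) ^ 2 ∂σ :=
        integral_nonneg fun _ => sq_nonneg _
      have h5 : ∀ ξ', (f (x * ξ' * ξ) - f (x * ξ') - a) ^ 2
          = (Φ ξ ξ' - 2 * a * (f (x * ξ' * ξ) - f (x * ξ'))) + a ^ 2 := fun ξ' => by
        simp only [hΦ]; ring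
      simp only [h5] at h4
      have i4 : Integrable (fun ξ' => 2 * a * (f (x * ξ' * ξ) - f (x * ξ'))) σ :=
        (i1.sub i2).const_mul _
      have i5 : Integrable (fun ξ' => Φ ξ ξ' - 2 * a * (f (x * ξ' * ξ) - f (x * ξ'))) σ :=
        i3.sub i4
      rw [integral_add i5 (integrable_const _), integral_sub i3 i4, integral_const_mul,
        ← ha] at h4
      simp at h4
      nlinarith
    have hr : f (x * ξ) - f x = a + (η (x * ξ) - η x) := by
      rw [ha2]; simp only [hη]; ring
    have hab : |a| ≤ 2 * c := by
      rw [ha2]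
      refine (abs_sub _ _).trans ?_
      have := abs_scaleMean_le (σ := σ) hc (x * ξ)
      have := abs_scaleMean_le (σ := σ) hc x
      linarith
    have hab2 : |f (x * ξ) - f x| ≤ 2 * c := by
      refine (abs_sub _ _).trans ?_
      have := hc (x * ξ)
      have := hc x
      linarith
    have h6 : (f (x * ξ) - f x) ^ 2 = a ^ 2 + (a + (f (x * ξ) - f x)) * (η (x * ξ) - η x) := by
      rw [hr]; ring
    have h7 : (a + (f (x * ξ) - f x)) * (η (x * ξ) - η x) ≤ 4 * c * (|η (x * ξ)| + |η x|) := by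
      refine (le_abs_self _).trans ?_
      rw [abs_mul]
      refine mul_le_mul ((abs_add_le _ _).trans (by linarith)) (abs_sub _ _) (abs_nonneg _)
        (by linarith)
    linarith
  have i4 : Integrable (fun ξ => ∫ ξ', Φ ξ ξ' ∂σ) σ := hΦi.integral_prod_left
  have i5 : Integrable (fun ξ => 4 * c * (|η (x * ξ)| + |η x|)) σ :=
    ((hηb.abs.integrable x).add (integrable_const _)).const_mul _
  have hswap : ∫ ξ, ∫ ξ', Φ ξ ξ' ∂σ ∂σ = scaleMean σ (scaleFluct σ f) x := integral_integral_swap hΦi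
  have hDi : Integrable (fun ξ => (f (x * ξ) - f x) ^ 2) σ :=
    Integrable.of_bound (((hf.integrable x).aestronglyMeasurable.sub
      aestronglyMeasurable_const).pow 2) ((2 * c) ^ 2) (ae_of_all _ fun ξ => by
        rw [Real.norm_eq_abs, abs_pow]
        refine pow_le_pow_left₀ (abs_nonneg _) ((abs_sub _ _).trans ?_) 2
        have := hc (x * ξ)
        have := hc x
        linarith)
  have h8 : ∫ ξ, (∫ ξ', Φ ξ ξ' ∂σ + 4 * c * (|η (x * ξ)| + |η x|)) ∂σ
      = scaleMean σ (scaleFluct σ f) x + 4 * c * (scaleMean σ (fun x => |η x|) x + |η x|) := by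
    rw [integral_add i4 i5, hswap, integral_const_mul,
      integral_add (hηb.abs.integrable x) (integrable_const _)]
    simp [scaleMean]
  rw [← h8]
  exact integral_mono hDi (i4.add i5) hpt

/-- A Choquet–Deny theorem for asymptotically harmonic functions: if `f(x) - E f(xξ) → 0` as
`x → ∞` for a bounded `f`, then `f(xξ) - f(x) → 0` in mean square. No condition on the lattice type
of `ln ξ` is needed. -/
theorem tendsto_scaleFluct (hσ : ∀ᵐ ξ ∂σ, 0 < ξ) (hf : IsBoundedMeasurable f)
    (h : Tendsto (fun x => f x - scaleMean σ f x) atTop (𝓝 0)) :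
    Tendsto (scaleFluct σ f) atTop (𝓝 0) := by
  obtain ⟨c, hc⟩ := hf.bounded
  have hc0 : 0 ≤ c := (abs_nonneg _).trans (hc 0)
  set D := scaleFluct σ f with hD
  have hDb : IsBoundedMeasurable D := hf.scaleFluct
  have hD0 : ∀ x, 0 ≤ D x := fun x => integral_nonneg fun _ => sq_nonneg _
  set η : ℝ → ℝ := fun x => f x - scaleMean σ f x with hη
  have hηb : IsBoundedMeasurable η := hf.sub hf.scaleMean
  have hηabs : Tendsto (fun x => |η x|) atTop (𝓝 0) := by simpa using h.abs
  -- the energy bound `N D ≤ T^N (f²) - f² + o(1)`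
  have key : ∀ N : ℕ, ∃ H z : ℝ → ℝ, IsBoundedMeasurable H ∧ (∀ x, |H x| ≤ c ^ 2) ∧
      IsBoundedMeasurable z ∧ Tendsto z atTop (𝓝 0) ∧ ∀ x, N * D x ≤ H x - f x * f x + z x := by
    intro N
    induction N with
    | zero =>
      refine ⟨fun x => f x * f x, fun _ => 0, hf.mul hf, fun x => ?_,
        isBoundedMeasurable_const 0, tendsto_const_nhds, fun x => by simp⟩
      simp only [← pow_two, abs_pow]
      exact pow_le_pow_left₀ (abs_nonneg _) (hc x) 2
    | succ N ih =>
      obtain ⟨H, z, hH, hHc, hz, hz0, hle⟩ := ih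
      set z₁ : ℝ → ℝ := fun x => 4 * c * (scaleMean σ (fun x => |η x|) x + |η x|) with hz₁
      have hz₁b : IsBoundedMeasurable z₁ :=
        (isBoundedMeasurable_const (4 * c)).mul (hηb.abs.scaleMean.add hηb.abs)
      have hz₁0 : Tendsto z₁ atTop (𝓝 0) := by
        have := ((hηb.abs.tendsto_scaleMean hσ hηabs).add hηabs).const_mul (4 * c)
        simpa [hz₁] using this
      refine ⟨scaleMean σ H, fun x => scaleMean σ z x + N * z₁ x + 2 * f x * η x, hH.scaleMean,
        abs_scaleMean_le hHc, ?_, ?_, fun x => ?_⟩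
      · exact (hz.scaleMean.add ((isBoundedMeasurable_const N).mul hz₁b)).add
          (((isBoundedMeasurable_const 2).mul hf).mul hηb)
      · have h1 : Tendsto (fun x => 2 * f x * η x) atTop (𝓝 0) := by
          refine squeeze_zero_norm (a := fun x => 2 * c * |η x|) (fun x => ?_)
            (by simpa using hηabs.const_mul (2 * c))
          rw [Real.norm_eq_abs, abs_mul, abs_mul, abs_two]
          gcongr
          exact hc x
        have := ((hz.tendsto_scaleMean hσ hz0).add (hz₁0.const_mul (N : ℝ))).add h1
        simpa using this
      · have h1 : D x ≤ scaleMean σ D x + z₁ x := scaleFluct_le_scaleMean hf hc x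
        have h2 : D x = scaleMean σ (fun x => f x * f x) x - f x * f x + 2 * f x * η x :=
          scaleFluct_eq hf x
        have h3 : scaleMean σ (fun x => N * D x) x
            ≤ scaleMean σ (fun x => H x - f x * f x + z x) x :=
          scaleMean_mono ((isBoundedMeasurable_const N).mul hDb) ((hH.sub (hf.mul hf)).add hz) hle x
        rw [scaleMean_const_mul, scaleMean_add (hH.sub (hf.mul hf)) hz,
          scaleMean_sub hH (hf.mul hf)] at h3
        have h4 : (N : ℝ) * D x ≤ N * (scaleMean σ D x + z₁ x) :=
          mul_le_mul_of_nonneg_left h1 (Nat.cast_nonneg N)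
        push_cast
        nlinarith
  rw [Metric.tendsto_atTop]
  intro ε hε
  obtain ⟨N, hN⟩ := exists_nat_gt ((c ^ 2 + 1) / ε)
  have hN0 : (0 : ℝ) < N := lt_trans (by positivity) hN
  obtain ⟨H, z, -, hHc, -, hz0, hle⟩ := key N
  obtain ⟨x₀, hx₀⟩ := Metric.tendsto_atTop.1 hz0 1 one_pos
  refine ⟨x₀, fun x hx => ?_⟩
  have h1 := hx₀ x hx
  rw [Real.dist_eq, sub_zero] at h1 ⊢
  rw [abs_of_nonneg (hD0 x)]
  have h2 := hle x
  have h3 := (abs_le.1 (hHc x)).2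
  have h4 := (abs_lt.1 h1).2
  rw [div_lt_iff₀ hε] at hN
  have h5 : (N : ℝ) * D x < N * ε := by nlinarith [mul_self_nonneg (f x)]
  exact lt_of_mul_lt_mul_left h5 hN0.le

end

/-! ### Convergence of the toll -/

/-- The toll `(∑ (n_i + E Ψ(T^{n_i})) - E Ψ(Tⁿ)) / n` of a split of `n` items into the subtree
sizes `n_i = k_i + s₁`. -/
def toll (s s₀ s₁ : ℕ) {b : ℕ} (ν : Measure (Fin b → ℝ)) (n : ℕ) (k : Fin b → ℕ) : ℝ :=
  (∑ i, (((k i + s₁ : ℕ) : ℝ) + meanPath s s₀ s₁ ν (k i + s₁)) - meanPath s s₀ s₁ ν n) / n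

/-- The law of the coordinate `V_I` of a split vector, where `I = i` has conditional probability
`V_i`. -/
def sizeBiasedLaw {b : ℕ} (ν : Measure (Fin b → ℝ)) : Measure ℝ :=
  ∑ i, (ν.withDensity fun v => ENNReal.ofReal (v i)).map fun v => v i

/-- The function `x ↦ (E Ψ(T^⌊x⌋) - ⌊x⌋ ln ⌊x⌋ / μ) / x`. -/
def meanOsc (s s₀ s₁ : ℕ) {b : ℕ} (ν : Measure (Fin b → ℝ)) (x : ℝ) : ℝ :=
  meanRest s s₀ s₁ ν ⌊x⌋₊ / x

/-- The difference between the toll and its limit, apart from the effect of the oscillations of the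
mean. -/
def tollRest (s s₀ s₁ : ℕ) {b : ℕ} (ν : Measure (Fin b → ℝ)) (n : ℕ)
    (p : (Fin b → ℝ) × (Fin b → ℕ)) : ℝ :=
  toll s s₀ s₁ ν n p.2 - cost ν p.1
    - ∑ i, p.1 i * (meanOsc s s₀ s₁ ν (n * p.1 i) - meanOsc s s₀ s₁ ν n)

section

variable {b s s₀ s₁ : ℕ} {ν : Measure (Fin b → ℝ)}

lemma integral_sizeBiasedLaw (hν : IsSplitLaw ν) {H : ℝ → ℝ} (hH : IsBoundedMeasurable H) :
    Integrable H (sizeBiasedLaw ν) ∧ ∫ x, H x ∂sizeBiasedLaw ν = ∫ v, ∑ i, v i * H (v i) ∂ν := by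
  have hp := hν.isProbabilityMeasure
  obtain ⟨c, hc⟩ := hH.bounded
  have hfin : ∀ i, IsFiniteMeasure (ν.withDensity fun v : Fin b → ℝ => ENNReal.ofReal (v i)) := by
    intro i
    refine isFiniteMeasure_withDensity_ofReal ?_
    refine (integrable_vector hν (by fun_prop) (c := 1) fun v hv => ?_).2
    rw [abs_of_nonneg (hv.1 i)]; exact coord_le_one hv i
  have hi : ∀ i ∈ (Finset.univ : Finset (Fin b)), Integrable H
      ((ν.withDensity fun v : Fin b → ℝ => ENNReal.ofReal (v i)).map fun v => v i) := by
    intro i _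
    have := hfin i
    exact Integrable.of_bound hH.1.aestronglyMeasurable c (ae_of_all _ hc)
  refine ⟨integrable_finsetSum_measure.2 hi, ?_⟩
  have hvi : ∀ i : Fin b, Integrable (fun v : Fin b → ℝ => v i * H (v i)) ν := by
    intro i
    have hm := hH.measurable
    refine integrable_vector hν (by fun_prop) (c := 1 * c) fun v hv => ?_
    rw [abs_mul, abs_of_nonneg (hv.1 i)]
    exact mul_le_mul (coord_le_one hv i) (hc _) (abs_nonneg _) zero_le_one
  rw [sizeBiasedLaw, integral_finsetSum_measure hi, integral_finsetSum _ fun i _ => hvi i]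
  refine Finset.sum_congr rfl fun i _ => ?_
  rw [integral_map (measurable_pi_apply i).aemeasurable hH.1.aestronglyMeasurable,
    integral_withDensity_eq_integral_toReal_smul (by fun_prop) (by simp)]
  refine integral_congr_ae ?_
  filter_upwards [hν.mem_simplex] with v hv
  simp [ENNReal.toReal_ofReal (hv.1 i)]

lemma isProbabilityMeasure_sizeBiasedLaw (hν : IsSplitLaw ν) :
    IsProbabilityMeasure (sizeBiasedLaw ν) := by
  have hp := hν.isProbabilityMeasure
  have h := integral_sizeBiasedLaw hν (isBoundedMeasurable_const 1)
  have h1 : ∫ v, ∑ i, v i * (1 : ℝ) ∂ν = 1 := by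
    have : ∫ v, ∑ i, v i * (1 : ℝ) ∂ν = ∫ _, (1 : ℝ) ∂ν := by
      refine integral_congr_ae ?_
      filter_upwards [hν.mem_simplex] with v hv
      simp [hv.2]
    rw [this]; simp
  rw [h1] at h
  have h2 := h.2
  rw [integral_const, smul_eq_mul, mul_one, Measure.real] at h2
  exact ⟨(ENNReal.toReal_eq_one_iff _).1 h2⟩

lemma ae_sizeBiasedLaw_pos : ∀ᵐ ξ ∂sizeBiasedLaw ν, 0 < ξ := by
  rw [ae_iff, sizeBiasedLaw, Measure.finsetSum_apply]
  refine Finset.sum_eq_zero fun i _ => ?_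
  have hm : MeasurableSet {a : ℝ | ¬ 0 < a} := measurableSet_Ioi.compl
  rw [Measure.map_apply (by fun_prop) hm, withDensity_apply _ (hm.preimage (by fun_prop))]
  rw [setLIntegral_eq_zero_iff (hm.preimage (by fun_prop)) (by fun_prop)]
  refine ae_of_all _ fun v hv => ?_
  simpa using hv

lemma meanRest_zero : meanRest s s₀ s₁ ν 0 = 0 := by
  simp [meanRest, meanPath_of_le (Nat.zero_le s)]

lemma isBoundedMeasurable_meanOsc (hs : IsAdmissible b s s₀ s₁) (hν : IsSplitLaw ν)
    (hV : ν {v | ∃ i, v i = 1} < 1) : IsBoundedMeasurable (meanOsc s s₀ s₁ ν) := by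
  obtain ⟨L, hL0, hL⟩ := abs_meanRest_sub_le hs hν hV
  refine ⟨?_, L, fun x => ?_⟩
  · exact ((measurable_of_countable (meanRest s s₀ s₁ ν)).comp Nat.measurable_floor).div
      measurable_id
  · rcases le_or_gt x 0 with hx | hx
    · simp [meanOsc, Nat.floor_of_nonpos hx, meanRest_zero, hL0]
    · have h := hL ⌊x⌋₊ 0
      rw [meanRest_zero, sub_zero, Nat.cast_zero, sub_zero, Nat.abs_cast] at h
      rw [meanOsc, abs_div, abs_of_pos hx, div_le_iff₀ hx]
      exact h.trans (mul_le_mul_of_nonneg_left (Nat.floor_le hx.le) hL0)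

lemma mul_meanOsc {x v : ℝ} (hx : 0 < x) (hv : 0 ≤ v) :
    v * meanOsc s s₀ s₁ ν (x * v) = meanRest s s₀ s₁ ν ⌊x * v⌋₊ / x := by
  rcases hv.eq_or_lt with rfl | hv
  · simp [meanRest_zero]
  · rw [meanOsc]; field_simp

lemma isTame_tollRest (hs : IsAdmissible b s s₀ s₁) (hν : IsSplitLaw ν)
    (hV : ν {v | ∃ i, v i = 1} < 1) (n : ℕ) : IsTame (tollRest s s₀ s₁ ν n) := by
  have hb := isBoundedMeasurable_meanOsc hs hν hV
  obtain ⟨c, hc⟩ := hb.bounded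
  have hm := hb.measurable
  refine ((isTame_throw (toll s s₀ s₁ ν n)).sub
    ((isTame_const 1).add ((isTame_vector measurable_sum_mul_log
      abs_sum_mul_log_le).const_mul _))).sub
    (IsTame.sum fun i => (isTame_coord i).mul (IsTame.sub (isTame_vector
      (g := fun v : Fin b → ℝ => meanOsc s s₀ s₁ ν (n * v i)) (by fun_prop) fun v _ => hc _)
      (isTame_const _)))

lemma toll_eq (hs : IsAdmissible b s s₀ s₁) {n : ℕ}
    (hn : s < n) {k : Fin b → ℕ} (hk : ∑ i, k i = n - s₀ - b * s₁) :
    toll s s₀ s₁ ν n k = 1 - s₀ / n - s₀ * Real.log n / (n * meanLog ν)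
      + (meanLog ν)⁻¹ * ∑ i, ((k i + s₁ : ℕ) : ℝ) / n * Real.log (((k i + s₁ : ℕ) : ℝ) / n)
      + (∑ i, meanRest s s₀ s₁ ν (k i + s₁) - meanRest s s₀ s₁ ν n) / n := by
  have hn0 : (0 : ℝ) < n := by exact_mod_cast (by omega : 0 < n)
  have hsum : (∑ i, ((k i + s₁ : ℕ) : ℝ)) = n - s₀ := by
    rw [← Nat.cast_sum, eq_sub_iff_add_eq]
    exact_mod_cast sum_child hs hn hk
  have h1 : ∀ i, ((k i + s₁ : ℕ) : ℝ) / n * Real.log (((k i + s₁ : ℕ) : ℝ) / n)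
      = (((k i + s₁ : ℕ) : ℝ) * Real.log ((k i + s₁ : ℕ) : ℝ)) / n
        - ((k i + s₁ : ℕ) : ℝ) * (Real.log n / n) := by
    intro i
    rcases Nat.eq_zero_or_pos (k i + s₁) with h | h
    · simp [h]
    · have : (0 : ℝ) < ((k i + s₁ : ℕ) : ℝ) := by exact_mod_cast h
      rw [Real.log_div this.ne' hn0.ne']
      ring
  have h2 : ∀ j, meanPath s s₀ s₁ ν j = meanRest s s₀ s₁ ν j + j * Real.log j * (meanLog ν)⁻¹ :=
    fun j => by simp only [meanRest]; ring
  simp only [h1, toll, h2, Finset.sum_add_distrib, Finset.sum_sub_distrib, ← Finset.sum_mul,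
    ← Finset.sum_div, hsum]
  field_simp
  ring

lemma abs_toll_le (hs : IsAdmissible b s s₀ s₁) (hν : IsSplitLaw ν)
    (hV : ν {v | ∃ i, v i = 1} < 1) : ∃ c, 0 < c ∧ ∀ n, s < n → ∀ k : Fin b → ℕ,
      ∑ i, k i = n - s₀ - b * s₁ → |toll s s₀ s₁ ν n k| ≤ c := by
  obtain ⟨L, hL0, hL⟩ := abs_meanRest_sub_le hs hν hV
  have hμ := meanLog_pos hν hV
  have hμ' := inv_pos.2 hμ
  refine ⟨1 + s₀ + s₀ * (meanLog ν)⁻¹ + (meanLog ν)⁻¹ * b + 2 * L, by positivity,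
    fun n hn k hk => ?_⟩
  have hn1 : (1 : ℝ) ≤ n := by exact_mod_cast (by omega : 1 ≤ n)
  have hn0 : (0 : ℝ) < n := by linarith
  have hf : ∀ j : ℕ, |meanRest s s₀ s₁ ν j| ≤ L * j := fun j => by
    have h := hL j 0
    rwa [meanRest_zero, sub_zero, Nat.cast_zero, sub_zero, Nat.abs_cast] at h
  have hsum : (∑ i, ((k i + s₁ : ℕ) : ℝ)) ≤ n := by
    rw [← Nat.cast_sum]
    have := sum_child hs hn hk
    exact_mod_cast (by omega)
  have a1 : |(s₀ : ℝ) / n| ≤ s₀ := by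
    rw [abs_of_nonneg (by positivity)]
    exact div_le_self (Nat.cast_nonneg _) hn1
  have a2 : |s₀ * Real.log n / (n * meanLog ν)| ≤ s₀ * (meanLog ν)⁻¹ := by
    rw [abs_of_nonneg (div_nonneg (mul_nonneg (Nat.cast_nonneg _) (Real.log_nonneg hn1))
      (by positivity)), ← div_div, div_eq_mul_inv]
    refine mul_le_mul_of_nonneg_right ?_ hμ'.le
    rw [mul_div_assoc]
    refine mul_le_of_le_one_right (Nat.cast_nonneg _) ?_
    rw [div_le_one hn0]
    linarith [Real.log_le_sub_one_of_pos hn0]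
  have a3 : |(meanLog ν)⁻¹ * ∑ i, ((k i + s₁ : ℕ) : ℝ) / n * Real.log (((k i + s₁ : ℕ) : ℝ) / n)|
      ≤ (meanLog ν)⁻¹ * b := by
    rw [abs_mul, abs_of_pos hμ']
    refine mul_le_mul_of_nonneg_left ?_ hμ'.le
    refine (Finset.abs_sum_le_sum_abs _ _).trans ?_
    refine (Finset.sum_le_sum fun i _ => abs_mul_log_le_one (by positivity) ?_).trans (by simp)
    rw [div_le_one hn0]
    exact_mod_cast child_le hs hn hk i
  have a4 : |(∑ i, meanRest s s₀ s₁ ν (k i + s₁) - meanRest s s₀ s₁ ν n) / n| ≤ 2 * L := by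
    rw [abs_div, abs_of_pos hn0, div_le_iff₀ hn0]
    refine (abs_sub _ _).trans ?_
    have : |∑ i, meanRest s s₀ s₁ ν (k i + s₁)| ≤ L * n := by
      refine (Finset.abs_sum_le_sum_abs _ _).trans ((Finset.sum_le_sum fun i _ => hf _).trans ?_)
      rw [← Finset.mul_sum]
      exact mul_le_mul_of_nonneg_left hsum hL0
    linarith [hf n]
  rw [toll_eq hs hn hk]
  refine (abs_add_le _ _).trans (add_le_add ((abs_add_le _ _).trans (add_le_add
    ((abs_sub _ _).trans (add_le_add ((abs_sub _ _).trans (add_le_add (by simp) a1)) a2)) a3)) a4)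

/-- The toll is centred: this is the recursion for the mean path length. -/
lemma integral_toll (hs : IsAdmissible b s s₀ s₁) (hν : IsSplitLaw ν)
    (hV : ν {v | ∃ i, v i = 1} < 1) {n : ℕ} (hn : s < n) :
    ∫ p, toll s s₀ s₁ ν n p.2 ∂throwLaw ν (n - s₀ - b * s₁) = 0 := by
  have hP := isProbabilityMeasure_throwLaw hν (n - s₀ - b * s₁)
  have hi := (isTame_throw (b := b) fun k =>
    ∑ i, (((k i + s₁ : ℕ) : ℝ) + meanPath s s₀ s₁ ν (k i + s₁))).integrable hν (n - s₀ - b * s₁)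
  simp only [toll]
  rw [integral_div, integral_sub hi (integrable_const _), ← meanPath_eq_integral hs hν hV hn]
  simp

lemma integral_cost (hν : IsSplitLaw ν) (hV : ν {v | ∃ i, v i = 1} < 1) :
    ∫ v, cost ν v ∂ν = 0 := by
  have hp := hν.isProbabilityMeasure
  have hi := integrable_vector hν measurable_sum_mul_log abs_sum_mul_log_le
  have hμ := meanLog_pos hν hV
  have h : ∫ v, ∑ i, v i * Real.log (v i) ∂ν = - meanLog ν := by rw [meanLog_eq, neg_neg]
  simp only [cost]
  rw [integral_add (integrable_const _) (hi.const_mul _), integral_const_mul, h]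
  simp [hμ.ne']

lemma measurable_cost : Measurable (cost ν) := by
  unfold cost
  fun_prop

lemma abs_cost_le (hν : IsSplitLaw ν) (hV : ν {v | ∃ i, v i = 1} < 1) (v : Fin b → ℝ)
    (hv : v ∈ stdSimplex ℝ (Fin b)) : |cost ν v| ≤ 1 + (meanLog ν)⁻¹ * b := by
  have hμ := inv_pos.2 (meanLog_pos hν hV)
  refine (abs_add_le _ _).trans (add_le_add (by simp) ?_)
  rw [abs_mul, abs_of_pos hμ]
  exact mul_le_mul_of_nonneg_left (abs_sum_mul_log_le v hv) hμ.le

/-- The relative sizes of the children converge to the split vector in mean square. -/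
lemma integral_child_sub_sq_le (hs : IsAdmissible b s s₀ s₁) (hν : IsSplitLaw ν) {n : ℕ}
    (hn : s < n) :
    ∫ p, ∑ i, (((p.2 i + s₁ : ℕ) : ℝ) / n - p.1 i) ^ 2 ∂throwLaw ν (n - s₀ - b * s₁)
      ≤ b * (2 + 2 * (s₁ + (s₀ + b * s₁)) ^ 2) / n := by
  have hp := hν.isProbabilityMeasure
  have hnm := throws_add_eq hs hn
  set m := n - s₀ - b * s₁ with hm
  have hP := isProbabilityMeasure_throwLaw hν m
  have hn1 : (1 : ℝ) ≤ n := by exact_mod_cast (by omega : 1 ≤ n)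
  have hn0 : (0 : ℝ) < n := by linarith
  have hnr : (n : ℝ) = m + (s₀ + b * s₁) := by
    have : (n : ℝ) = m + s₀ + b * s₁ := by exact_mod_cast hnm.symm
    rw [this]; ring
  set t : ℝ := s₀ + b * s₁ with ht
  have ht0 : 0 ≤ t := by positivity
  have hs1 : (0 : ℝ) ≤ s₁ := Nat.cast_nonneg _
  have hm0 : (0 : ℝ) ≤ m := Nat.cast_nonneg m
  have ht1 : IsTame fun p : (Fin b → ℝ) × (Fin b → ℕ) =>
      ∑ i, (((p.2 i + s₁ : ℕ) : ℝ) / n - p.1 i) ^ 2 :=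
    IsTame.sum fun i => ((isTame_throw fun k => ((k i + s₁ : ℕ) : ℝ) / n).sub (isTame_coord i)).pow 2
  refine (ht1.integral_mono hν (isTame_const (b * (2 + 2 * (s₁ + t) ^ 2) / n)) m ?_).trans
    (by simp)
  intro v hv
  rw [multMean_const hv, multMean_sum (g := fun i k => (((k i + s₁ : ℕ) : ℝ) / n - v i) ^ 2)]
  have h1 : ∀ i, multMean m v (fun k => (((k i + s₁ : ℕ) : ℝ) / n - v i) ^ 2)
      ≤ (2 + 2 * (s₁ + t) ^ 2) / n := by
    intro i
    have h2 : multMean m v (fun k => (((k i + s₁ : ℕ) : ℝ) / n - v i) ^ 2)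
        ≤ multMean m v (fun k => (2 / (n : ℝ) ^ 2) * ((k i : ℝ) - m * v i) ^ 2
          + 2 * (s₁ + t) ^ 2 / (n : ℝ) ^ 2) := by
      refine multMean_mono hv.1 fun k _ => ?_
      have h3 : ((k i + s₁ : ℕ) : ℝ) / n - v i = (((k i : ℝ) - m * v i) + (s₁ - t * v i)) / n := by
        push_cast; rw [hnr]
        have : (m : ℝ) + t ≠ 0 := by rw [← hnr]; exact hn0.ne'
        field_simp; ring
      have h4 : (s₁ - t * v i) ^ 2 ≤ (s₁ + t) ^ 2 := by
        refine sq_le_sq' ?_ ?_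
        · nlinarith [mul_nonneg ht0 (sub_nonneg.2 (coord_le_one hv i))]
        · nlinarith [mul_nonneg ht0 (hv.1 i)]
      rw [h3, div_pow, div_mul_eq_mul_div, ← add_div]
      gcongr
      nlinarith [sq_nonneg ((k i : ℝ) - m * v i - (s₁ - t * v i))]
    refine h2.trans ?_
    rw [multMean_add, multMean_const hv, multMean_const_mul]
    have h5 := multMean_sub_sq_le hv m i
    have h6 : multMean m v (fun k => ((k i : ℝ) - m * v i) ^ 2) ≤ n := h5.trans (by linarith)
    have h7 : 2 / (n : ℝ) ^ 2 * multMean m v (fun k => ((k i : ℝ) - m * v i) ^ 2)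
        ≤ 2 / (n : ℝ) ^ 2 * n := mul_le_mul_of_nonneg_left h6 (by positivity)
    have h8 : 2 / (n : ℝ) ^ 2 * n = 2 / n := by field_simp
    have h9 : 2 * (s₁ + t) ^ 2 / (n : ℝ) ^ 2 ≤ 2 * (s₁ + t) ^ 2 / n := by
      gcongr
      nlinarith
    rw [add_div]
    linarith
  refine (Finset.sum_le_sum fun i _ => h1 i).trans (le_of_eq ?_)
  simp
  ring

/-- Uniform continuity of `x ln x` on the unit interval. -/
lemma exists_abs_mul_log_sub_le {ε : ℝ} (hε : 0 < ε) : ∃ K, 0 ≤ K ∧ ∀ x ∈ Set.Icc (0 : ℝ) 1,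
    ∀ y ∈ Set.Icc (0 : ℝ) 1, |x * Real.log x - y * Real.log y| ≤ ε + K * |x - y| := by
  have hu : UniformContinuousOn (fun x : ℝ => x * Real.log x) (Set.Icc 0 1) :=
    isCompact_Icc.uniformContinuousOn_of_continuous Real.continuous_mul_log.continuousOn
  obtain ⟨δ, hδ, h⟩ := Metric.uniformContinuousOn_iff.1 hu ε hε
  refine ⟨2 / δ, by positivity, fun x hx y hy => ?_⟩
  rcases lt_or_ge (dist x y) δ with hd | hd
  · have := h x hx y hy hd
    rw [Real.dist_eq] at this
    have : 0 ≤ 2 / δ * |x - y| := by positivity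
    linarith
  · rw [Real.dist_eq] at hd
    have h1 := abs_mul_log_le_one hx.1 hx.2
    have h2 := abs_mul_log_le_one hy.1 hy.2
    have h3 : 2 ≤ 2 / δ * |x - y| := by
      rw [div_mul_eq_mul_div, le_div_iff₀ hδ]
      linarith
    have := abs_sub (x * Real.log x) (y * Real.log y)
    linarith

/-- By the Lipschitz bound on `meanRest` and continuity of `x ln x`, the remainder is controlled by
the distance between the relative sizes of the children and the split vector. -/
lemma tendsto_integral_tollRest_sq (hs : IsAdmissible b s s₀ s₁) (hν : IsSplitLaw ν)
    (hV : ν {v | ∃ i, v i = 1} < 1) :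
    Tendsto (fun n => ∫ p, tollRest s s₀ s₁ ν n p ^ 2 ∂throwLaw ν (n - s₀ - b * s₁))
      atTop (𝓝 0) := by
  obtain ⟨L, hL0, hL⟩ := abs_meanRest_sub_le hs hν hV
  have hμ := meanLog_pos hν hV
  have hμ' := inv_pos.2 hμ
  set r : ℕ → ℝ := fun n => s₀ / n + s₀ * Real.log n / (n * meanLog ν) + L * b / n with hr
  have hr0 : Tendsto r atTop (𝓝 0) := by
    have h1 : Tendsto (fun n : ℕ => (s₀ : ℝ) / n) atTop (𝓝 0) :=
      tendsto_const_div_atTop_nhds_zero_nat _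
    have h2 : Tendsto (fun n : ℕ => L * b / n) atTop (𝓝 0) :=
      tendsto_const_div_atTop_nhds_zero_nat _
    have h3 : Tendsto (fun n : ℕ => s₀ * Real.log n / (n * meanLog ν)) atTop (𝓝 0) := by
      have h4 : Tendsto (fun x : ℝ => Real.log x / x) atTop (𝓝 0) :=
        Real.isLittleO_log_id_atTop.tendsto_div_nhds_zero
      have h5 := (h4.comp tendsto_natCast_atTop_atTop).const_mul (s₀ * (meanLog ν)⁻¹)
      rw [mul_zero] at h5
      refine h5.congr fun n => ?_
      simp only [Function.comp]
      rw [div_eq_mul_inv, div_eq_mul_inv, mul_inv]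
      ring
    simpa using (h1.add h3).add h2
  -- a pointwise bound in terms of the relative sizes of the children
  have hpt : ∀ ε > 0, ∃ K, 0 ≤ K ∧ ∀ n, s < n → ∀ v ∈ stdSimplex ℝ (Fin b), ∀ k : Fin b → ℕ,
      ∑ i, k i = n - s₀ - b * s₁ → |tollRest s s₀ s₁ ν n (v, k)|
        ≤ r n + ε + K * ∑ i, |((k i + s₁ : ℕ) : ℝ) / n - v i| := by
    intro ε hε
    obtain ⟨K, hK0, hK⟩ := exists_abs_mul_log_sub_le (ε := ε * meanLog ν / (b + 1)) (by positivity)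
    refine ⟨(meanLog ν)⁻¹ * K + L, by positivity, fun n hn v hv k hk => ?_⟩
    have hn1 : (1 : ℝ) ≤ n := by exact_mod_cast (by omega : 1 ≤ n)
    have hn0 : (0 : ℝ) < n := by linarith
    have h1 : tollRest s s₀ s₁ ν n (v, k) = - (s₀ / n) - s₀ * Real.log n / (n * meanLog ν)
        + (meanLog ν)⁻¹ * ∑ i, (((k i + s₁ : ℕ) : ℝ) / n * Real.log (((k i + s₁ : ℕ) : ℝ) / n)
            - v i * Real.log (v i))
        + ∑ i, (meanRest s s₀ s₁ ν (k i + s₁) - meanRest s s₀ s₁ ν ⌊(n : ℝ) * v i⌋₊) / n := by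
      have h2 : ∑ i, v i * (meanOsc s s₀ s₁ ν (n * v i) - meanOsc s s₀ s₁ ν n)
          = ∑ i, meanRest s s₀ s₁ ν ⌊(n : ℝ) * v i⌋₊ / n - meanRest s s₀ s₁ ν n / n := by
        simp only [mul_sub, Finset.sum_sub_distrib, ← Finset.sum_mul, hv.2,
          mul_meanOsc hn0 (hv.1 _)]
        simp [meanOsc]
      simp only [tollRest, toll_eq hs hn hk, cost, h2, Finset.sum_sub_distrib, ← Finset.sum_div]
      ring
    have a1 : |(meanLog ν)⁻¹ * ∑ i, (((k i + s₁ : ℕ) : ℝ) / n *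
        Real.log (((k i + s₁ : ℕ) : ℝ) / n) - v i * Real.log (v i))|
        ≤ ε + (meanLog ν)⁻¹ * K * ∑ i, |((k i + s₁ : ℕ) : ℝ) / n - v i| := by
      rw [abs_mul, abs_of_pos hμ']
      have h3 : |∑ i, (((k i + s₁ : ℕ) : ℝ) / n *
          Real.log (((k i + s₁ : ℕ) : ℝ) / n) - v i * Real.log (v i))|
          ≤ b * (ε * meanLog ν / (b + 1)) + K * ∑ i, |((k i + s₁ : ℕ) : ℝ) / n - v i| := by
        refine (Finset.abs_sum_le_sum_abs _ _).trans ?_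
        refine (Finset.sum_le_sum fun i _ => hK _ ⟨by positivity, ?_⟩ _
          ⟨hv.1 i, coord_le_one hv i⟩).trans (le_of_eq ?_)
        · rw [div_le_one hn0]
          exact_mod_cast child_le hs hn hk i
        · rw [Finset.sum_add_distrib, Finset.mul_sum]; simp
      have h4 : (meanLog ν)⁻¹ * (b * (ε * meanLog ν / (b + 1))) ≤ ε := by
        have : (meanLog ν)⁻¹ * (b * (ε * meanLog ν / (b + 1))) = ε * (b / (b + 1)) := by
          field_simp
        rw [this]
        refine mul_le_of_le_one_right hε.le ?_
        rw [div_le_one (by positivity)]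
        linarith
      have := mul_le_mul_of_nonneg_left h3 hμ'.le
      rw [mul_add, ← mul_assoc _ K] at this
      linarith
    have a2 : |∑ i, (meanRest s s₀ s₁ ν (k i + s₁) - meanRest s s₀ s₁ ν ⌊(n : ℝ) * v i⌋₊) / n|
        ≤ L * b / n + L * ∑ i, |((k i + s₁ : ℕ) : ℝ) / n - v i| := by
      refine (Finset.abs_sum_le_sum_abs _ _).trans ?_
      have h5 : ∀ i, |(meanRest s s₀ s₁ ν (k i + s₁) - meanRest s s₀ s₁ ν ⌊(n : ℝ) * v i⌋₊) / n|
          ≤ L / n + L * |((k i + s₁ : ℕ) : ℝ) / n - v i| := by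
        intro i
        rw [abs_div, abs_of_pos hn0, div_le_iff₀ hn0]
        refine (hL _ _).trans ?_
        have h6 : |((k i + s₁ : ℕ) : ℝ) - (⌊(n : ℝ) * v i⌋₊ : ℝ)|
            ≤ 1 + |((k i + s₁ : ℕ) : ℝ) - n * v i| := by
          have h7 : |(n : ℝ) * v i - (⌊(n : ℝ) * v i⌋₊ : ℝ)| ≤ 1 := by
            have := Nat.floor_le (mul_nonneg hn0.le (hv.1 i))
            have := Nat.lt_floor_add_one ((n : ℝ) * v i)
            rw [abs_le]
            constructor <;> linarith
          have := abs_sub_le ((k i + s₁ : ℕ) : ℝ) (n * v i) (⌊(n : ℝ) * v i⌋₊ : ℝ)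
          linarith
        have h8 : |((k i + s₁ : ℕ) : ℝ) / n - v i| * n = |((k i + s₁ : ℕ) : ℝ) - n * v i| := by
          rw [← abs_of_pos hn0, ← abs_mul, abs_of_pos hn0]
          congr 1
          field_simp
        have h9 : (L / n + L * |((k i + s₁ : ℕ) : ℝ) / n - v i|) * n
            = L * (1 + |((k i + s₁ : ℕ) : ℝ) - n * v i|) := by
          rw [add_mul, mul_assoc, h8]
          field_simp
        rw [h9]
        exact mul_le_mul_of_nonneg_left h6 hL0
      refine (Finset.sum_le_sum fun i _ => h5 i).trans (le_of_eq ?_)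
      rw [Finset.sum_add_distrib, Finset.mul_sum]
      simp
      ring
    have a3 : |(s₀ : ℝ) / n| = s₀ / n := abs_of_nonneg (by positivity)
    have a4 : |s₀ * Real.log n / (n * meanLog ν)| = s₀ * Real.log n / (n * meanLog ν) :=
      abs_of_nonneg (div_nonneg (mul_nonneg (Nat.cast_nonneg _) (Real.log_nonneg hn1))
        (by positivity))
    rw [h1]
    refine (abs_add_le _ _).trans ((add_le_add ((abs_add_le _ _).trans (add_le_add
      ((abs_sub _ _).trans (le_of_eq (by rw [abs_neg, a3, a4]))) a1)) a2).trans (le_of_eq ?_))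
    simp only [hr]
    ring
  rw [Metric.tendsto_atTop]
  intro ε hε
  obtain ⟨K, hK0, hK⟩ := hpt (Real.sqrt (ε / 12)) (by positivity)
  set K₀ : ℝ := b * (2 + 2 * (s₁ + (s₀ + b * s₁)) ^ 2) with hK₀
  have hlim : Tendsto (fun n : ℕ => 3 * r n ^ 2 + 3 * K ^ 2 * b * (K₀ / n)) atTop (𝓝 0) := by
    have := ((hr0.pow 2).const_mul 3).add
      ((tendsto_const_div_atTop_nhds_zero_nat K₀).const_mul (3 * K ^ 2 * b))
    simpa using this
  obtain ⟨N, hN⟩ := Metric.tendsto_atTop.1 hlim (ε / 2) (by positivity)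
  refine ⟨max N (s + 1), fun n hn => ?_⟩
  have hsn : s < n := by have := le_max_right N (s + 1); omega
  have h1 := hN n ((le_max_left _ _).trans hn)
  rw [Real.dist_eq, sub_zero] at h1 ⊢
  rw [abs_of_nonneg (integral_nonneg fun _ => sq_nonneg _)]
  have hP := isProbabilityMeasure_throwLaw hν (n - s₀ - b * s₁)
  have htd : IsTame fun p : (Fin b → ℝ) × (Fin b → ℕ) =>
      ∑ i, (((p.2 i + s₁ : ℕ) : ℝ) / n - p.1 i) ^ 2 :=
    IsTame.sum fun i => ((isTame_throw fun k => ((k i + s₁ : ℕ) : ℝ) / n).sub (isTame_coord i)).pow 2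
  have hle : ∫ p, tollRest s s₀ s₁ ν n p ^ 2 ∂throwLaw ν (n - s₀ - b * s₁)
      ≤ ∫ p, ((3 * r n ^ 2 + ε / 4) + 3 * K ^ 2 * b *
        ∑ i, (((p.2 i + s₁ : ℕ) : ℝ) / n - p.1 i) ^ 2) ∂throwLaw ν (n - s₀ - b * s₁) := by
    refine integral_mono_ae (((isTame_tollRest hs hν hV n).pow 2).integrable hν _)
      (((isTame_const _).add (htd.const_mul _)).integrable hν _) ?_
    filter_upwards [ae_throwLaw hν (n - s₀ - b * s₁)] with p hp
    have h2 := hK n hsn p.1 hp.1 p.2 hp.2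
    set S := ∑ i, |((p.2 i + s₁ : ℕ) : ℝ) / n - p.1 i| with hS
    have h3 : S ^ 2 ≤ b * ∑ i, (((p.2 i + s₁ : ℕ) : ℝ) / n - p.1 i) ^ 2 := by
      have := sq_sum_le_card_mul_sum_sq (s := (Finset.univ : Finset (Fin b)))
        (f := fun i => |((p.2 i + s₁ : ℕ) : ℝ) / n - p.1 i|)
      rw [Finset.card_univ, Fintype.card_fin] at this
      simp only [sq_abs] at this
      exact this
    have h4 : tollRest s s₀ s₁ ν n p ^ 2 ≤ (r n + Real.sqrt (ε / 12) + K * S) ^ 2 := by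
      rw [← sq_abs]
      exact pow_le_pow_left₀ (abs_nonneg _) h2 2
    have h5 : Real.sqrt (ε / 12) ^ 2 = ε / 12 := Real.sq_sqrt (by positivity)
    have h6 : (r n + Real.sqrt (ε / 12) + K * S) ^ 2
        ≤ 3 * (r n ^ 2 + Real.sqrt (ε / 12) ^ 2 + (K * S) ^ 2) := by
      nlinarith [sq_nonneg (r n - Real.sqrt (ε / 12)), sq_nonneg (r n - K * S),
        sq_nonneg (Real.sqrt (ε / 12) - K * S)]
    have h7 := mul_le_mul_of_nonneg_left h3 (by positivity : 0 ≤ 3 * K ^ 2)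
    rw [h5] at h6
    nlinarith
  rw [(isTame_const _).integral_add hν (htd.const_mul _), integral_const_mul] at hle
  simp only [integral_const, probReal_univ, one_smul] at hle
  have h8 := integral_child_sub_sq_le hs hν hsn
  rw [← hK₀] at h8
  have h9 := mul_le_mul_of_nonneg_left h8 (by positivity : 0 ≤ 3 * K ^ 2 * b)
  have h10 := (abs_lt.1 h1).2
  linarith

/-- The mean square distance between the toll and its limit tends to zero. The oscillations of the
mean are asymptotically harmonic, since the toll and its limit are centred; so they do not
contribute, by `tendsto_scaleFluct`. -/
theorem tendsto_integral_toll_sub_cost_sq (hs : IsAdmissible b s s₀ s₁) (hν : IsSplitLaw ν)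
    (hV : ν {v | ∃ i, v i = 1} < 1) :
    Tendsto (fun n => ∫ p, (toll s s₀ s₁ ν n p.2 - cost ν p.1) ^ 2
      ∂throwLaw ν (n - s₀ - b * s₁)) atTop (𝓝 0) := by
  have hp := hν.isProbabilityMeasure
  have hσ := isProbabilityMeasure_sizeBiasedLaw hν
  obtain ⟨L, hL0, hL⟩ := abs_meanRest_sub_le hs hν hV
  have hGb := isBoundedMeasurable_meanOsc hs hν hV
  have hrest := tendsto_integral_tollRest_sq hs hν hV
  set G := meanOsc s s₀ s₁ ν with hG
  set f := meanRest s s₀ s₁ ν with hf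
  obtain ⟨c, hc⟩ := hGb.bounded
  have hGm := hGb.measurable
  have hfl : ∀ j : ℕ, |f j| ≤ L * j := fun j => by
    have h := hL j 0
    rwa [show f 0 = 0 from meanRest_zero, sub_zero, Nat.cast_zero, sub_zero, Nat.abs_cast] at h
  have hmean : ∀ x, scaleMean (sizeBiasedLaw ν) G x = ∫ v, ∑ i, v i * G (x * v i) ∂ν := fun x =>
    (integral_sizeBiasedLaw hν (H := fun ξ => G (x * ξ)) ⟨by fun_prop, c, fun _ => hc _⟩).2
  have hvi : ∀ x, Integrable (fun v : Fin b → ℝ => ∑ i, v i * G (x * v i)) ν := by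
    intro x
    refine integrable_vector hν (by fun_prop) (c := c) fun v hv => ?_
    refine (Finset.abs_sum_le_sum_abs _ _).trans ?_
    have : ∀ i, |v i * G (x * v i)| ≤ v i * c := fun i => by
      rw [abs_mul, abs_of_nonneg (hv.1 i)]
      exact mul_le_mul_of_nonneg_left (hc _) (hv.1 i)
    refine (Finset.sum_le_sum fun i _ => this i).trans ?_
    rw [← Finset.sum_mul, hv.2, one_mul]
  set η : ℝ → ℝ := fun x => G x - scaleMean (sizeBiasedLaw ν) G x with hη
  -- at integers, the defect of harmonicity of the oscillations is the mean of the remainder, since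
  -- the toll and the cost are centred
  have hηn : Tendsto (fun n : ℕ => η n) atTop (𝓝 0) := by
    have h1 : ∀ᶠ n : ℕ in atTop, ‖η n‖ ≤
        Real.sqrt (∫ p, tollRest s s₀ s₁ ν n p ^ 2 ∂throwLaw ν (n - s₀ - b * s₁)) := by
      filter_upwards [eventually_gt_atTop s] with n hn
      have hP := isProbabilityMeasure_throwLaw hν (n - s₀ - b * s₁)
      set lam := throwLaw ν (n - s₀ - b * s₁) with hlam
      have hT := isTame_tollRest hs hν hV n
      have hosc : IsTame fun p : (Fin b → ℝ) × (Fin b → ℕ) =>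
          ∑ i, p.1 i * (G (n * p.1 i) - G n) :=
        IsTame.sum fun i => (isTame_coord i).mul (IsTame.sub (isTame_vector
          (g := fun v : Fin b → ℝ => G (n * v i)) (by fun_prop) fun v _ => hc _) (isTame_const _))
      have ht1 := isTame_throw (b := b) (toll s s₀ s₁ ν n)
      have ht2 := isTame_vector measurable_cost (abs_cost_le hν hV)
      have h2 : ∫ p, tollRest s s₀ s₁ ν n p ∂lam = η n := by
        have h3 : ∫ p, toll s s₀ s₁ ν n p.2 ∂lam = 0 := integral_toll hs hν hV hn
        have h4 : ∫ p, cost ν p.1 ∂lam = 0 := by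
          rw [hlam, integral_throwLaw_vector hν _ measurable_cost (abs_cost_le hν hV),
            integral_cost hν hV]
        have h5 : ∫ p, ∑ i, p.1 i * (G (n * p.1 i) - G n) ∂lam
            = scaleMean (sizeBiasedLaw ν) G n - G n := by
          have h6 : ∫ p, ∑ i, p.1 i * (G (n * p.1 i) - G n) ∂lam
              = ∫ v, ∑ i, v i * (G (n * v i) - G n) ∂ν := by
            refine integral_throwLaw_vector hν _ (g := fun v => ∑ i, v i * (G (n * v i) - G n))
              (by fun_prop) (c := 2 * c) fun v hv => ?_
            refine (Finset.abs_sum_le_sum_abs _ _).trans ?_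
            have : ∀ i, |v i * (G (n * v i) - G n)| ≤ v i * (2 * c) := fun i => by
              rw [abs_mul, abs_of_nonneg (hv.1 i)]
              refine mul_le_mul_of_nonneg_left ((abs_sub _ _).trans ?_) (hv.1 i)
              linarith [hc (n * v i), hc n]
            refine (Finset.sum_le_sum fun i _ => this i).trans ?_
            rw [← Finset.sum_mul, hv.2, one_mul]
          have h7 : ∫ v, ∑ i, v i * (G (n * v i) - G n) ∂ν
              = ∫ v, (∑ i, v i * G (n * v i) - G n) ∂ν := by
            refine integral_congr_ae ?_
            filter_upwards [hν.mem_simplex] with v hv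
            simp only [mul_sub, Finset.sum_sub_distrib, ← Finset.sum_mul, hv.2, one_mul]
          rw [h6, h7, integral_sub (hvi _) (integrable_const _), hmean]
          simp
        simp only [tollRest]
        rw [integral_sub ((ht1.sub ht2).integrable hν _) (hosc.integrable hν _),
          integral_sub (ht1.integrable hν _) (ht2.integrable hν _), h3, h4, h5]
        simp only [hη]
        ring
      rw [← h2, Real.norm_eq_abs]
      refine Real.abs_le_sqrt ?_
      have h8 : 0 ≤ ∫ p, (tollRest s s₀ s₁ ν n p - η n) ^ 2 ∂lam :=
        integral_nonneg fun _ => sq_nonneg _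
      have h9 : ∀ p, (tollRest s s₀ s₁ ν n p - η n) ^ 2
          = (tollRest s s₀ s₁ ν n p ^ 2 + (-(2 * η n)) * tollRest s s₀ s₁ ν n p) + η n ^ 2 :=
        fun p => by ring
      simp only [h9] at h8
      rw [((hT.pow 2).add (hT.const_mul _)).integral_add hν (isTame_const _),
        (hT.pow 2).integral_add hν (hT.const_mul _), integral_const_mul, ← hlam, h2] at h8
      simp at h8
      rw [h2]
      nlinarith
    have h2 : Tendsto (fun n => Real.sqrt (∫ p, tollRest s s₀ s₁ ν n p ^ 2
        ∂throwLaw ν (n - s₀ - b * s₁))) atTop (𝓝 0) := by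
      have := (Real.continuous_sqrt.tendsto 0).comp hrest
      rw [Real.sqrt_zero] at this
      exact this
    exact squeeze_zero_norm' h1 h2
  -- the oscillations vary little between consecutive integers
  have hηx : Tendsto η atTop (𝓝 0) := by
    have h1 : ∀ᶠ x : ℝ in atTop, ‖η x - η ⌊x⌋₊‖ ≤ (2 * L + b * (2 * L)) / x := by
      filter_upwards [eventually_ge_atTop 1] with x hx
      have hx0 : 0 < x := by linarith
      set n := ⌊x⌋₊ with hn
      have hn1 : 1 ≤ n := Nat.le_floor (by simpa using hx)
      have hn0 : (0 : ℝ) < n := by exact_mod_cast hn1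
      have hnx : (n : ℝ) ≤ x := Nat.floor_le hx0.le
      have hxn : x < n + 1 := Nat.lt_floor_add_one x
      have h0 : |1 / x - 1 / (n : ℝ)| ≤ 1 / (n * x) := by
        rw [abs_sub_comm, div_sub_div _ _ hn0.ne' hx0.ne', abs_of_nonneg
          (div_nonneg (by linarith) (by positivity))]
        gcongr
        linarith
      have h2 : |G x - G n| ≤ L / x := by
        have : G x - G n = f n * (1 / x - 1 / n) := by
          simp only [hG, meanOsc, Nat.floor_natCast, ← hn, ← hf]
          ring
        rw [this, abs_mul]
        refine (mul_le_mul (hfl n) h0 (abs_nonneg _) (by positivity)).trans (le_of_eq ?_)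
        field_simp
      have h3 : ∀ v ∈ stdSimplex ℝ (Fin b), ∀ i,
          |v i * G (x * v i) - v i * G (n * v i)| ≤ 2 * L / x + v i * (L / x) := by
        intro v hv i
        have hv0 := hv.1 i
        have hv1 := coord_le_one hv i
        rw [mul_meanOsc hx0 hv0, mul_meanOsc hn0 hv0, ← hf]
        have e1 : f ⌊x * v i⌋₊ / x - f ⌊(n : ℝ) * v i⌋₊ / n
            = (f ⌊x * v i⌋₊ - f ⌊(n : ℝ) * v i⌋₊) / x
              + f ⌊(n : ℝ) * v i⌋₊ * (1 / x - 1 / n) := by ring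
        rw [e1]
        refine (abs_add_le _ _).trans (add_le_add ?_ ?_)
        · rw [abs_div, abs_of_pos hx0]
          gcongr
          refine (hL _ _).trans ?_
          rw [mul_comm]
          gcongr
          have := Nat.floor_le (mul_nonneg hx0.le hv0)
          have := Nat.lt_floor_add_one (x * v i)
          have := Nat.floor_le (mul_nonneg hn0.le hv0)
          have := Nat.lt_floor_add_one ((n : ℝ) * v i)
          have := mul_le_mul_of_nonneg_right hnx hv0
          have : x * v i ≤ n * v i + 1 := by nlinarith
          rw [abs_le]
          constructor <;> linarith
        · rw [abs_mul]
          refine (mul_le_mul ((hfl _).trans (mul_le_mul_of_nonneg_left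
            (Nat.floor_le (mul_nonneg hn0.le hv0)) hL0)) h0 (abs_nonneg _)
            (by positivity)).trans (le_of_eq ?_)
          field_simp
      have h4 : |scaleMean (sizeBiasedLaw ν) G x - scaleMean (sizeBiasedLaw ν) G n|
          ≤ (b * (2 * L) + L) / x := by
        rw [hmean, hmean, ← integral_sub (hvi x) (hvi n)]
        have := norm_integral_le_of_norm_le_const (μ := ν) (C := (b * (2 * L) + L) / x)
          (f := fun v => ∑ i, v i * G (x * v i) - ∑ i, v i * G (n * v i)) (by
            filter_upwards [hν.mem_simplex] with v hv
            rw [← Finset.sum_sub_distrib, Real.norm_eq_abs]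
            refine (Finset.abs_sum_le_sum_abs _ _).trans
              ((Finset.sum_le_sum fun i _ => h3 v hv i).trans (le_of_eq ?_))
            rw [Finset.sum_add_distrib, ← Finset.sum_mul, hv.2]
            simp
            ring)
        simpa using this
      have h5 : η x - η n = (G x - G n)
          - (scaleMean (sizeBiasedLaw ν) G x - scaleMean (sizeBiasedLaw ν) G n) := by
        simp only [hη]; ring
      rw [h5, Real.norm_eq_abs]
      refine (abs_sub _ _).trans ((add_le_add h2 h4).trans (le_of_eq ?_))
      ring
    have h2 : Tendsto (fun x => η x - η ⌊x⌋₊) atTop (𝓝 0) :=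
      squeeze_zero_norm' h1 (tendsto_const_nhds.div_atTop tendsto_id)
    have h3 := h2.add (hηn.comp tendsto_nat_floor_atTop)
    simpa using h3
  have hfluct := tendsto_scaleFluct (ae_sizeBiasedLaw_pos (ν := ν)) hGb hηx
  have hfl2 : Tendsto (fun n : ℕ => scaleFluct (sizeBiasedLaw ν) G n) atTop (𝓝 0) :=
    hfluct.comp tendsto_natCast_atTop_atTop
  have hlim := (hrest.const_mul 2).add (hfl2.const_mul 2)
  rw [mul_zero, add_zero] at hlim
  refine squeeze_zero' (Eventually.of_forall fun n => integral_nonneg fun _ => sq_nonneg _)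
    ?_ hlim
  filter_upwards [eventually_gt_atTop s] with n hn
  have hP := isProbabilityMeasure_throwLaw hν (n - s₀ - b * s₁)
  have hT := isTame_tollRest hs hν hV n
  have ht1 := isTame_throw (b := b) (toll s s₀ s₁ ν n)
  have ht2 := isTame_vector measurable_cost (abs_cost_le hν hV)
  have hosc : IsTame fun p : (Fin b → ℝ) × (Fin b → ℕ) =>
      ∑ i, p.1 i * (G (n * p.1 i) - G n) ^ 2 :=
    IsTame.sum fun i => (isTame_coord i).mul (IsTame.pow (IsTame.sub (isTame_vector
      (g := fun v : Fin b → ℝ => G (n * v i)) (by fun_prop) fun v _ => hc _) (isTame_const _)) 2)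
  have h1 : ∫ p, ∑ i, p.1 i * (G (n * p.1 i) - G n) ^ 2 ∂throwLaw ν (n - s₀ - b * s₁)
      = scaleFluct (sizeBiasedLaw ν) G n := by
    have hb : ∀ x, |(G (n * x) - G n) ^ 2| ≤ (2 * c) ^ 2 := fun x => by
      rw [abs_pow]
      refine pow_le_pow_left₀ (abs_nonneg _) ((abs_sub _ _).trans ?_) 2
      linarith [hc (n * x), hc n]
    rw [scaleFluct, (integral_sizeBiasedLaw hν (H := fun ξ => (G (n * ξ) - G n) ^ 2)
      ⟨by fun_prop, (2 * c) ^ 2, hb⟩).2]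
    refine integral_throwLaw_vector hν _ (g := fun v => ∑ i, v i * (G (n * v i) - G n) ^ 2)
      (by fun_prop) (c := (2 * c) ^ 2) fun v hv => ?_
    refine (Finset.abs_sum_le_sum_abs _ _).trans ?_
    have : ∀ i, |v i * (G (n * v i) - G n) ^ 2| ≤ v i * (2 * c) ^ 2 := fun i => by
      rw [abs_mul, abs_of_nonneg (hv.1 i)]
      exact mul_le_mul_of_nonneg_left (hb _) (hv.1 i)
    refine (Finset.sum_le_sum fun i _ => this i).trans ?_
    rw [← Finset.sum_mul, hv.2, one_mul]
  rw [← h1, ← integral_const_mul, ← integral_const_mul,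
    ← ((hT.pow 2).const_mul 2).integral_add hν (hosc.const_mul 2)]
  refine integral_mono_ae (((ht1.sub ht2).pow 2).integrable hν _)
    ((((hT.pow 2).const_mul 2).add (hosc.const_mul 2)).integrable hν _) ?_
  filter_upwards [ae_throwLaw hν (n - s₀ - b * s₁)] with p hp
  have h2 : toll s s₀ s₁ ν n p.2 - cost ν p.1 = tollRest s s₀ s₁ ν n p
      + ∑ i, p.1 i * (G (n * p.1 i) - G n) := by simp only [tollRest, ← hG]; ring
  have h3 : (∑ i, p.1 i * (G (n * p.1 i) - G n)) ^ 2
      ≤ ∑ i, p.1 i * (G (n * p.1 i) - G n) ^ 2 := by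
    have := (even_two.convexOn_pow (𝕜 := ℝ)).map_sum_le (t := Finset.univ) (w := p.1)
      (p := fun i => G (n * p.1 i) - G n) (fun i _ => hp.1.1 i) hp.1.2 (fun _ _ => Set.mem_univ _)
    simpa using this
  rw [h2]
  nlinarith [sq_nonneg (tollRest s s₀ s₁ ν n p - ∑ i, p.1 i * (G (n * p.1 i) - G n))]

end

/-! ### Exponential moments of one split -/

section

variable {b s s₀ s₁ : ℕ} {ν : Measure (Fin b → ℝ)}

lemma IsTame.integral_abs_le_sqrt (hν : IsSplitLaw ν) {F : (Fin b → ℝ) × (Fin b → ℕ) → ℝ}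
    (hF : IsTame F) (m : ℕ) :
    ∫ p, |F p| ∂throwLaw ν m ≤ Real.sqrt (∫ p, F p ^ 2 ∂throwLaw ν m) := by
  have hP := isProbabilityMeasure_throwLaw hν m
  set a := ∫ p, |F p| ∂throwLaw ν m with ha
  have h8 : 0 ≤ ∫ p, (|F p| - a) ^ 2 ∂throwLaw ν m := integral_nonneg fun _ => sq_nonneg _
  have h9 : ∀ p, (|F p| - a) ^ 2 = (F p ^ 2 + (-(2 * a)) * |F p|) + a ^ 2 := fun p => by
    rw [sub_sq, sq_abs]; ring
  simp only [h9] at h8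
  rw [((hF.pow 2).add (hF.abs.const_mul _)).integral_add hν (isTame_const _),
    (hF.pow 2).integral_add hν (hF.abs.const_mul _), integral_const_mul, ← ha] at h8
  simp at h8
  exact Real.le_sqrt_of_sq_le (by nlinarith)

lemma abs_exp_sub_exp_le {x y M : ℝ} (hx : x ≤ M) (hy : y ≤ M) :
    |Real.exp x - Real.exp y| ≤ Real.exp M * |x - y| := by
  wlog h : y ≤ x generalizing x y
  · rw [abs_sub_comm, abs_sub_comm x]
    exact this hy hx (le_of_not_ge h)
  rw [abs_of_nonneg (sub_nonneg.2 (Real.exp_le_exp.2 h)), abs_of_nonneg (sub_nonneg.2 h)]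
  have h1 := Real.add_one_le_exp (y - x)
  have h2 : Real.exp y = Real.exp x * Real.exp (y - x) := by rw [← Real.exp_add]; ring_nf
  have h3 : Real.exp x - Real.exp y ≤ Real.exp x * (x - y) := by
    rw [h2]; nlinarith [Real.exp_pos x]
  exact h3.trans (mul_le_mul_of_nonneg_right (Real.exp_le_exp.2 hx) (sub_nonneg.2 h))

lemma cost_eq_one {v : Fin b → ℝ} (hv : v ∈ stdSimplex ℝ (Fin b)) (h : ∃ i, v i = 1) :
    cost ν v = 1 := by
  obtain ⟨i, hi⟩ := h
  have : ∑ j, v j * Real.log (v j) = 0 := Finset.sum_eq_zero fun j _ => by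
    by_cases hj : j = i
    · rw [hj, hi]; simp
    · rw [eq_zero_of_eq_one hv hi hj]; simp
  rw [cost, this]; simp

lemma sum_sq_eq_one {v : Fin b → ℝ} (hv : v ∈ stdSimplex ℝ (Fin b)) (h : ∃ i, v i = 1) :
    ∑ i, v i ^ 2 = 1 := by
  obtain ⟨i, hi⟩ := h
  rw [Finset.sum_eq_single i (fun j _ hj => by rw [eq_zero_of_eq_one hv hi hj]; simp) (by simp), hi]
  simp

lemma integrable_exp_cost (hν : IsSplitLaw ν) (hV : ν {v | ∃ i, v i = 1} < 1) (l κ : ℝ) :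
    Integrable (fun v => Real.exp (l * cost ν v - κ * (1 - ∑ i, v i ^ 2))) ν := by
  have hm := measurable_cost (ν := ν)
  refine integrable_vector hν (by fun_prop)
    (c := Real.exp (|l| * (1 + (meanLog ν)⁻¹ * b) + |κ| * 1)) fun v hv => ?_
  rw [abs_of_pos (Real.exp_pos _)]
  refine Real.exp_le_exp.2 ?_
  have h1 : l * cost ν v ≤ |l| * (1 + (meanLog ν)⁻¹ * b) := by
    refine (le_abs_self _).trans ?_
    rw [abs_mul]
    exact mul_le_mul_of_nonneg_left (abs_cost_le hν hV v hv) (abs_nonneg _)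
  have h2 : -(κ * (1 - ∑ i, v i ^ 2)) ≤ |κ| * 1 := by
    refine (neg_le_abs _).trans ?_
    rw [abs_mul]
    refine mul_le_mul_of_nonneg_left ?_ (abs_nonneg _)
    have := sum_sq_le_one hv
    have : 0 ≤ ∑ i, v i ^ 2 := Finset.sum_nonneg fun _ _ => sq_nonneg _
    rw [abs_le]
    constructor <;> linarith
  linarith

/-- A strong penalty on splitting leaves only the event that some `V_i` is one. -/
lemma tendsto_integral_exp_cost_penalty (hν : IsSplitLaw ν) (hV : ν {v | ∃ i, v i = 1} < 1)
    (l : ℝ) :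
    Tendsto (fun j : ℕ => ∫ v, Real.exp (l * cost ν v - j * (1 - ∑ i, v i ^ 2)) ∂ν) atTop
      (𝓝 (Real.exp l * (ν {v | ∃ i, v i = 1}).toReal)) := by
  have hp := hν.isProbabilityMeasure
  have h1 : Real.exp l * (ν {v | ∃ i, v i = 1}).toReal
      = ∫ v, Set.indicator {v : Fin b → ℝ | ∃ i, v i = 1} (fun _ => Real.exp l) v ∂ν := by
    rw [integral_indicator_const _ measurableSet_exists_eq_one, smul_eq_mul, mul_comm]
    rfl
  rw [h1]
  refine tendsto_integral_of_dominated_convergence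
    (fun v => Real.exp (l * cost ν v - 0 * (1 - ∑ i, v i ^ 2))) ?_
    (integrable_exp_cost hν hV l 0) ?_ ?_
  · exact fun j => (integrable_exp_cost hν hV l j).aestronglyMeasurable
  · intro j
    filter_upwards [hν.mem_simplex] with v hv
    rw [Real.norm_eq_abs, abs_of_pos (Real.exp_pos _)]
    refine Real.exp_le_exp.2 ?_
    have := mul_nonneg (Nat.cast_nonneg (α := ℝ) j) (sub_nonneg.2 (sum_sq_le_one hv))
    linarith
  · filter_upwards [hν.mem_simplex] with v hv
    by_cases h : ∃ i, v i = 1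
    · rw [Set.indicator_of_mem (show v ∈ {v : Fin b → ℝ | ∃ i, v i = 1} from h)]
      simp [cost_eq_one hv h, sum_sq_eq_one hv h]
    · rw [Set.indicator_of_notMem (show v ∉ {v : Fin b → ℝ | ∃ i, v i = 1} from h)]
      have h2 : 0 < 1 - ∑ i, v i ^ 2 := sub_pos.2 (sum_sq_lt_one hv h)
      refine Real.tendsto_exp_atBot.comp ?_
      have h3 : Tendsto (fun j : ℕ => (j : ℝ) * (1 - ∑ i, v i ^ 2)) atTop atTop :=
        tendsto_natCast_atTop_atTop.atTop_mul_const h2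
      exact tendsto_atBot_add_const_left _ _ (tendsto_neg_atTop_atBot.comp h3)

lemma child_sum_sq_le (hs : IsAdmissible b s s₀ s₁) {n : ℕ} (hn : s < n) {k : Fin b → ℕ}
    (hk : ∑ i, k i = n - s₀ - b * s₁) : ∑ i, ((k i + s₁ : ℕ) : ℝ) ^ 2 ≤ (n : ℝ) ^ 2 := by
  have h1 := sum_child hs hn hk
  have h2 : (∑ i, ((k i + s₁ : ℕ) : ℝ)) ≤ n := by
    rw [← Nat.cast_sum]; exact_mod_cast (by omega)
  refine (Finset.sum_sq_le_sq_sum_of_nonneg fun i _ => Nat.cast_nonneg _).trans ?_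
  exact pow_le_pow_left₀ (Finset.sum_nonneg fun i _ => Nat.cast_nonneg _) h2 2

lemma isTame_exp_toll (l κ : ℝ) (n : ℕ) : IsTame fun p : (Fin b → ℝ) × (Fin b → ℕ) =>
    Real.exp (l * toll s s₀ s₁ ν n p.2 - κ * (1 - (∑ i, ((p.2 i + s₁ : ℕ) : ℝ) ^ 2) / n ^ 2)) :=
  isTame_throw fun k : Fin b → ℕ =>
    Real.exp (l * toll s s₀ s₁ ν n k - κ * (1 - (∑ i, ((k i + s₁ : ℕ) : ℝ) ^ 2) / n ^ 2))

/-- The toll and the relative sizes converge in mean square and are bounded, so exponential moments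
of one split converge. -/
lemma tendsto_integral_exp_toll (hs : IsAdmissible b s s₀ s₁) (hν : IsSplitLaw ν)
    (hV : ν {v | ∃ i, v i = 1} < 1) (l : ℝ) {κ : ℝ} (hκ : 0 ≤ κ) :
    Tendsto (fun n : ℕ => ∫ p, Real.exp (l * toll s s₀ s₁ ν n p.2
      - κ * (1 - (∑ i, ((p.2 i + s₁ : ℕ) : ℝ) ^ 2) / n ^ 2)) ∂throwLaw ν (n - s₀ - b * s₁)) atTop
      (𝓝 (∫ v, Real.exp (l * cost ν v - κ * (1 - ∑ i, v i ^ 2)) ∂ν)) := by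
  obtain ⟨c, hc0, hc⟩ := abs_toll_le hs hν hV
  have hμ := inv_pos.2 (meanLog_pos hν hV)
  set M := |l| * c + |l| * (1 + (meanLog ν)⁻¹ * b) with hM
  set K₀ : ℝ := b * (2 + 2 * (s₁ + (s₀ + b * s₁)) ^ 2) with hK₀
  have hlim : Tendsto (fun n : ℕ => Real.exp M * (|l| * Real.sqrt
      (∫ p, (toll s s₀ s₁ ν n p.2 - cost ν p.1) ^ 2 ∂throwLaw ν (n - s₀ - b * s₁))
      + κ * 2 * Real.sqrt (b * (K₀ / n)))) atTop (𝓝 0) := by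
    have h1 := (Real.continuous_sqrt.tendsto 0).comp (tendsto_integral_toll_sub_cost_sq hs hν hV)
    have h2 := (Real.continuous_sqrt.tendsto (b * 0)).comp
      ((tendsto_const_div_atTop_nhds_zero_nat K₀).const_mul (b : ℝ))
    rw [mul_zero, Real.sqrt_zero] at h2
    rw [Real.sqrt_zero] at h1
    have h3 := ((h1.const_mul |l|).add (h2.const_mul (κ * 2))).const_mul (Real.exp M)
    simpa only [mul_zero, add_zero, Function.comp_def] using h3
  have hbd : ∀ᶠ n : ℕ in atTop, ‖∫ p, Real.exp (l * toll s s₀ s₁ ν n p.2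
      - κ * (1 - (∑ i, ((p.2 i + s₁ : ℕ) : ℝ) ^ 2) / n ^ 2)) ∂throwLaw ν (n - s₀ - b * s₁)
      - ∫ v, Real.exp (l * cost ν v - κ * (1 - ∑ i, v i ^ 2)) ∂ν‖ ≤ Real.exp M * (|l| * Real.sqrt
      (∫ p, (toll s s₀ s₁ ν n p.2 - cost ν p.1) ^ 2 ∂throwLaw ν (n - s₀ - b * s₁))
      + κ * 2 * Real.sqrt (b * (K₀ / n))) := by
    filter_upwards [eventually_gt_atTop s] with n hn
    have hn0 : (0 : ℝ) < n := by exact_mod_cast (by omega : 0 < n)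
    set m := n - s₀ - b * s₁ with hm
    have hP := isProbabilityMeasure_throwLaw hν m
    have hcm := measurable_cost (ν := ν)
    have hcb := abs_cost_le hν hV
    have tc : IsTame fun p : (Fin b → ℝ) × (Fin b → ℕ) => cost ν p.1 := isTame_vector hcm hcb
    have tu : IsTame fun p : (Fin b → ℝ) × (Fin b → ℕ) => ∑ i, p.1 i ^ 2 :=
      IsTame.sum fun i => (isTame_coord i).pow 2
    have te : IsTame fun p : (Fin b → ℝ) × (Fin b → ℕ) =>
        Real.exp (l * cost ν p.1 - κ * (1 - ∑ i, p.1 i ^ 2)) :=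
      IsTame.exp ((tc.const_mul l).sub (((isTame_const 1).sub tu).const_mul κ))
    have h1 : ∫ v, Real.exp (l * cost ν v - κ * (1 - ∑ i, v i ^ 2)) ∂ν
        = ∫ p, Real.exp (l * cost ν p.1 - κ * (1 - ∑ i, p.1 i ^ 2)) ∂throwLaw ν m := by
      rw [te.integral_eq hν]
      refine integral_congr_ae ?_
      filter_upwards [hν.mem_simplex] with v hv
      exact (multMean_const hv m _).symm
    have tt : IsTame fun p : (Fin b → ℝ) × (Fin b → ℕ) => toll s s₀ s₁ ν n p.2 - cost ν p.1 :=
      (isTame_throw (toll s s₀ s₁ ν n)).sub tc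
    have tS : IsTame fun p : (Fin b → ℝ) × (Fin b → ℕ) =>
        ∑ i, |((p.2 i + s₁ : ℕ) : ℝ) / n - p.1 i| := IsTame.sum fun i =>
      ((isTame_throw fun k => ((k i + s₁ : ℕ) : ℝ) / n).sub (isTame_coord i)).abs
    have tS2 : IsTame fun p : (Fin b → ℝ) × (Fin b → ℕ) =>
        ∑ i, (((p.2 i + s₁ : ℕ) : ℝ) / n - p.1 i) ^ 2 := IsTame.sum fun i =>
      ((isTame_throw fun k => ((k i + s₁ : ℕ) : ℝ) / n).sub (isTame_coord i)).pow 2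
    have hS : ∫ p, ∑ i, |((p.2 i + s₁ : ℕ) : ℝ) / n - p.1 i| ∂throwLaw ν m
        ≤ Real.sqrt (b * (K₀ / n)) := by
      have h2 := tS.integral_abs_le_sqrt hν m
      have h3 : ∀ p : (Fin b → ℝ) × (Fin b → ℕ), abs (∑ i, |((p.2 i + s₁ : ℕ) : ℝ) / n - p.1 i|)
          = ∑ i, |((p.2 i + s₁ : ℕ) : ℝ) / n - p.1 i| := fun p =>
        abs_of_nonneg (Finset.sum_nonneg fun i _ => abs_nonneg _)
      simp only [h3] at h2
      refine h2.trans (Real.sqrt_le_sqrt ?_)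
      have h4 := integral_child_sub_sq_le hs hν hn
      rw [← hm, ← hK₀] at h4
      refine le_trans ?_ (mul_le_mul_of_nonneg_left h4 (Nat.cast_nonneg b))
      rw [← integral_const_mul]
      refine integral_mono ((tS.pow 2).integrable hν m) ((tS2.const_mul b).integrable hν m) ?_
      intro p
      have := sq_sum_le_card_mul_sum_sq (s := (Finset.univ : Finset (Fin b)))
        (f := fun i => |((p.2 i + s₁ : ℕ) : ℝ) / n - p.1 i|)
      rw [Finset.card_univ, Fintype.card_fin] at this
      simp only [sq_abs] at this
      exact this
    rw [h1, ← integral_sub ((isTame_exp_toll l κ n).integrable hν m) (te.integrable hν m)]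
    refine (norm_integral_le_integral_norm _).trans ?_
    have h5 : ∫ p, ‖Real.exp (l * toll s s₀ s₁ ν n p.2
        - κ * (1 - (∑ i, ((p.2 i + s₁ : ℕ) : ℝ) ^ 2) / n ^ 2))
        - Real.exp (l * cost ν p.1 - κ * (1 - ∑ i, p.1 i ^ 2))‖ ∂throwLaw ν m
        ≤ ∫ p, (Real.exp M * |l| * |toll s s₀ s₁ ν n p.2 - cost ν p.1|
          + Real.exp M * (κ * 2) * ∑ i, |((p.2 i + s₁ : ℕ) : ℝ) / n - p.1 i|) ∂throwLaw ν m := by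
      refine integral_mono_ae ((((isTame_exp_toll l κ n).sub te).abs).integrable hν m)
        (((tt.abs.const_mul _).add (tS.const_mul _)).integrable hν m) ?_
      filter_upwards [ae_throwLaw hν m] with p hp
      have e1 : l * toll s s₀ s₁ ν n p.2 ≤ |l| * c := by
        refine (le_abs_self _).trans ?_
        rw [abs_mul]
        exact mul_le_mul_of_nonneg_left (hc n hn p.2 hp.2) (abs_nonneg _)
      have e2 : l * cost ν p.1 ≤ |l| * (1 + (meanLog ν)⁻¹ * b) := by
        refine (le_abs_self _).trans ?_
        rw [abs_mul]
        exact mul_le_mul_of_nonneg_left (hcb p.1 hp.1) (abs_nonneg _)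
      have e3 : (∑ i, ((p.2 i + s₁ : ℕ) : ℝ) ^ 2) / (n : ℝ) ^ 2 ≤ 1 := by
        rw [div_le_one (by positivity)]
        exact child_sum_sq_le hs hn hp.2
      have e4 := sum_sq_le_one hp.1
      have e5 : 0 ≤ |l| * c := by positivity
      have e6 : 0 ≤ |l| * (1 + (meanLog ν)⁻¹ * b) := by positivity
      refine (abs_exp_sub_exp_le (M := M) ?_ ?_).trans ?_
      · have := mul_nonneg hκ (sub_nonneg.2 e3)
        rw [hM]; linarith
      · have := mul_nonneg hκ (sub_nonneg.2 e4)
        rw [hM]; linarith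
      · rw [mul_assoc, mul_assoc (Real.exp M), ← mul_add]
        refine mul_le_mul_of_nonneg_left ?_ (Real.exp_pos _).le
        have e7 : l * toll s s₀ s₁ ν n p.2 - κ * (1 - (∑ i, ((p.2 i + s₁ : ℕ) : ℝ) ^ 2) / n ^ 2)
            - (l * cost ν p.1 - κ * (1 - ∑ i, p.1 i ^ 2))
            = l * (toll s s₀ s₁ ν n p.2 - cost ν p.1)
              + κ * ((∑ i, ((p.2 i + s₁ : ℕ) : ℝ) ^ 2) / n ^ 2 - ∑ i, p.1 i ^ 2) := by ring
        rw [e7]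
        refine (abs_add_le _ _).trans (add_le_add (le_of_eq (abs_mul _ _)) ?_)
        rw [abs_mul, abs_of_nonneg hκ, mul_assoc]
        refine mul_le_mul_of_nonneg_left ?_ hκ
        rw [Finset.sum_div, ← Finset.sum_sub_distrib, Finset.mul_sum]
        refine (Finset.abs_sum_le_sum_abs _ _).trans (Finset.sum_le_sum fun i _ => ?_)
        have e8 : ((p.2 i + s₁ : ℕ) : ℝ) ^ 2 / (n : ℝ) ^ 2 - p.1 i ^ 2
            = (((p.2 i + s₁ : ℕ) : ℝ) / n + p.1 i) * (((p.2 i + s₁ : ℕ) : ℝ) / n - p.1 i) := by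
          rw [← div_pow]; ring
        rw [e8, abs_mul]
        refine mul_le_mul_of_nonneg_right ?_ (abs_nonneg _)
        have e9 : ((p.2 i + s₁ : ℕ) : ℝ) / n ≤ 1 := by
          rw [div_le_one hn0]
          exact_mod_cast child_le hs hn hp.2 i
        have e10 := hp.1.1 i
        have e11 := coord_le_one hp.1 i
        have e12 : 0 ≤ ((p.2 i + s₁ : ℕ) : ℝ) / n := by positivity
        rw [abs_of_nonneg (by linarith)]
        linarith
    refine h5.trans ?_
    rw [(tt.abs.const_mul _).integral_add hν (tS.const_mul _), integral_const_mul,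
      integral_const_mul]
    have h6 := tt.integral_abs_le_sqrt hν m
    have h7 := mul_le_mul_of_nonneg_left h6 (by positivity : 0 ≤ Real.exp M * |l|)
    have h8 := mul_le_mul_of_nonneg_left hS (by positivity : 0 ≤ Real.exp M * (κ * 2))
    linarith
  exact tendsto_iff_norm_sub_tendsto_zero.2
    (squeeze_zero' (Eventually.of_forall fun _ => norm_nonneg _) hbd hlim)

lemma exp_neg_le {a U : ℝ} (ha : 0 ≤ a) (hU0 : 0 ≤ U) (hU1 : U ≤ 1) :
    Real.exp (-(a * U)) ≤ 1 - min a 1 / 2 * U := by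
  set y := min a 1 * U with hy
  have hm0 : 0 ≤ min a 1 := le_min ha zero_le_one
  have hy0 : 0 ≤ y := mul_nonneg hm0 hU0
  have hy1 : y ≤ 1 := mul_le_one₀ (min_le_right _ _) hU0 hU1
  have h1 : Real.exp (-(a * U)) ≤ Real.exp (-y) :=
    Real.exp_le_exp.2 (neg_le_neg (mul_le_mul_of_nonneg_right (min_le_left _ _) hU0))
  refine h1.trans ?_
  have h2 : 1 + y ≤ Real.exp y := by linarith [Real.add_one_le_exp y]
  have h3 : Real.exp (-y) ≤ (1 + y)⁻¹ := by
    rw [Real.exp_neg]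
    exact inv_anti₀ (by linarith) h2
  have h4 : (1 + y)⁻¹ ≤ 1 - y / 2 := by
    rw [inv_le_iff_one_le_mul₀ (by linarith)]
    nlinarith
  have h5 : 1 - y / 2 = 1 - min a 1 / 2 * U := by rw [hy]; ring
  linarith

/-- For small parameters, the centred toll is compensated by the loss of squared size. -/
lemma exists_exp_toll_le_one_of_small (hs : IsAdmissible b s s₀ s₁) (hν : IsSplitLaw ν)
    (hV : ν {v | ∃ i, v i = 1} < 1) : ∃ l₀ > 0, ∃ K₁, 0 < K₁ ∧ ∀ K ≥ K₁, ∀ n, s < n → ∀ l, |l| ≤ l₀ →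
      ∫ p, Real.exp (l * toll s s₀ s₁ ν n p.2
        - K * l ^ 2 * (1 - (∑ i, ((p.2 i + s₁ : ℕ) : ℝ) ^ 2) / n ^ 2))
        ∂throwLaw ν (n - s₀ - b * s₁) ≤ 1 := by
  obtain ⟨c, hc0, hc⟩ := abs_toll_le hs hν hV
  have hρ := integral_sum_sq_lt_one hν hV
  have hρ0 := integral_sum_sq_nonneg (ν := ν)
  set c₀ := (1 - ∫ v, ∑ i, v i ^ 2 ∂ν) / 4 with hc₀
  have hc₀0 : 0 < c₀ := by rw [hc₀]; linarith
  have hc₀1 : c₀ ≤ 1 := by rw [hc₀]; linarith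
  -- `A` is half the mean loss, with the factor `1/e` that bounds `exp (l * toll)` from below
  set A := c₀ * Real.exp (-1) / 2 with hA
  have hA0 : 0 < A := by positivity
  have hA1 : A ≤ 1 := by
    have : Real.exp (-1) ≤ 1 := Real.exp_le_one_iff.2 (by norm_num)
    rw [hA]; nlinarith [Real.exp_pos (-1)]
  refine ⟨Real.sqrt A / c, by positivity, c ^ 2 / A, by positivity, fun K hK n hn l hl => ?_⟩
  have hn0 : (0 : ℝ) < n := by exact_mod_cast (by omega : 0 < n)
  set m := n - s₀ - b * s₁ with hm
  have hP := isProbabilityMeasure_throwLaw hν m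
  rw [le_div_iff₀ hc0] at hl
  have hlc : |l| * c ≤ 1 := hl.trans (Real.sqrt_le_one.2 hA1)
  have hlA : l ^ 2 * c ^ 2 ≤ A := by
    have h := pow_le_pow_left₀ (by positivity) hl 2
    rwa [mul_pow, sq_abs, Real.sq_sqrt hA0.le] at h
  have hK0 : 0 ≤ K := le_trans (by positivity) hK
  have ha : 0 ≤ K * l ^ 2 := by positivity
  set κ := min (K * l ^ 2) 1 / 2 with hκ
  have hκ0 : 0 ≤ κ := div_nonneg (le_min ha zero_le_one) (by norm_num)
  have tU : IsTame fun p : (Fin b → ℝ) × (Fin b → ℕ) => ∑ i, ((p.2 i + s₁ : ℕ) : ℝ) ^ 2 :=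
    isTame_throw fun k => ∑ i, ((k i + s₁ : ℕ) : ℝ) ^ 2
  have tT := isTame_throw (b := b) (toll s s₀ s₁ ν n)
  have tR : IsTame fun p : (Fin b → ℝ) × (Fin b → ℕ) => (1 + l ^ 2 * c ^ 2 - κ * Real.exp (-1))
      + l * toll s s₀ s₁ ν n p.2
      + κ * Real.exp (-1) / n ^ 2 * ∑ i, ((p.2 i + s₁ : ℕ) : ℝ) ^ 2 :=
    ((isTame_const _).add (tT.const_mul _)).add (tU.const_mul _)
  have h1 : ∫ p, Real.exp (l * toll s s₀ s₁ ν n p.2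
        - K * l ^ 2 * (1 - (∑ i, ((p.2 i + s₁ : ℕ) : ℝ) ^ 2) / n ^ 2)) ∂throwLaw ν m
      ≤ ∫ p, ((1 + l ^ 2 * c ^ 2 - κ * Real.exp (-1)) + l * toll s s₀ s₁ ν n p.2
      + κ * Real.exp (-1) / n ^ 2 * ∑ i, ((p.2 i + s₁ : ℕ) : ℝ) ^ 2) ∂throwLaw ν m := by
    refine integral_mono_ae ((isTame_exp_toll l _ n).integrable hν m) (tR.integrable hν m) ?_
    filter_upwards [ae_throwLaw hν m] with p hp
    set T := toll s s₀ s₁ ν n p.2 with hT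
    set U := 1 - (∑ i, ((p.2 i + s₁ : ℕ) : ℝ) ^ 2) / (n : ℝ) ^ 2 with hU
    have hTc : |T| ≤ c := hc n hn p.2 hp.2
    have hU0 : 0 ≤ U := by
      rw [hU, sub_nonneg, div_le_one (by positivity)]
      exact child_sum_sq_le hs hn hp.2
    have hU1 : U ≤ 1 := by
      have : 0 ≤ (∑ i, ((p.2 i + s₁ : ℕ) : ℝ) ^ 2) / (n : ℝ) ^ 2 := by positivity
      rw [hU]; linarith
    have hlT : |l * T| ≤ 1 := by
      rw [abs_mul]
      exact (mul_le_mul_of_nonneg_left hTc (abs_nonneg _)).trans hlc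
    have e1 : Real.exp (l * T) ≤ 1 + l * T + l ^ 2 * c ^ 2 := by
      have h2 := (abs_le.1 (Real.abs_exp_sub_one_sub_id_le hlT)).2
      have h3 : (l * T) ^ 2 ≤ l ^ 2 * c ^ 2 := by
        rw [mul_pow]
        refine mul_le_mul_of_nonneg_left ?_ (sq_nonneg _)
        rw [← sq_abs T]
        exact pow_le_pow_left₀ (abs_nonneg _) hTc 2
      linarith
    have e2 : Real.exp (-1) ≤ Real.exp (l * T) := Real.exp_le_exp.2 (abs_le.1 hlT).1
    have e3 := exp_neg_le ha hU0 hU1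
    rw [← hκ] at e3
    have e4 : Real.exp (l * T - K * l ^ 2 * U) = Real.exp (l * T) * Real.exp (-(K * l ^ 2 * U)) := by
      rw [← Real.exp_add]; ring_nf
    have e5 : Real.exp (l * T) * Real.exp (-(K * l ^ 2 * U)) ≤ Real.exp (l * T) * (1 - κ * U) :=
      mul_le_mul_of_nonneg_left e3 (Real.exp_pos _).le
    have e6 : Real.exp (-1) * (κ * U) ≤ Real.exp (l * T) * (κ * U) :=
      mul_le_mul_of_nonneg_right e2 (by positivity)
    have e7 : κ * Real.exp (-1) / n ^ 2 * ∑ i, ((p.2 i + s₁ : ℕ) : ℝ) ^ 2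
        = κ * Real.exp (-1) * (1 - U) := by rw [hU]; ring
    rw [e4, e7]
    linarith
  refine h1.trans ?_
  rw [((isTame_const _).add (tT.const_mul _)).integral_add hν (tU.const_mul _),
    (isTame_const _).integral_add hν (tT.const_mul _), integral_const_mul, integral_const_mul,
    integral_toll hs hν hV hn]
  simp only [integral_const, probReal_univ, one_smul, mul_zero, add_zero]
  have h2 := integral_child_sq_le hs hν hV hn
  rw [← hc₀, ← hm] at h2
  have h3 : κ * Real.exp (-1) / (n : ℝ) ^ 2 * ∫ p, ∑ i, ((p.2 i + s₁ : ℕ) : ℝ) ^ 2 ∂throwLaw ν m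
      ≤ κ * Real.exp (-1) / (n : ℝ) ^ 2 * ((1 - c₀) * (n : ℝ) ^ 2) :=
    mul_le_mul_of_nonneg_left h2 (by positivity)
  have h4 : κ * Real.exp (-1) / (n : ℝ) ^ 2 * ((1 - c₀) * (n : ℝ) ^ 2)
      = κ * Real.exp (-1) - min (K * l ^ 2) 1 * A := by
    rw [hA, hκ]; field_simp
  have h5 : l ^ 2 * c ^ 2 ≤ min (K * l ^ 2) 1 * A := by
    rcases le_total (K * l ^ 2) 1 with h | h
    · rw [min_eq_left h]
      have := (div_le_iff₀ hA0).1 hK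
      nlinarith [sq_nonneg l]
    · rw [min_eq_right h, one_mul]; exact hlA
  linarith

/-- The inductive inequality for Gaussian bounds of exponential moments. In the range
`θ max(n, n₀) ∈ [lo, hi]`, which is preserved by passing to a child, a bound `exp (K θ² n_i²)` for the
children implies the same bound for the parent. -/
theorem exists_integral_exp_toll_le (hs : IsAdmissible b s s₀ s₁) (hν : IsSplitLaw ν)
    (hV : ν {v | ∃ i, v i = 1} < 1) {lo hi : ℝ} (hlo : lo ≤ 0) (hhi : 0 ≤ hi)
    (hlt : Real.exp hi * (ν {v | ∃ i, v i = 1}).toReal < 1) :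
    ∃ K : ℝ, 0 ≤ K ∧ ∃ n₀ : ℕ, ∀ n, s < n → ∀ θ : ℝ, lo ≤ θ * (max n n₀ : ℕ) → θ * (max n n₀ : ℕ) ≤ hi →
      ∫ p, Real.exp (θ * n * toll s s₀ s₁ ν n p.2 + K * θ ^ 2 * ∑ i, ((p.2 i + s₁ : ℕ) : ℝ) ^ 2)
        ∂throwLaw ν (n - s₀ - b * s₁) ≤ Real.exp (K * θ ^ 2 * n ^ 2) := by
  obtain ⟨l₀, hl₀, K₁, hK₁, hsmall⟩ := exists_exp_toll_le_one_of_small hs hν hV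
  have hlt' : Real.exp lo * (ν {v | ∃ i, v i = 1}).toReal < 1 :=
    (mul_le_mul_of_nonneg_right (Real.exp_le_exp.2 (hlo.trans hhi)) ENNReal.toReal_nonneg).trans_lt
      hlt
  -- a penalty `j` that makes the limiting exponential moments at both end points less than one
  obtain ⟨j, hj1, hj2⟩ := (((tendsto_integral_exp_cost_penalty hν hV hi).eventually_lt_const
    hlt).and ((tendsto_integral_exp_cost_penalty hν hV lo).eventually_lt_const hlt')).exists
  have hj0 : (0 : ℝ) ≤ j := Nat.cast_nonneg j
  obtain ⟨n₁, hn₁⟩ := eventually_atTop.1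
    (((tendsto_integral_exp_toll hs hν hV hi hj0).eventually_lt_const hj1).and
      ((tendsto_integral_exp_toll hs hν hV lo hj0).eventually_lt_const hj2))
  -- with this `n₀`, the constraint on `θ max(n, n₀)` makes `θ n` small for all `n < n₁`
  obtain ⟨n₀, hn₀⟩ := exists_nat_gt (n₁ * (hi - lo) / l₀)
  rw [div_lt_iff₀ hl₀] at hn₀
  refine ⟨max K₁ (j / l₀ ^ 2), le_trans hK₁.le (le_max_left _ _), n₀, fun n hn θ h1 h2 => ?_⟩
  set K := max K₁ (j / l₀ ^ 2) with hK
  have hn0 : (0 : ℝ) < n := by exact_mod_cast (by omega : 0 < n)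
  set m := n - s₀ - b * s₁ with hm
  set l := θ * n with hl
  have hkey : ∫ p, Real.exp (l * toll s s₀ s₁ ν n p.2
        - K * l ^ 2 * (1 - (∑ i, ((p.2 i + s₁ : ℕ) : ℝ) ^ 2) / n ^ 2)) ∂throwLaw ν m ≤ 1 := by
    rcases le_or_gt |l| l₀ with h | h
    · exact hsmall K (le_max_left _ _) n hn l h
    have hN0 : (0 : ℝ) < (max n n₀ : ℕ) := by exact_mod_cast lt_max_of_lt_left (by omega)
    have hnN : (n : ℝ) ≤ (max n n₀ : ℕ) := by exact_mod_cast le_max_left _ _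
    have hn0N : (n₀ : ℝ) ≤ (max n n₀ : ℕ) := by exact_mod_cast le_max_right _ _
    have hrange : lo ≤ l ∧ l ≤ hi := by
      rcases le_total 0 θ with hθ | hθ
      · exact ⟨hlo.trans (by positivity), (mul_le_mul_of_nonneg_left hnN hθ).trans h2⟩
      · refine ⟨h1.trans (mul_le_mul_of_nonpos_left hnN hθ), ?_⟩
        exact (mul_nonpos_of_nonpos_of_nonneg hθ hn0.le).trans hhi
    have hnn₁ : n₁ ≤ n := by
      have h3 : |θ| * n₀ ≤ hi - lo := by
        refine (mul_le_mul_of_nonneg_left hn0N (abs_nonneg _)).trans ?_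
        rw [← abs_of_pos hN0, ← abs_mul, abs_le]
        constructor <;> linarith
      have h4 : |l| = |θ| * n := by rw [hl, abs_mul, abs_of_pos hn0]
      have hθ0 : 0 < |θ| := by
        by_contra hθ
        have : |θ| = 0 := le_antisymm (not_lt.1 hθ) (abs_nonneg _)
        rw [h4, this, zero_mul] at h
        linarith
      by_contra hlt
      have hn1r : (n : ℝ) ≤ n₁ := by exact_mod_cast (not_le.1 hlt).le
      have h5 : |θ| * (n₁ * (hi - lo)) < |θ| * (n₀ * l₀) := mul_lt_mul_of_pos_left hn₀ hθ0
      have h6 : |θ| * n₀ * l₀ ≤ (hi - lo) * l₀ := mul_le_mul_of_nonneg_right h3 hl₀.le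
      have h7 : (hi - lo) * l₀ ≤ (hi - lo) * (|θ| * n) :=
        mul_le_mul_of_nonneg_left (by rw [← h4]; exact h.le) (by linarith)
      have h8 : (hi - lo) * (|θ| * n) ≤ (hi - lo) * (|θ| * n₁) :=
        mul_le_mul_of_nonneg_left (mul_le_mul_of_nonneg_left hn1r hθ0.le) (by linarith)
      nlinarith
    obtain ⟨hn2, hn3⟩ := hn₁ n hnn₁
    rw [← hm] at hn2 hn3
    have hjK : (j : ℝ) ≤ K * l ^ 2 := by
      have h9 : (j : ℝ) / l₀ ^ 2 ≤ K := le_max_right _ _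
      rw [div_le_iff₀ (by positivity)] at h9
      have h10 : l₀ ^ 2 ≤ l ^ 2 := by
        rw [← sq_abs l]
        exact pow_le_pow_left₀ hl₀.le h.le 2
      exact h9.trans (mul_le_mul_of_nonneg_left h10 (hK₁.le.trans (le_max_left _ _)))
    -- for the remaining `l`, convexity in `l` reduces to the end points `lo` and `hi`
    have hconv : ∃ a : ℝ, 0 ≤ a ∧ a ≤ 1 ∧ l = (1 - a) * lo + a * hi := by
      have hne : 0 < hi - lo := by
        rcases (sub_nonneg.2 (hlo.trans hhi)).eq_or_lt with h' | h'
        · have : l = 0 := by linarith [hrange.1, hrange.2]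
          rw [this, abs_zero] at h; linarith
        · exact h'
      refine ⟨(l - lo) / (hi - lo), div_nonneg (by linarith [hrange.1]) hne.le, ?_, ?_⟩
      · rw [div_le_one hne]; linarith [hrange.2]
      · field_simp; ring
    obtain ⟨a, ha0, ha1, hla⟩ := hconv
    have hP := isProbabilityMeasure_throwLaw hν m
    have t1 := isTame_exp_toll (s := s) (s₀ := s₀) (s₁ := s₁) (ν := ν) hi j n
    have t2 := isTame_exp_toll (s := s) (s₀ := s₀) (s₁ := s₁) (ν := ν) lo j n
    have hle : ∫ p, Real.exp (l * toll s s₀ s₁ ν n p.2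
        - K * l ^ 2 * (1 - (∑ i, ((p.2 i + s₁ : ℕ) : ℝ) ^ 2) / n ^ 2)) ∂throwLaw ν m
        ≤ ∫ p, ((1 - a) * Real.exp (lo * toll s s₀ s₁ ν n p.2
          - j * (1 - (∑ i, ((p.2 i + s₁ : ℕ) : ℝ) ^ 2) / n ^ 2))
          + a * Real.exp (hi * toll s s₀ s₁ ν n p.2
          - j * (1 - (∑ i, ((p.2 i + s₁ : ℕ) : ℝ) ^ 2) / n ^ 2))) ∂throwLaw ν m := by
      refine integral_mono_ae ((isTame_exp_toll l _ n).integrable hν m)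
        (((t2.const_mul _).add (t1.const_mul _)).integrable hν m) ?_
      filter_upwards [ae_throwLaw hν m] with p hp
      set T := toll s s₀ s₁ ν n p.2 with hT
      set U := 1 - (∑ i, ((p.2 i + s₁ : ℕ) : ℝ) ^ 2) / (n : ℝ) ^ 2 with hU
      have hU0 : 0 ≤ U := by
        rw [hU, sub_nonneg, div_le_one (by positivity)]
        exact child_sum_sq_le hs hn hp.2
      have e1 : Real.exp (l * T - K * l ^ 2 * U)
          ≤ Real.exp ((1 - a) * (lo * T - j * U) + a * (hi * T - j * U)) := by
        refine Real.exp_le_exp.2 ?_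
        have := mul_le_mul_of_nonneg_right hjK hU0
        have e2 : l * T = (1 - a) * (lo * T) + a * (hi * T) := by rw [hla]; ring
        linarith
      refine e1.trans ?_
      have := convexOn_exp.2 (Set.mem_univ (lo * T - j * U)) (Set.mem_univ (hi * T - j * U))
        (sub_nonneg.2 ha1) ha0 (by ring)
      simpa only [smul_eq_mul] using this
    refine hle.trans ?_
    rw [(t2.const_mul _).integral_add hν (t1.const_mul _), integral_const_mul, integral_const_mul]
    have := mul_le_mul_of_nonneg_left hn2.le ha0
    have := mul_le_mul_of_nonneg_left hn3.le (sub_nonneg.2 ha1)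
    linarith
  have heq : ∀ p : (Fin b → ℝ) × (Fin b → ℕ),
      Real.exp (l * toll s s₀ s₁ ν n p.2 + K * θ ^ 2 * ∑ i, ((p.2 i + s₁ : ℕ) : ℝ) ^ 2)
      = Real.exp (K * θ ^ 2 * n ^ 2) * Real.exp (l * toll s s₀ s₁ ν n p.2
        - K * l ^ 2 * (1 - (∑ i, ((p.2 i + s₁ : ℕ) : ℝ) ^ 2) / n ^ 2)) := by
    intro p
    rw [← Real.exp_add]
    congr 1
    rw [hl]
    field_simp
    ring
  simp only [heq, integral_const_mul]
  exact mul_le_of_le_one_right (Real.exp_pos _).le hkey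

end

/-! ### The environment of a split tree and its decomposition at the root -/

section

variable {b s s₀ s₁ : ℕ} {ν : Measure (Fin b → ℝ)}

/-- The environment of a split tree: a split vector and a way to throw items at each node. -/
abbrev Env (b : ℕ) : Type := Node b → (Fin b → ℝ) × (ℕ → Fin b → ℕ)

/-- The part of a family indexed by the nodes that lies above the `i`-th child of the root, indexed
by the nodes of the tree rooted at that child. The letter of the root is the last one of a word. -/
def subtree {E : Type*} (i : Fin b) (W : Node b → E) : Node b → E := fun u => W (u ++ [i])

/-- The throws of an environment. -/
def throws (W : Env b) : Node b → ℕ → Fin b → ℕ := fun u m => (W u).2 m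

/-- `Q` is the law of an environment of split trees. -/
def IsEnvLaw (ν : Measure (Fin b → ℝ)) (Q : Measure (Env b)) : Prop :=
  IsSplitRandomness Q ν (fun u W => (W u).1) (fun u m W => (W u).2 m)

lemma measurable_subtree {E : Type*} [MeasurableSpace E] (i : Fin b) :
    Measurable (subtree (E := E) i) :=
  measurable_pi_iff.2 fun _ => measurable_pi_apply _

lemma measure_ext_of_prod_singleton {A K : Type*} [MeasurableSpace A] [MeasurableSpace K]
    [Countable K] [MeasurableSingletonClass K] {μ μ' : Measure (A × K)}
    (h : ∀ (k : K) (S : Set A), MeasurableSet S → μ (S ×ˢ {k}) = μ' (S ×ˢ {k})) : μ = μ' := by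
  ext S hS
  have hU : S = ⋃ k : K, ((fun a => (a, k)) ⁻¹' S) ×ˢ {k} := by
    ext ⟨a, k⟩; simp
  have hm : ∀ k : K, MeasurableSet ((fun a : A => (a, k)) ⁻¹' S) := fun k =>
    measurable_prodMk_right hS
  have hd : Pairwise (Function.onFun Disjoint fun k : K => ((fun a : A => (a, k)) ⁻¹' S) ×ˢ {k}) := by
    intro k k' hk
    refine Set.disjoint_left.2 ?_
    rintro ⟨a, l⟩ h1 h2
    exact hk (h1.2.symm.trans h2.2)
  rw [hU, measure_iUnion hd fun k => (hm k).prod (measurableSet_singleton k),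
    measure_iUnion hd fun k => (hm k).prod (measurableSet_singleton k)]
  exact tsum_congr fun k => h k _ (hm k)

lemma throwLaw_prod_singleton (ν : Measure (Fin b → ℝ)) (m : ℕ) (k : Fin b → ℕ)
    {A : Set (Fin b → ℝ)} (hA : MeasurableSet A) :
    throwLaw ν m (A ×ˢ {k}) = ∫⁻ v in A, ENNReal.ofReal (multinomialProb m v k) ∂ν := by
  have hS : MeasurableSet (A ×ˢ {k} : Set ((Fin b → ℝ) × (Fin b → ℕ))) :=
    hA.prod (measurableSet_singleton k)
  rw [← lintegral_indicator_one hS, lintegral_throwLaw ν m (measurable_one.indicator hS),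
    ← lintegral_indicator hA]
  refine lintegral_congr fun v => ?_
  by_cases hk : ∑ i, k i = m
  · rw [Finset.sum_eq_single_of_mem k (mem_piAntidiag_univ.2 hk)]
    · by_cases hv : v ∈ A
      · rw [Set.indicator_of_mem (by exact ⟨hv, rfl⟩), Set.indicator_of_mem hv]; simp
      · rw [Set.indicator_of_notMem (fun h => hv h.1), Set.indicator_of_notMem hv]; simp
    · intro k' _ hne
      rw [Set.indicator_of_notMem (fun h => hne h.2)]; simp
  · have h0 : multinomialProb m v k = 0 := by rw [multinomialProb, if_neg hk]
    have h1 : A.indicator (fun v => ENNReal.ofReal (multinomialProb m v k)) v = 0 := by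
      by_cases hv : v ∈ A
      · rw [Set.indicator_of_mem hv, h0, ENNReal.ofReal_zero]
      · exact Set.indicator_of_notMem hv _
    rw [h1]
    refine Finset.sum_eq_zero fun k' hk' => ?_
    rw [Set.indicator_of_notMem, mul_zero]
    rintro ⟨_, h⟩
    rw [Set.mem_singleton_iff] at h
    exact hk (h ▸ mem_piAntidiag_univ.1 hk')

section

variable {Ω : Type*} [MeasurableSpace Ω] {P : Measure Ω}
  {𝒱 : Node b → Ω → (Fin b → ℝ)} {M : Node b → ℕ → Ω → (Fin b → ℕ)}

lemma IsSplitRandomness.isProbabilityMeasure (hν : IsSplitLaw ν)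
    (hM : IsSplitRandomness P ν 𝒱 M) : IsProbabilityMeasure P := by
  constructor
  have h := hν.isProbabilityMeasure.measure_univ
  rwa [← hM.law_vector [], Measure.map_apply (hM.measurable_vector []) MeasurableSet.univ,
    Set.preimage_univ] at h

lemma IsSplitRandomness.map_throw (hM : IsSplitRandomness P ν 𝒱 M) (u : Node b) (m : ℕ) :
    P.map (fun ω => (𝒱 u ω, M u m ω)) = throwLaw ν m := by
  refine measure_ext_of_prod_singleton fun k A hA => ?_
  rw [throwLaw_prod_singleton ν m k hA, ← hM.law_throw u m k A hA,
    Measure.map_apply ((hM.measurable_vector u).prodMk (hM.measurable_throw u m))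
      (hA.prod (measurableSet_singleton k))]
  rfl

lemma IsSplitRandomness.measurable_env (hM : IsSplitRandomness P ν 𝒱 M) (f : Node b → Node b) :
    Measurable fun ω => ((fun u => (𝒱 (f u) ω, fun m => M (f u) m ω)) : Env b) :=
  measurable_pi_iff.2 fun _ => (hM.measurable_vector _).prodMk
    (measurable_pi_iff.2 fun m => hM.measurable_throw _ m)

/-- Relabelling the nodes by an injective map does not change the assumptions on the law. -/
lemma IsSplitRandomness.isEnvLaw_map (hν : IsSplitLaw ν) (hM : IsSplitRandomness P ν 𝒱 M)
    {f : Node b → Node b} (hf : f.Injective) :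
    IsEnvLaw ν (P.map fun ω => ((fun u => (𝒱 (f u) ω, fun m => M (f u) m ω)) : Env b)) := by
  have hP := hM.isProbabilityMeasure hν
  have hm := hM.measurable_env f
  have hPm := Measure.isProbabilityMeasure_map (μ := P) hm.aemeasurable
  refine ⟨fun u => by fun_prop, fun _ _ => by fun_prop, fun u => ?_, fun u m k A hA => ?_, ?_⟩
  · rw [Measure.map_map (by fun_prop) hm]
    exact hM.law_vector (f u)
  · rw [Measure.map_apply hm, ← hM.law_throw (f u) m k A hA]
    · rfl
    · have h1 : Measurable fun W : Env b => (W u).1 := by fun_prop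
      have h2 : Measurable fun W : Env b => (W u).2 m := by fun_prop
      exact (h1 hA).inter (h2 (measurableSet_singleton k))
  · have h1 := (hM.indep.precomp hf).map_fun_eq_infinitePi_map fun u =>
      (hM.measurable_vector (f u)).prodMk
        (measurable_pi_iff.2 fun m => hM.measurable_throw (f u) m)
    rw [iIndepFun_iff_map_fun_eq_infinitePi_map fun u => by fun_prop]
    change Measure.map (fun W : Env b => W) _ = Measure.infinitePi fun u => Measure.map
      (fun W : Env b => W u) _
    rw [Measure.map_id', h1]
    congr 1
    funext u
    have := fun u => Measure.isProbabilityMeasure_map (μ := P)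
      ((hM.measurable_vector (f u)).prodMk
        (measurable_pi_iff.2 fun m => hM.measurable_throw (f u) m)).aemeasurable
    exact (Measure.infinitePi_map_eval (fun u => P.map fun ω => (𝒱 (f u) ω, fun m => M (f u) m ω))
      u).symm

end

lemma IsEnvLaw.subtree (hν : IsSplitLaw ν) {Q : Measure (Env b)} (hQ : IsEnvLaw ν Q) (i : Fin b) :
    IsEnvLaw ν (Q.map (subtree i)) :=
  IsSplitRandomness.isEnvLaw_map hν hQ (f := fun u => u ++ [i]) fun _ _ h => List.append_cancel_right h

lemma IsEnvLaw.isProbabilityMeasure (hν : IsSplitLaw ν) {Q : Measure (Env b)}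
    (hQ : IsEnvLaw ν Q) : IsProbabilityMeasure Q := IsSplitRandomness.isProbabilityMeasure hν hQ

/-- Disjoint blocks of an independent family are independent. -/
lemma iIndepFun_blocks {Ω ι κ E : Type*} [MeasurableSpace Ω] [MeasurableSpace E] {P : Measure Ω}
    [IsProbabilityMeasure P] {X : κ → Ω → E} (hX : iIndepFun X P) (hXm : ∀ k, Measurable (X k))
    {S : ι → Set κ} (hS : Pairwise (Function.onFun Disjoint S)) :
    iIndepFun (fun i ω (u : S i) => X u ω) P := by
  have hinj : Function.Injective fun p : (Σ i, S i) => (p.2 : κ) := by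
    rintro ⟨i, u, hu⟩ ⟨j, v, hv⟩ h
    simp only at h
    subst h
    by_cases hij : i = j
    · subst hij; rfl
    · exact absurd hv (Set.disjoint_left.1 (hS hij) hu)
  have hpr : ∀ k, IsProbabilityMeasure (P.map (X k)) := fun k =>
    Measure.isProbabilityMeasure_map (hXm k).aemeasurable
  have h1 := (hX.precomp hinj).map_fun_eq_infinitePi_map fun p : (Σ i, S i) => hXm p.2
  have h2 := Measure.infinitePi_map_piCurry (κ := fun i => S i) (X := fun _ _ => E)
    (μ := fun i u => P.map (X u))
  rw [iIndepFun_iff_map_fun_eq_infinitePi_map fun i => measurable_pi_iff.2 fun u : S i => hXm u]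
  have h3 : ∀ i, P.map (fun ω (u : S i) => X u ω) = Measure.infinitePi fun u : S i => P.map (X u) :=
    fun i => (hX.precomp (g := fun u : S i => (u : κ))
      Subtype.val_injective).map_fun_eq_infinitePi_map fun u => hXm u
  simp only [h3]
  rw [← h2, ← h1, Measure.map_map (by fun_prop) (measurable_pi_iff.2 fun p : (Σ i, S i) => hXm p.2)]
  rfl

/-- The block of the root, and the blocks of the subtrees of its children. -/
def block : Option (Fin b) → Set (Node b)
  | none => {[]}
  | some i => {u | ∃ v, u = v ++ [i]}

lemma pairwise_disjoint_block : Pairwise (Function.onFun Disjoint (block (b := b))) := by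
  intro i j hij
  refine Set.disjoint_left.2 fun u hi hj => ?_
  rcases i with _ | i <;> rcases j with _ | j
  · exact hij rfl
  · obtain ⟨v, hv⟩ := hj
    rw [show u = [] from hi] at hv
    simp at hv
  · obtain ⟨v, hv⟩ := hi
    rw [show u = [] from hj] at hv
    simp at hv
  · obtain ⟨v, hv⟩ := hi
    obtain ⟨w, hw⟩ := hj
    rw [hv] at hw
    exact hij (by simpa using (List.append_inj' hw rfl).2)

/-- The throw at the root and the environments of the subtrees are independent. -/
lemma IsEnvLaw.map_root_subtree (hν : IsSplitLaw ν) {Q : Measure (Env b)} (hQ : IsEnvLaw ν Q)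
    (m : ℕ) : Q.map (fun W => (((W []).1, (W []).2 m), fun i => SplitTree.subtree i W))
      = (throwLaw ν m).prod (Measure.pi fun i => Q.map (SplitTree.subtree i)) := by
  have hP := hQ.isProbabilityMeasure hν
  have h0 : iIndepFun (fun (u : Node b) (W : Env b) => W u) Q := hQ.indep
  have h1 := iIndepFun_blocks h0 (fun u => measurable_pi_apply u) pairwise_disjoint_block
  have hm : ∀ i : Option (Fin b), Measurable fun (W : Env b) (u : block i) => W u := fun i =>
    measurable_pi_iff.2 fun u => measurable_pi_apply _
  -- the subtrees are independent
  have h2 : iIndepFun (fun (i : Fin b) (W : Env b) => SplitTree.subtree i W) Q :=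
    (h1.precomp (Option.some_injective _)).comp
      (fun i (f : block (some i) → (Fin b → ℝ) × (ℕ → Fin b → ℕ)) (u : Node b) =>
        f ⟨u ++ [i], u, rfl⟩)
      fun i => measurable_pi_iff.2 fun u => measurable_pi_apply _
  have h3 := (iIndepFun_iff_map_fun_eq_pi_map fun i =>
    (measurable_subtree (E := (Fin b → ℝ) × (ℕ → Fin b → ℕ)) i).aemeasurable).1 h2
  -- the root is independent of the family of subtrees
  have h4 := h1.indepFun_finset {none} (Finset.univ.image some) (by simp) hm
  have hφ : Measurable fun f : (i : ({none} : Finset (Option (Fin b)))) →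
      (block (i : Option (Fin b)) → (Fin b → ℝ) × (ℕ → Fin b → ℕ)) =>
      ((f ⟨none, by simp⟩ ⟨[], rfl⟩).1, (f ⟨none, by simp⟩ ⟨[], rfl⟩).2 m) := by
    have h6 := (measurable_pi_apply (⟨[], rfl⟩ : block (b := b) none)).comp (measurable_pi_apply
      (X := fun i : ({none} : Finset (Option (Fin b))) =>
        (block (i : Option (Fin b)) → (Fin b → ℝ) × (ℕ → Fin b → ℕ))) ⟨none, by simp⟩)
    exact h6.fst.prodMk ((measurable_pi_apply m).comp h6.snd)
  have hψ : Measurable fun (f : (i : (Finset.univ.image some : Finset (Option (Fin b)))) →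
      (block (i : Option (Fin b)) → (Fin b → ℝ) × (ℕ → Fin b → ℕ))) (i : Fin b) (u : Node b) =>
      f ⟨some i, by simp⟩ ⟨u ++ [i], u, rfl⟩ :=
    measurable_pi_iff.2 fun i => measurable_pi_iff.2 fun u =>
      (measurable_pi_apply _).comp (measurable_pi_apply _)
  have h5 : IndepFun (fun W : Env b => ((W []).1, (W []).2 m))
      (fun (W : Env b) i => SplitTree.subtree i W) Q :=
    h4.comp hφ hψ
  have hsm : Measurable fun (W : Env b) i => SplitTree.subtree i W :=
    measurable_pi_iff.2 fun i => measurable_subtree i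
  rw [h5.map_prod_eq_prod_map_map (by fun_prop) hsm.aemeasurable, h3]
  congr 1
  exact IsSplitRandomness.map_throw hQ [] m

lemma IsEnvLaw.lintegral_root_subtree (hν : IsSplitLaw ν) {Q : Measure (Env b)}
    (hQ : IsEnvLaw ν Q) (m : ℕ)
    {F : ((Fin b → ℝ) × (Fin b → ℕ)) × (Fin b → Env b) → ENNReal} (hF : Measurable F) :
    ∫⁻ W, F (((W []).1, (W []).2 m), fun i => SplitTree.subtree i W) ∂Q
      = ∫⁻ p, ∫⁻ T, F (p, T) ∂(Measure.pi fun i => Q.map (SplitTree.subtree i)) ∂throwLaw ν m := by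
  have hP := fun i => (hQ.subtree hν i).isProbabilityMeasure hν
  have hsm : Measurable fun (W : Env b) i => SplitTree.subtree i W :=
    measurable_pi_iff.2 fun i => measurable_subtree i
  rw [← lintegral_prod F hF.aemeasurable, ← hQ.map_root_subtree hν m,
    lintegral_map hF (Measurable.prodMk (by fun_prop) hsm)]

end

/-! ### The path length along the subtrees of the root -/

section

variable {b s s₀ s₁ : ℕ} {ν : Measure (Fin b → ℝ)}

/-- The path length of the tree with `n` items, counting only the first `d` generations: an item
at depth `j` contributes `min j d`. -/
def pathTrunc (s s₀ s₁ : ℕ) {b : ℕ} : ℕ → (Node b → ℕ → Fin b → ℕ) → ℕ → ℕ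
  | 0, _, _ => 0
  | d + 1, M, n => if s < n then
      ∑ i, ((M [] (n - s₀ - b * s₁) i + s₁)
        + pathTrunc s s₀ s₁ d (subtree i M) (M [] (n - s₀ - b * s₁) i + s₁))
    else 0

/-- The conditional mean of the path length given the throws at the nodes of depth less than `d`. -/
def predict (s s₀ s₁ : ℕ) {b : ℕ} (ν : Measure (Fin b → ℝ)) :
    ℕ → (Node b → ℕ → Fin b → ℕ) → ℕ → ℝ
  | 0, _, n => meanPath s s₀ s₁ ν n
  | d + 1, M, n => if s < n then
      ∑ i, (((M [] (n - s₀ - b * s₁) i + s₁ : ℕ) : ℝ)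
        + predict s s₀ s₁ ν d (subtree i M) (M [] (n - s₀ - b * s₁) i + s₁))
    else 0

lemma pathTrunc_mono (M : Node b → ℕ → Fin b → ℕ) (n : ℕ) :
    Monotone fun d => pathTrunc s s₀ s₁ d M n := by
  refine monotone_nat_of_le_succ fun d => ?_
  induction d generalizing n M with
  | zero => simp [pathTrunc]
  | succ d ih =>
    rw [pathTrunc, pathTrunc]
    split_ifs
    · exact Finset.sum_le_sum fun i _ => Nat.add_le_add_left (ih _ _) _
    · exact le_rfl

lemma pathTrunc_of_le (d : ℕ) (M : Node b → ℕ → Fin b → ℕ) {n : ℕ} (hn : n ≤ s) :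
    pathTrunc s s₀ s₁ d M n = 0 := by
  cases d with
  | zero => rfl
  | succ d => rw [pathTrunc, if_neg (not_lt.2 hn)]

lemma predict_of_le (d : ℕ) (M : Node b → ℕ → Fin b → ℕ) {n : ℕ} (hn : n ≤ s) :
    predict s s₀ s₁ ν d M n = 0 := by
  cases d with
  | zero => exact meanPath_of_le hn
  | succ d => rw [predict, if_neg (not_lt.2 hn)]

lemma card_append_singleton (M : Node b → ℕ → Fin b → ℕ) (n : ℕ) (i : Fin b) (u : Node b) :
    card s s₀ s₁ M n (u ++ [i]) = card s s₀ s₁ (subtree i M) (card s s₀ s₁ M n [i]) u := by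
  induction u with
  | nil => rfl
  | cons j u ih =>
    rw [List.cons_append, card, card, ih]
    rfl

lemma stored_append_singleton (M : Node b → ℕ → Fin b → ℕ) (n : ℕ) (i : Fin b) (u : Node b) :
    stored s s₀ s₁ M n (u ++ [i]) = stored s s₀ s₁ (subtree i M) (card s s₀ s₁ M n [i]) u := by
  rw [stored, stored, card_append_singleton]

lemma card_singleton (M : Node b → ℕ → Fin b → ℕ) {n : ℕ} (hn : s < n) (i : Fin b) :
    card s s₀ s₁ M n [i] = M [] (n - s₀ - b * s₁) i + s₁ := by
  rw [card, card, if_pos hn]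

lemma card_singleton_of_le (M : Node b → ℕ → Fin b → ℕ) {n : ℕ} (hn : n ≤ s) (i : Fin b) :
    card s s₀ s₁ M n [i] = 0 := by
  rw [card, card, if_neg (not_lt.2 hn)]

/-- A node is the root or lies above exactly one child of the root. -/
lemma tsum_node (f : Node b → ENNReal) : ∑' u, f u = f [] + ∑ i, ∑' u, f (u ++ [i]) := by
  have hbij : Function.Bijective
      (Sum.elim (fun _ => []) fun p => p.2 ++ [p.1] : Unit ⊕ (Fin b × Node b) → Node b) := by
    refine ⟨?_, fun u => ?_⟩
    · rintro (_ | ⟨i, u⟩) (_ | ⟨j, v⟩) h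
      · rfl
      · simp at h
      · simp at h
      · simp only [Sum.elim_inr] at h
        obtain ⟨h1, h2⟩ := List.append_inj' h rfl
        simp only [List.cons.injEq, and_true] at h2
        simp [h1, h2]
    · rcases List.eq_nil_or_concat u with rfl | ⟨v, i, rfl⟩
      · exact ⟨Sum.inl (), rfl⟩
      · exact ⟨Sum.inr (i, v), by simp⟩
  rw [← (Equiv.ofBijective _ hbij).tsum_eq f,
    Summable.tsum_sum ENNReal.summable ENNReal.summable, tsum_fintype, ENNReal.tsum_prod',
    tsum_fintype]
  simp

/-- The number of items stored in the whole tree. -/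
def totalStored (s s₀ s₁ : ℕ) {b : ℕ} (M : Node b → ℕ → Fin b → ℕ) (n : ℕ) : ENNReal :=
  ∑' u : Node b, (stored s s₀ s₁ M n u : ENNReal)

lemma totalStored_eq (M : Node b → ℕ → Fin b → ℕ) (n : ℕ) :
    totalStored s s₀ s₁ M n = (stored s s₀ s₁ M n [] : ENNReal)
      + ∑ i, totalStored s s₀ s₁ (subtree i M) (card s s₀ s₁ M n [i]) := by
  rw [totalStored, tsum_node]
  simp only [stored_append_singleton, totalStored]

lemma pathLength_eq (M : Node b → ℕ → Fin b → ℕ) (n : ℕ) :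
    pathLength s s₀ s₁ M n = ∑ i, (totalStored s s₀ s₁ (subtree i M) (card s s₀ s₁ M n [i])
      + pathLength s s₀ s₁ (subtree i M) (card s s₀ s₁ M n [i])) := by
  rw [pathLength, tsum_node]
  simp only [stored_append_singleton, List.length_nil, Nat.cast_zero, mul_zero, zero_add,
    List.length_append, List.length_cons, Nat.cast_add, Nat.cast_one, mul_add, mul_one]
  refine Finset.sum_congr rfl fun i _ => ?_
  rw [ENNReal.tsum_add, add_comm]
  rfl

lemma card_zero (M : Node b → ℕ → Fin b → ℕ) (u : Node b) : card s s₀ s₁ M 0 u = 0 := by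
  induction u with
  | nil => rfl
  | cons i u ih => rw [card, ih, if_neg (Nat.not_lt_zero s)]

lemma stored_zero (M : Node b → ℕ → Fin b → ℕ) (u : Node b) : stored s s₀ s₁ M 0 u = 0 := by
  rw [stored, card_zero, if_neg (Nat.not_lt_zero s)]

lemma totalStored_zero (M : Node b → ℕ → Fin b → ℕ) : totalStored s s₀ s₁ M 0 = 0 := by
  simp [totalStored, stored_zero]

lemma pathLength_zero (M : Node b → ℕ → Fin b → ℕ) : pathLength s s₀ s₁ M 0 = 0 := by
  simp [pathLength, stored_zero]

/-- Once the truncated path length is stationary, all items have been stored. -/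
lemma of_pathTrunc_succ_eq (hs : IsAdmissible b s s₀ s₁) (d : ℕ) :
    ∀ (M : Node b → ℕ → Fin b → ℕ) (n : ℕ), (∀ u m, ∑ i, M u m i = m) →
      pathTrunc s s₀ s₁ (d + 1) M n = pathTrunc s s₀ s₁ d M n →
      totalStored s s₀ s₁ M n = n ∧ pathLength s s₀ s₁ M n = pathTrunc s s₀ s₁ d M n ∧
      predict s s₀ s₁ ν (d + 1) M n = pathTrunc s s₀ s₁ d M n := by
  have hsmall : ∀ (M : Node b → ℕ → Fin b → ℕ) (n d : ℕ), n ≤ s →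
      totalStored s s₀ s₁ M n = n ∧ pathLength s s₀ s₁ M n = pathTrunc s s₀ s₁ d M n ∧
      predict s s₀ s₁ ν (d + 1) M n = pathTrunc s s₀ s₁ d M n := by
    intro M n d hn
    rw [totalStored_eq, pathLength_eq, pathTrunc_of_le d M hn, predict_of_le (d + 1) M hn]
    simp only [card_singleton_of_le M hn, totalStored_zero, pathLength_zero]
    simp [stored, card, not_lt.2 hn]
  induction d with
  | zero =>
    intro M n hM h
    rcases le_or_gt n s with hn | hn
    · exact hsmall M n 0 hn
    · have hsum := sum_child hs hn (hM [] (n - s₀ - b * s₁))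
      simp only [pathTrunc, if_pos hn] at h
      rw [Finset.sum_eq_zero_iff] at h
      have h0 : ∀ i, M [] (n - s₀ - b * s₁) i + s₁ = 0 := fun i => by
        have := h i (Finset.mem_univ i)
        omega
      simp only [h0, Finset.sum_const_zero, zero_add] at hsum
      rw [totalStored_eq, pathLength_eq]
      simp only [pathTrunc, predict, if_pos hn, card_singleton M hn, h0, totalStored_zero,
        pathLength_zero, meanPath_of_le (Nat.zero_le s)]
      simp [stored, card, hn, hsum]
  | succ d ih =>
    intro M n hM h
    rcases le_or_gt n s with hn | hn
    · exact hsmall M n (d + 1) hn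
    · have hsum := sum_child hs hn (hM [] (n - s₀ - b * s₁))
      set I : Fin b → ℕ := fun i => M [] (n - s₀ - b * s₁) i + s₁ with hI
      rw [pathTrunc, pathTrunc, if_pos hn, if_pos hn, eq_comm, Finset.sum_eq_sum_iff_of_le
        fun i _ => Nat.add_le_add_left (pathTrunc_mono _ _ (Nat.le_succ d)) _] at h
      have h1 : ∀ i, _ := fun i => ih (subtree i M) (I i) (fun u m => hM _ m)
        (Nat.add_left_cancel (h i (Finset.mem_univ i))).symm
      rw [totalStored_eq, pathLength_eq, pathTrunc, predict, if_pos hn, if_pos hn]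
      simp only [card_singleton M hn]
      refine ⟨?_, ?_, ?_⟩
      · rw [Finset.sum_congr rfl fun i _ => (h1 i).1, stored, card, if_pos hn]
        rw [add_comm]
        exact_mod_cast hsum
      · push_cast
        refine Finset.sum_congr rfl fun i _ => ?_
        have := h1 i
        simp only [hI] at this
        rw [this.1, this.2.1]
        push_cast
        rfl
      · push_cast
        refine Finset.sum_congr rfl fun i _ => ?_
        have := h1 i
        simp only [hI] at this
        rw [this.2.2]

lemma measurable_pathTrunc (d : ℕ) :
    Measurable fun q : Env b × ℕ => pathTrunc s s₀ s₁ d (throws q.1) q.2 := by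
  induction d with
  | zero => exact measurable_const
  | succ d ih =>
    refine measurable_from_prod_countable_left fun n => ?_
    simp only [pathTrunc]
    split_ifs
    · refine Finset.measurable_sum _ fun i _ => ?_
      have h1 : Measurable fun W : Env b => (W []).2 (n - s₀ - b * s₁) i + s₁ := by fun_prop
      exact h1.add (ih.comp ((measurable_subtree i).prodMk h1))
    · exact measurable_const

lemma measurable_pathTrunc_cast (d : ℕ) :
    Measurable fun q : Env b × ℕ => (pathTrunc s s₀ s₁ d (throws q.1) q.2 : ENNReal) :=
  measurable_from_top.comp (measurable_pathTrunc d)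

lemma measurable_pathTrunc_apply (d n : ℕ) :
    Measurable fun W : Env b => (pathTrunc s s₀ s₁ d (throws W) n : ENNReal) :=
  (measurable_pathTrunc_cast d).comp (measurable_id.prodMk measurable_const)

lemma measurable_predict (d : ℕ) :
    Measurable fun q : Env b × ℕ => predict s s₀ s₁ ν d (throws q.1) q.2 := by
  induction d with
  | zero => exact (measurable_from_top (f := meanPath s s₀ s₁ ν)).comp measurable_snd
  | succ d ih =>
    refine measurable_from_prod_countable_left fun n => ?_
    simp only [predict]
    split_ifs
    · refine Finset.measurable_sum _ fun i _ => ?_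
      have h1 : Measurable fun W : Env b => (W []).2 (n - s₀ - b * s₁) i + s₁ := by fun_prop
      exact (measurable_from_top.comp h1).add (ih.comp ((measurable_subtree i).prodMk h1))
    · exact measurable_const

lemma IsEnvLaw.lintegral_pathTrunc (hν : IsSplitLaw ν) (d : ℕ) :
    ∀ {Q : Measure (Env b)}, IsEnvLaw ν Q → ∀ n,
      ∫⁻ W, (pathTrunc s s₀ s₁ d (throws W) n : ENNReal) ∂Q = meanTrunc s s₀ s₁ ν d n := by
  induction d with
  | zero => intro Q _ n; simp [pathTrunc, meanTrunc]
  | succ d ih =>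
    intro Q hQ n
    simp only [pathTrunc, meanTrunc]
    split_ifs with hn
    · have hP := fun i => (hQ.subtree hν i).isProbabilityMeasure hν
      have hm : ∀ i, Measurable fun q : ((Fin b → ℝ) × (Fin b → ℕ)) × (Fin b → Env b) =>
          ((pathTrunc s s₀ s₁ d (throws (q.2 i)) (q.1.2 i + s₁) : ℕ) : ENNReal) := fun i =>
        (measurable_pathTrunc_cast d).comp (Measurable.prodMk (by fun_prop) (by fun_prop))
      have h := hQ.lintegral_root_subtree hν (n - s₀ - b * s₁)
        (F := fun q => ∑ i, (((q.1.2 i + s₁ : ℕ) : ENNReal)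
          + (pathTrunc s s₀ s₁ d (throws (q.2 i)) (q.1.2 i + s₁) : ℕ)))
        (Finset.measurable_sum _ fun i _ => Measurable.add
          (measurable_from_top.comp (by fun_prop :
            Measurable fun q : ((Fin b → ℝ) × (Fin b → ℕ)) × (Fin b → Env b) => q.1.2 i + s₁))
          (hm i))
      push_cast at h ⊢
      refine Eq.trans h (lintegral_congr fun p => ?_)
      refine (lintegral_finsetSum (f := fun i (T : Fin b → Env b) => (p.2 i : ENNReal) + s₁
        + (pathTrunc s s₀ s₁ d (throws (T i)) (p.2 i + s₁) : ENNReal)) _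
        fun i _ => Measurable.add measurable_const ((hm i).comp measurable_prodMk_left)).trans ?_
      refine Finset.sum_congr rfl fun i _ => ?_
      rw [lintegral_add_left measurable_const, lintegral_const, measure_univ, mul_one]
      congr 1
      rw [(measurePreserving_eval (fun i => Q.map (SplitTree.subtree i)) i).lintegral_comp
        (f := fun W => (pathTrunc s s₀ s₁ d (throws W) (p.2 i + s₁) : ENNReal))
        (measurable_pathTrunc_apply d _)]
      exact ih (hQ.subtree hν i) _
    · simp

/-- The path length of the tree with `n` items, as a measurable function of the environment. -/
def path (s s₀ s₁ : ℕ) {b : ℕ} (W : Env b) (n : ℕ) : ℝ :=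
  (⨆ d, (pathTrunc s s₀ s₁ d (throws W) n : ENNReal)).toReal

lemma measurable_path : Measurable fun q : Env b × ℕ => path s s₀ s₁ q.1 q.2 :=
  (Measurable.iSup fun d => measurable_pathTrunc_cast d).ennreal_toReal

lemma measurable_path_apply (n : ℕ) : Measurable fun W : Env b => path s s₀ s₁ W n := by
  have h := (measurable_path (b := b) (s := s) (s₀ := s₀) (s₁ := s₁)).comp
    (measurable_prodMk_right (y := n))
  exact h

lemma IsEnvLaw.lintegral_iSup_pathTrunc (hs : IsAdmissible b s s₀ s₁) (hν : IsSplitLaw ν)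
    (hV : ν {v | ∃ i, v i = 1} < 1) {Q : Measure (Env b)} (hQ : IsEnvLaw ν Q) (n : ℕ) :
    ∫⁻ W, (⨆ d, (pathTrunc s s₀ s₁ d (throws W) n : ENNReal)) ∂Q
      = ENNReal.ofReal (meanPath s s₀ s₁ ν n) := by
  rw [ofReal_meanPath hs hν hV, MeasureTheory.lintegral_iSup]
  · simp only [hQ.lintegral_pathTrunc hν]
  · exact fun d => measurable_pathTrunc_apply d n
  · exact fun d d' h W => Nat.cast_le.2 (pathTrunc_mono _ _ h)

lemma IsEnvLaw.ae_iSup_lt_top (hs : IsAdmissible b s s₀ s₁) (hν : IsSplitLaw ν)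
    (hV : ν {v | ∃ i, v i = 1} < 1) {Q : Measure (Env b)} (hQ : IsEnvLaw ν Q) (n : ℕ) :
    ∀ᵐ W ∂Q, ⨆ d, (pathTrunc s s₀ s₁ d (throws W) n : ENNReal) < ⊤ := by
  refine ae_lt_top (Measurable.iSup fun d => measurable_pathTrunc_apply d n) ?_
  rw [hQ.lintegral_iSup_pathTrunc hs hν hV]
  exact ENNReal.ofReal_ne_top

lemma IsEnvLaw.ae_valid (hν : IsSplitLaw ν) {Q : Measure (Env b)} (hQ : IsEnvLaw ν Q) :
    ∀ᵐ W ∂Q, ∀ u, (W u).1 ∈ stdSimplex ℝ (Fin b) ∧ ∀ m, ∑ i, (W u).2 m i = m := by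
  have h : ∀ u m, ∀ᵐ W ∂Q, (W u).1 ∈ stdSimplex ℝ (Fin b) ∧ ∑ i, (W u).2 m i = m := by
    intro u m
    have h1 := ae_throwLaw hν m
    rw [← IsSplitRandomness.map_throw hQ u m] at h1
    exact ae_of_ae_map (by fun_prop) h1
  have h2 := fun u => ae_all_iff.2 (h u)
  filter_upwards [ae_all_iff.2 h2] with W hW u
  exact ⟨(hW u 0).1, fun m => (hW u m).2⟩

/-- Almost surely, the path length is the eventual value of the truncated path lengths and of the
conditional means. -/
lemma IsEnvLaw.ae_path (hs : IsAdmissible b s s₀ s₁) (hν : IsSplitLaw ν)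
    (hV : ν {v | ∃ i, v i = 1} < 1) {Q : Measure (Env b)} (hQ : IsEnvLaw ν Q) (n : ℕ) :
    ∀ᵐ W ∂Q, pathLength s s₀ s₁ (throws W) n = ENNReal.ofReal (path s s₀ s₁ W n) ∧
      ∀ᶠ d in atTop, predict s s₀ s₁ ν d (throws W) n = path s s₀ s₁ W n := by
  filter_upwards [hQ.ae_iSup_lt_top hs hν hV n, hQ.ae_valid hν] with W hW hvalid
  -- a bounded monotone sequence of natural numbers is eventually constant
  obtain ⟨N, hN⟩ := ENNReal.exists_nat_gt hW.ne
  have hmono := pathTrunc_mono (s := s) (s₀ := s₀) (s₁ := s₁) (throws W) n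
  have hb : ∀ d, pathTrunc s s₀ s₁ d (throws W) n ≤ N := fun d => by
    have := (le_iSup (fun d => (pathTrunc s s₀ s₁ d (throws W) n : ENNReal)) d).trans hN.le
    exact_mod_cast this
  have hst : ∃ d₀, ∀ d ≥ d₀, pathTrunc s s₀ s₁ d (throws W) n
      = pathTrunc s s₀ s₁ d₀ (throws W) n := by
    by_contra hcon
    push Not at hcon
    have : ∀ k : ℕ, ∃ d, k ≤ pathTrunc s s₀ s₁ d (throws W) n := by
      intro k
      induction k with
      | zero => exact ⟨0, Nat.zero_le _⟩
      | succ k ih =>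
        obtain ⟨d, hd⟩ := ih
        obtain ⟨d', hd', hne⟩ := hcon d
        have := hmono hd'
        simp only at this
        exact ⟨d', by omega⟩
    obtain ⟨d, hd⟩ := this (N + 1)
    have := hb d
    omega
  obtain ⟨d₀, hd₀⟩ := hst
  have hsup : ⨆ d, (pathTrunc s s₀ s₁ d (throws W) n : ENNReal)
      = pathTrunc s s₀ s₁ d₀ (throws W) n := by
    refine le_antisymm (iSup_le fun d => ?_) (le_iSup (fun d =>
      (pathTrunc s s₀ s₁ d (throws W) n : ENNReal)) d₀)
    rcases le_total d₀ d with h | h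
    · rw [hd₀ d h]
    · exact Nat.cast_le.2 (hmono h)
  have hval : ∀ u m, ∑ i, throws W u m i = m := fun u m => (hvalid u).2 m
  have hpath : path s s₀ s₁ W n = pathTrunc s s₀ s₁ d₀ (throws W) n := by
    rw [path, hsup, ENNReal.toReal_natCast]
  refine ⟨?_, ?_⟩
  · rw [hpath, ENNReal.ofReal_natCast]
    exact (of_pathTrunc_succ_eq (ν := ν) hs d₀ _ n hval (hd₀ _ (Nat.le_succ _))).2.1
  · filter_upwards [eventually_ge_atTop (d₀ + 1)] with d hd
    obtain ⟨e, rfl⟩ := Nat.exists_eq_add_of_le' hd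
    rw [hpath, ← add_assoc]
    rw [(of_pathTrunc_succ_eq hs (e + d₀) _ n hval
      ((hd₀ _ (by omega)).trans (hd₀ _ (by omega)).symm)).2.2, hd₀ _ (by omega)]

/-- The path length of a tree, in terms of the subtrees of the root. -/
lemma IsEnvLaw.ae_path_eq (hs : IsAdmissible b s s₀ s₁) (hν : IsSplitLaw ν)
    (hV : ν {v | ∃ i, v i = 1} < 1) {Q : Measure (Env b)} (hQ : IsEnvLaw ν Q) {n : ℕ}
    (hn : s < n) : ∀ᵐ W ∂Q, path s s₀ s₁ W n
      = ∑ i, ((((W []).2 (n - s₀ - b * s₁) i + s₁ : ℕ) : ℝ)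
        + path s s₀ s₁ (SplitTree.subtree i W) ((W []).2 (n - s₀ - b * s₁) i + s₁)) := by
  filter_upwards [hQ.ae_iSup_lt_top hs hν hV n] with W hW
  have h1 : ⨆ d, (pathTrunc s s₀ s₁ d (throws W) n : ENNReal)
      = ∑ i, ((((W []).2 (n - s₀ - b * s₁) i + s₁ : ℕ) : ENNReal)
        + ⨆ d, (pathTrunc s s₀ s₁ d (throws (SplitTree.subtree i W))
          ((W []).2 (n - s₀ - b * s₁) i + s₁) : ENNReal)) := by
    have hmono : Monotone fun d => (pathTrunc s s₀ s₁ d (throws W) n : ENNReal) := fun d d' h =>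
      Nat.cast_le.2 (pathTrunc_mono _ _ h)
    rw [← hmono.iSup_nat_add 1]
    simp only [pathTrunc, if_pos hn]
    push_cast
    refine (ENNReal.finsetSum_iSup_of_monotone (s := Finset.univ) (f := fun i d =>
      ((W []).2 (n - s₀ - b * s₁) i : ENNReal) + s₁ + (pathTrunc s s₀ s₁ d
        (throws (SplitTree.subtree i W)) ((W []).2 (n - s₀ - b * s₁) i + s₁) : ENNReal))
      fun i d d' h => add_le_add_right (Nat.cast_le.2 (pathTrunc_mono _ _ h)) _).symm.trans ?_
    exact Finset.sum_congr rfl fun i _ => (ENNReal.add_iSup _).symm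
  have hfin : ∀ i, (((W []).2 (n - s₀ - b * s₁) i + s₁ : ℕ) : ENNReal)
        + ⨆ d, (pathTrunc s s₀ s₁ d (throws (SplitTree.subtree i W))
          ((W []).2 (n - s₀ - b * s₁) i + s₁) : ENNReal) ≠ ⊤ := by
    rw [h1] at hW
    exact fun i => (ENNReal.sum_lt_top.1 hW i (Finset.mem_univ i)).ne
  rw [path, h1, ENNReal.toReal_sum fun i _ => hfin i]
  refine Finset.sum_congr rfl fun i _ => ?_
  rw [ENNReal.toReal_add (ENNReal.add_ne_top.1 (hfin i)).1 (ENNReal.add_ne_top.1 (hfin i)).2,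
    ENNReal.toReal_natCast]
  rfl

lemma path_of_le (W : Env b) {n : ℕ} (hn : n ≤ s) : path s s₀ s₁ W n = 0 := by
  simp [path, pathTrunc_of_le _ _ hn]

lemma path_nonneg (W : Env b) (n : ℕ) : 0 ≤ path s s₀ s₁ W n := ENNReal.toReal_nonneg

lemma IsEnvLaw.lintegral_path (hs : IsAdmissible b s s₀ s₁) (hν : IsSplitLaw ν)
    (hV : ν {v | ∃ i, v i = 1} < 1) {Q : Measure (Env b)} (hQ : IsEnvLaw ν Q) (n : ℕ) :
    ∫⁻ W, ENNReal.ofReal (path s s₀ s₁ W n) ∂Q = ENNReal.ofReal (meanPath s s₀ s₁ ν n) := by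
  rw [← hQ.lintegral_iSup_pathTrunc hs hν hV]
  refine lintegral_congr_ae ?_
  filter_upwards [hQ.ae_iSup_lt_top hs hν hV n] with W hW
  exact ENNReal.ofReal_toReal hW.ne

lemma IsEnvLaw.integral_path (hs : IsAdmissible b s s₀ s₁) (hν : IsSplitLaw ν)
    (hV : ν {v | ∃ i, v i = 1} < 1) {Q : Measure (Env b)} (hQ : IsEnvLaw ν Q) (n : ℕ) :
    ∫ W, path s s₀ s₁ W n ∂Q = meanPath s s₀ s₁ ν n := by
  rw [integral_eq_lintegral_of_nonneg_ae (Eventually.of_forall fun W => path_nonneg W n)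
    (measurable_path_apply n).aestronglyMeasurable, hQ.lintegral_path hs hν hV,
    ENNReal.toReal_ofReal (meanPath_nonneg n)]

end

/-! ### Exponential moments of the path length -/

section

variable {b s s₀ s₁ : ℕ} {ν : Measure (Fin b → ℝ)}

lemma lintegral_pi_prod {ι : Type*} [Fintype ι] {E : ι → Type*} [∀ i, MeasurableSpace (E i)]
    (μ : ∀ i, Measure (E i)) [∀ i, IsProbabilityMeasure (μ i)] {f : ∀ i, E i → ENNReal}
    (hf : ∀ i, Measurable (f i)) :
    ∫⁻ x, ∏ i, f i (x i) ∂Measure.pi μ = ∏ i, ∫⁻ x, f i x ∂μ i := by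
  rw [lintegral_prod_eq_prod_lintegral_of_indepFun Finset.univ (fun i (x : ∀ i, E i) => f i (x i))
    (iIndepFun_pi fun i => (hf i).aemeasurable) fun i => (hf i).comp (measurable_pi_apply i)]
  exact Finset.prod_congr rfl fun i _ => (measurePreserving_eval μ i).lintegral_comp (hf i)

lemma mul_toll {n : ℕ} (hn : 0 < n) (k : Fin b → ℕ) :
    (n : ℝ) * toll s s₀ s₁ ν n k
      = ∑ i, (((k i + s₁ : ℕ) : ℝ) + meanPath s s₀ s₁ ν (k i + s₁)) - meanPath s s₀ s₁ ν n := by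
  rw [toll, mul_div_cancel₀]
  exact_mod_cast hn.ne'

lemma predict_succ_sub {d n : ℕ} (hn : s < n) (M : Node b → ℕ → Fin b → ℕ) :
    predict s s₀ s₁ ν (d + 1) M n - meanPath s s₀ s₁ ν n
      = n * toll s s₀ s₁ ν n (M [] (n - s₀ - b * s₁))
        + ∑ i, (predict s s₀ s₁ ν d (subtree i M) (M [] (n - s₀ - b * s₁) i + s₁)
          - meanPath s s₀ s₁ ν (M [] (n - s₀ - b * s₁) i + s₁)) := by
  rw [mul_toll (by omega), predict, if_pos hn, Finset.sum_sub_distrib, Finset.sum_add_distrib,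
    Finset.sum_add_distrib]
  ring

/-- The exponential moments of the conditional means, by induction on the number of generations:
given the throw at the root, the subtrees contribute a product. -/
lemma exists_lintegral_exp_predict_le (hs : IsAdmissible b s s₀ s₁) (hν : IsSplitLaw ν)
    (hV : ν {v | ∃ i, v i = 1} < 1) {lo hi : ℝ} (hlo : lo ≤ 0) (hhi : 0 ≤ hi)
    (hp : Real.exp hi * (ν {v | ∃ i, v i = 1}).toReal < 1) :
    ∃ K : ℝ, 0 ≤ K ∧ ∃ n₀ : ℕ, ∀ d, ∀ {Q : Measure (Env b)}, IsEnvLaw ν Q → ∀ n θ,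
      lo ≤ θ * (max n n₀ : ℕ) → θ * (max n n₀ : ℕ) ≤ hi →
      ∫⁻ W, ENNReal.ofReal (Real.exp (θ * (predict s s₀ s₁ ν d (throws W) n
        - meanPath s s₀ s₁ ν n))) ∂Q ≤ ENNReal.ofReal (Real.exp (K * θ ^ 2 * n ^ 2)) := by
  obtain ⟨K, hK, n₀, H⟩ := exists_integral_exp_toll_le hs hν hV hlo hhi hp
  refine ⟨K, hK, n₀, fun d => ?_⟩
  have hone : ∀ {Q : Measure (Env b)}, IsEnvLaw ν Q → ∀ d n θ, (∀ W : Env b,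
      predict s s₀ s₁ ν d (throws W) n - meanPath s s₀ s₁ ν n = 0) →
      ∫⁻ W, ENNReal.ofReal (Real.exp (θ * (predict s s₀ s₁ ν d (throws W) n
        - meanPath s s₀ s₁ ν n))) ∂Q ≤ ENNReal.ofReal (Real.exp (K * θ ^ 2 * n ^ 2)) := by
    intro Q hQ d n θ h
    have hP := hQ.isProbabilityMeasure hν
    simp only [h, mul_zero, Real.exp_zero, lintegral_const, measure_univ, mul_one]
    exact ENNReal.ofReal_le_ofReal (Real.one_le_exp (by positivity))
  induction d with
  | zero => exact fun {Q} hQ n θ _ _ => hone hQ 0 n θ fun W => sub_self _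
  | succ d ih =>
    intro Q hQ n θ h1 h2
    rcases le_or_gt n s with hn | hn
    · exact hone hQ (d + 1) n θ fun W => by
        rw [predict_of_le _ _ hn, meanPath_of_le hn, sub_self]
    have hP := fun i => (hQ.subtree hν i).isProbabilityMeasure hν
    have hemp : Measurable (meanPath s s₀ s₁ ν) := measurable_from_top
    have hq : Measurable fun q : Env b × ℕ => predict s s₀ s₁ ν d (throws q.1) q.2
        - meanPath s s₀ s₁ ν q.2 := (measurable_predict d).sub (hemp.comp measurable_snd)
    have hF : Measurable fun q : ((Fin b → ℝ) × (Fin b → ℕ)) × (Fin b → Env b) =>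
        n * toll s s₀ s₁ ν n q.1.2 + ∑ i, (predict s s₀ s₁ ν d (throws (q.2 i)) (q.1.2 i + s₁)
          - meanPath s s₀ s₁ ν (q.1.2 i + s₁)) := by
      have h2 : Measurable fun q : ((Fin b → ℝ) × (Fin b → ℕ)) × (Fin b → Env b) =>
          toll s s₀ s₁ ν n q.1.2 :=
        (isTame_throw (b := b) (toll s s₀ s₁ ν n)).measurable.comp measurable_fst
      refine (h2.const_mul _).add (Finset.measurable_sum _ fun i _ => ?_)
      have h3 : Measurable fun q : ((Fin b → ℝ) × (Fin b → ℕ)) × (Fin b → Env b) =>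
          (q.2 i, q.1.2 i + s₁) := by fun_prop
      have h4 := hq.comp h3
      exact h4
    have h := hQ.lintegral_root_subtree hν (n - s₀ - b * s₁) ((hF.const_mul θ).exp.ennreal_ofReal)
    simp only [predict_succ_sub hn]
    refine (Eq.trans ?_ h).trans_le ?_
    · rfl
    have hstep : ∀ᵐ p ∂throwLaw ν (n - s₀ - b * s₁),
        ∫⁻ T, ENNReal.ofReal (Real.exp (θ * (n * toll s s₀ s₁ ν n p.2
          + ∑ i, (predict s s₀ s₁ ν d (throws (T i)) (p.2 i + s₁)
          - meanPath s s₀ s₁ ν (p.2 i + s₁))))) ∂(Measure.pi fun i => Q.map (SplitTree.subtree i))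
        ≤ ENNReal.ofReal (Real.exp (θ * n * toll s s₀ s₁ ν n p.2
          + K * θ ^ 2 * ∑ i, ((p.2 i + s₁ : ℕ) : ℝ) ^ 2)) := by
      filter_upwards [ae_throwLaw hν (n - s₀ - b * s₁)] with p hp
      have hf : ∀ i, Measurable fun W : Env b => ENNReal.ofReal (Real.exp (θ *
          (predict s s₀ s₁ ν d (throws W) (p.2 i + s₁) - meanPath s s₀ s₁ ν (p.2 i + s₁)))) :=
        fun i => ((hq.comp (measurable_prodMk_right (y := p.2 i + s₁))).const_mul
          θ).exp.ennreal_ofReal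
      have e1 : ∀ T : Fin b → Env b, ENNReal.ofReal (Real.exp (θ * (n * toll s s₀ s₁ ν n p.2
          + ∑ i, (predict s s₀ s₁ ν d (throws (T i)) (p.2 i + s₁)
          - meanPath s s₀ s₁ ν (p.2 i + s₁)))))
          = ENNReal.ofReal (Real.exp (θ * n * toll s s₀ s₁ ν n p.2)) * ∏ i, ENNReal.ofReal
            (Real.exp (θ * (predict s s₀ s₁ ν d (throws (T i)) (p.2 i + s₁)
              - meanPath s s₀ s₁ ν (p.2 i + s₁)))) := by
        intro T
        rw [← ENNReal.ofReal_prod_of_nonneg fun i _ => (Real.exp_pos _).le, ← Real.exp_sum,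
          ← ENNReal.ofReal_mul (Real.exp_pos _).le, ← Real.exp_add, ← Finset.mul_sum]
        rw [mul_add, mul_assoc]
      have hprod : Measurable fun T : Fin b → Env b => ∏ i, ENNReal.ofReal
          (Real.exp (θ * (predict s s₀ s₁ ν d (throws (T i)) (p.2 i + s₁)
            - meanPath s s₀ s₁ ν (p.2 i + s₁)))) :=
        Finset.measurable_prod _ fun i _ => (hf i).comp (measurable_pi_apply i)
      simp only [e1]
      rw [lintegral_const_mul _ hprod, lintegral_pi_prod _ hf, Real.exp_add,
        ENNReal.ofReal_mul (Real.exp_pos _).le, Finset.mul_sum, Real.exp_sum,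
        ENNReal.ofReal_prod_of_nonneg fun i _ => (Real.exp_pos _).le]
      refine mul_le_mul_right (Finset.prod_le_prod' fun i _ => ih (hQ.subtree hν i) _ _ ?_ ?_) _
      -- the range of `θ` is inherited by the children, as `n_i ≤ n` and `lo ≤ 0 ≤ hi`
      all_goals
        have hle : ((max (p.2 i + s₁) n₀ : ℕ) : ℝ) ≤ (max n n₀ : ℕ) := by
          exact_mod_cast max_le_max_right _ (child_le hs hn hp.2 i)
        have h0 : (0 : ℝ) ≤ (max (p.2 i + s₁) n₀ : ℕ) := Nat.cast_nonneg _
      · rcases le_total 0 θ with hθ | hθ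
        · exact hlo.trans (mul_nonneg hθ h0)
        · exact h1.trans (mul_le_mul_of_nonpos_left hle hθ)
      · rcases le_total 0 θ with hθ | hθ
        · exact (mul_le_mul_of_nonneg_left hle hθ).trans h2
        · exact (mul_nonpos_of_nonpos_of_nonneg hθ h0).trans hhi
    refine (lintegral_mono_ae hstep).trans ?_
    have ht : IsTame fun p : (Fin b → ℝ) × (Fin b → ℕ) =>
        Real.exp (θ * n * toll s s₀ s₁ ν n p.2 + K * θ ^ 2 * ∑ i, ((p.2 i + s₁ : ℕ) : ℝ) ^ 2) :=
      isTame_throw fun k =>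
        Real.exp (θ * n * toll s s₀ s₁ ν n k + K * θ ^ 2 * ∑ i, ((k i + s₁ : ℕ) : ℝ) ^ 2)
    rw [← ofReal_integral_eq_lintegral_ofReal (ht.integrable hν _)
      (Eventually.of_forall fun _ => (Real.exp_pos _).le)]
    exact ENNReal.ofReal_le_ofReal (H n hn θ h1 h2)

/-- Gaussian bounds for the exponential moments of the path length, from those of its conditional
means by Fatou. The constants do not depend on the law of the environment. -/
lemma exists_lintegral_exp_path_le (hs : IsAdmissible b s s₀ s₁) (hν : IsSplitLaw ν)
    (hV : ν {v | ∃ i, v i = 1} < 1) {lo hi : ℝ} (hlo : lo ≤ 0) (hhi : 0 ≤ hi)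
    (hp : Real.exp hi * (ν {v | ∃ i, v i = 1}).toReal < 1) :
    ∃ K : ℝ, 0 ≤ K ∧ ∃ n₀ : ℕ, ∀ {Q : Measure (Env b)}, IsEnvLaw ν Q → ∀ n θ,
      lo ≤ θ * (max n n₀ : ℕ) → θ * (max n n₀ : ℕ) ≤ hi →
      ∫⁻ W, ENNReal.ofReal (Real.exp (θ * (path s s₀ s₁ W n - meanPath s s₀ s₁ ν n))) ∂Q
        ≤ ENNReal.ofReal (Real.exp (K * θ ^ 2 * n ^ 2)) := by
  obtain ⟨K, hK, n₀, H⟩ := exists_lintegral_exp_predict_le hs hν hV hlo hhi hp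
  refine ⟨K, hK, n₀, fun {Q} hQ n θ h1 h2 => ?_⟩
  have hm : ∀ d, Measurable fun W : Env b => ENNReal.ofReal (Real.exp (θ *
      (predict s s₀ s₁ ν d (throws W) n - meanPath s s₀ s₁ ν n))) := fun d =>
    ((((measurable_predict d).comp (measurable_prodMk_right (y := n))).sub_const _).const_mul
      θ).exp.ennreal_ofReal
  have h3 : ∫⁻ W, ENNReal.ofReal (Real.exp (θ * (path s s₀ s₁ W n - meanPath s s₀ s₁ ν n))) ∂Q
      = ∫⁻ W, liminf (fun d => ENNReal.ofReal (Real.exp (θ *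
        (predict s s₀ s₁ ν d (throws W) n - meanPath s s₀ s₁ ν n)))) atTop ∂Q := by
    refine lintegral_congr_ae ?_
    filter_upwards [hQ.ae_path hs hν hV n] with W hW
    refine (Tendsto.liminf_eq (tendsto_nhds_of_eventually_eq ?_)).symm
    filter_upwards [hW.2] with d hd
    rw [hd]
  rw [h3]
  refine (lintegral_liminf_le hm).trans ?_
  exact liminf_le_of_le (by isBoundedDefault) fun a ha => by
    obtain ⟨d, hd⟩ := ha.exists
    exact hd.trans (H d hQ n θ h1 h2)

end

/-! ### The limit variable on the environment -/

section

variable {b s s₀ s₁ : ℕ} {ν : Measure (Fin b → ℝ)}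

lemma IsEnvLaw.integral_root_subtree (hν : IsSplitLaw ν) {Q : Measure (Env b)}
    (hQ : IsEnvLaw ν Q) (m : ℕ)
    {F : ((Fin b → ℝ) × (Fin b → ℕ)) → (Fin b → Env b) → ℝ} (hF : Measurable (Function.uncurry F))
    (hint : Integrable (fun W => F ((W []).1, (W []).2 m) fun i => SplitTree.subtree i W) Q) :
    ∫ W, F ((W []).1, (W []).2 m) (fun i => SplitTree.subtree i W) ∂Q
      = ∫ p, ∫ T, F p T ∂(Measure.pi fun i => Q.map (SplitTree.subtree i)) ∂throwLaw ν m := by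
  have hP := fun i => (hQ.subtree hν i).isProbabilityMeasure hν
  have hP' := isProbabilityMeasure_throwLaw hν m
  have hsm : Measurable fun (W : Env b) i => SplitTree.subtree i W :=
    measurable_pi_iff.2 fun i => measurable_subtree i
  have hg : Measurable fun W : Env b => (((W []).1, (W []).2 m), fun i => SplitTree.subtree i W) :=
    Measurable.prodMk (by fun_prop) hsm
  have h1 := integral_map (μ := Q) hg.aemeasurable (f := Function.uncurry F)
    hF.aestronglyMeasurable
  have h2 : Integrable (Function.uncurry F)
      ((throwLaw ν m).prod (Measure.pi fun i => Q.map (SplitTree.subtree i))) := by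
    rw [← hQ.map_root_subtree hν m]
    exact (integrable_map_measure hF.aestronglyMeasurable hg.aemeasurable).2 hint
  rw [hQ.map_root_subtree hν m] at h1
  exact h1.symm.trans (integral_prod _ h2)

lemma integral_pi_sum {ι : Type*} [Fintype ι] {E : ι → Type*} [∀ i, MeasurableSpace (E i)]
    {μ : ∀ i, Measure (E i)} [∀ i, IsProbabilityMeasure (μ i)] {Z : ∀ i, E i → ℝ}
    (hZ : ∀ i, Integrable (Z i) (μ i)) (h0 : ∀ i, ∫ x, Z i x ∂μ i = 0) (c : ℝ) :
    ∫ x, (∑ i, Z i (x i) + c) ∂Measure.pi μ = c := by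
  have h1 : Integrable (fun x : ∀ i, E i => ∑ i, Z i (x i)) (Measure.pi μ) :=
    integrable_finsetSum _ fun i _ => integrable_comp_eval (hZ i)
  rw [integral_add h1 (integrable_const c), integral_finsetSum _ fun i _ =>
    integrable_comp_eval (hZ i)]
  simp only [integral_comp_eval (hZ _).aestronglyMeasurable, h0]
  simp

/-- The second moment of a sum of independent centred variables and a constant. -/
lemma integral_pi_sum_sq {ι : Type*} [Fintype ι] {E : ι → Type*} [∀ i, MeasurableSpace (E i)]
    {μ : ∀ i, Measure (E i)} [∀ i, IsProbabilityMeasure (μ i)] {Z : ∀ i, E i → ℝ}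
    (hZ : ∀ i, MemLp (Z i) 2 (μ i)) (h0 : ∀ i, ∫ x, Z i x ∂μ i = 0) (c : ℝ) :
    ∫ x, (∑ i, Z i (x i) + c) ^ 2 ∂Measure.pi μ = ∑ i, ∫ x, Z i x ^ 2 ∂μ i + c ^ 2 := by
  have h1 : MemLp (fun x : ∀ i, E i => ∑ i, Z i (x i) + c) 2 (Measure.pi μ) :=
    (memLp_finsetSum _ fun i _ => (hZ i).comp_measurePreserving
      (measurePreserving_eval μ i)).add (memLp_const c)
  have h2 := variance_eq_sub h1
  have h3 : Var[fun x : ∀ i, E i => ∑ i, Z i (x i) + c; Measure.pi μ] = ∑ i, Var[Z i; μ i] := by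
    rw [variance_add_const (X := fun x : ∀ i, E i => ∑ i, Z i (x i)), ← variance_sum_pi hZ]
    · congr 1
      ext x
      simp
    · exact (memLp_finsetSum _ fun i _ => (hZ i).comp_measurePreserving
        (measurePreserving_eval μ i)).aestronglyMeasurable
  rw [h3, integral_pi_sum (fun i => (hZ i).integrable one_le_two) h0] at h2
  simp only [variance_of_integral_eq_zero (hZ _).aemeasurable (h0 _)] at h2
  simp only [Pi.pow_apply] at h2
  linarith

/-- The second moment of a sum over the subtrees of the root that are centred given the throw at
the root. -/
lemma IsEnvLaw.integral_sum_sq (hν : IsSplitLaw ν) {Q : Measure (Env b)} (hQ : IsEnvLaw ν Q)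
    (m : ℕ) {Z : (Fin b → ℝ) × (Fin b → ℕ) → Fin b → Env b → ℝ} {c : (Fin b → ℝ) × (Fin b → ℕ) → ℝ}
    (hZ : ∀ i, Measurable fun q : ((Fin b → ℝ) × (Fin b → ℕ)) × Env b => Z q.1 i q.2)
    (hc : Measurable c)
    (hL : ∀ᵐ p ∂throwLaw ν m, ∀ i, MemLp (Z p i) 2 (Q.map (SplitTree.subtree i)) ∧
      ∫ W, Z p i W ∂Q.map (SplitTree.subtree i) = 0)
    (hint : MemLp (fun W => ∑ i, Z ((W []).1, (W []).2 m) i (SplitTree.subtree i W)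
      + c ((W []).1, (W []).2 m)) 2 Q) :
    ∫ W, (∑ i, Z ((W []).1, (W []).2 m) i (SplitTree.subtree i W) + c ((W []).1, (W []).2 m)) ^ 2 ∂Q
      = ∫ p, (∑ i, ∫ W, Z p i W ^ 2 ∂Q.map (SplitTree.subtree i) + c p ^ 2) ∂throwLaw ν m := by
  have hP := fun i => (hQ.subtree hν i).isProbabilityMeasure hν
  have hF : Measurable (Function.uncurry fun (p : (Fin b → ℝ) × (Fin b → ℕ)) (T : Fin b → Env b) =>
      (∑ i, Z p i (T i) + c p) ^ 2) := by
    refine ((Finset.measurable_sum _ fun i _ => ?_).add (hc.comp measurable_fst)).pow_const 2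
    have h1 : Measurable fun q : ((Fin b → ℝ) × (Fin b → ℕ)) × (Fin b → Env b) => (q.1, q.2 i) := by
      fun_prop
    have h2 := (hZ i).comp h1
    exact h2
  rw [hQ.integral_root_subtree hν m hF hint.integrable_sq]
  refine integral_congr_ae ?_
  filter_upwards [hL] with p hp
  exact integral_pi_sum_sq (fun i => (hp i).1) (fun i => (hp i).2) (c p)

/-- The `d`-th iterate of the fixed point equation along the tree, started at zero. -/
def approx {b : ℕ} (ν : Measure (Fin b → ℝ)) : ℕ → Env b → ℝ
  | 0, _ => 0
  | d + 1, W => ∑ i, (W []).1 i * approx ν d (subtree i W) + cost ν (W []).1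

/-- The increments of `approx`. -/
def incr {b : ℕ} (ν : Measure (Fin b → ℝ)) (d : ℕ) (W : Env b) : ℝ :=
  approx ν (d + 1) W - approx ν d W

lemma incr_zero (W : Env b) : incr ν 0 W = cost ν (W []).1 := by
  simp [incr, approx]

lemma incr_succ (d : ℕ) (W : Env b) :
    incr ν (d + 1) W = ∑ i, (W []).1 i * incr ν d (subtree i W) := by
  rw [incr, approx, approx, add_sub_add_right_eq_sub, ← Finset.sum_sub_distrib]
  exact Finset.sum_congr rfl fun i _ => by rw [incr, mul_sub]

lemma sum_incr (d : ℕ) (W : Env b) : ∑ e ∈ Finset.range d, incr ν e W = approx ν d W := by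
  simp only [incr]
  rw [Finset.sum_range_sub (fun d => approx ν d W)]
  simp [approx]

lemma measurable_approx (d : ℕ) : Measurable (approx (b := b) ν d) := by
  induction d with
  | zero => exact measurable_const
  | succ d ih =>
    refine (Finset.measurable_sum _ fun i _ => ?_).add (measurable_cost.comp (by fun_prop))
    exact Measurable.mul (by fun_prop) (ih.comp (measurable_subtree i))

lemma measurable_incr (d : ℕ) : Measurable (incr (b := b) ν d) :=
  (measurable_approx (d + 1)).sub (measurable_approx d)

lemma abs_sum_mul_le {v : Fin b → ℝ} (hv : v ∈ stdSimplex ℝ (Fin b)) {x : Fin b → ℝ} {c : ℝ}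
    (hx : ∀ i, |x i| ≤ c) : |∑ i, v i * x i| ≤ c := by
  refine (Finset.abs_sum_le_sum_abs _ _).trans ?_
  calc ∑ i, |v i * x i| ≤ ∑ i, v i * c := Finset.sum_le_sum fun i _ => by
        rw [abs_mul, abs_of_nonneg (hv.1 i)]
        exact mul_le_mul_of_nonneg_left (hx i) (hv.1 i)
    _ = c := by rw [← Finset.sum_mul, hv.2, one_mul]

lemma abs_incr_le {c : ℝ} (hc : ∀ v ∈ stdSimplex ℝ (Fin b), |cost ν v| ≤ c) (d : ℕ) :
    ∀ W : Env b, (∀ u, (W u).1 ∈ stdSimplex ℝ (Fin b)) → |incr ν d W| ≤ c := by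
  induction d with
  | zero => exact fun W hW => by rw [incr_zero]; exact hc _ (hW [])
  | succ d ih =>
    intro W hW
    rw [incr_succ]
    exact abs_sum_mul_le (hW []) fun i => ih _ fun u => hW _

lemma IsEnvLaw.memLp_incr (hν : IsSplitLaw ν) (hV : ν {v | ∃ i, v i = 1} < 1)
    {Q : Measure (Env b)} (hQ : IsEnvLaw ν Q) (d : ℕ) : MemLp (incr ν d) 2 Q := by
  have hP := hQ.isProbabilityMeasure hν
  refine MemLp.of_bound (measurable_incr d).aestronglyMeasurable (1 + (meanLog ν)⁻¹ * b) ?_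
  filter_upwards [hQ.ae_valid hν] with W hW
  exact abs_incr_le (abs_cost_le hν hV) d W fun u => (hW u).1

lemma IsEnvLaw.memLp_approx (hν : IsSplitLaw ν) (hV : ν {v | ∃ i, v i = 1} < 1)
    {Q : Measure (Env b)} (hQ : IsEnvLaw ν Q) (d : ℕ) : MemLp (approx ν d) 2 Q := by
  have h : approx (b := b) ν d = fun W => ∑ e ∈ Finset.range d, incr ν e W :=
    funext fun W => (sum_incr d W).symm
  rw [h]
  exact memLp_finsetSum _ fun e _ => hQ.memLp_incr hν hV e

lemma measurable_mul_apply {f : Env b → ℝ} (hf : Measurable f) (i : Fin b) :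
    Measurable fun q : ((Fin b → ℝ) × (Fin b → ℕ)) × Env b => q.1.1 i * f q.2 :=
  Measurable.mul (by fun_prop) (hf.comp measurable_snd)

lemma IsEnvLaw.integral_approx (hν : IsSplitLaw ν) (hV : ν {v | ∃ i, v i = 1} < 1) (d : ℕ) :
    ∀ {Q : Measure (Env b)}, IsEnvLaw ν Q → ∫ W, approx ν d W ∂Q = 0 := by
  induction d with
  | zero => intro Q _; simp [approx]
  | succ d ih =>
    intro Q hQ
    have hP := hQ.isProbabilityMeasure hν
    have hPi := fun i => (hQ.subtree hν i).isProbabilityMeasure hν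
    have hF : Measurable (Function.uncurry fun (p : (Fin b → ℝ) × (Fin b → ℕ))
        (T : Fin b → Env b) => ∑ i, p.1 i * approx ν d (T i) + cost ν p.1) := by
      refine (Finset.measurable_sum _ fun i _ => ?_).add
        (measurable_cost.comp (measurable_fst.comp measurable_fst))
      have h1 : Measurable fun q : ((Fin b → ℝ) × (Fin b → ℕ)) × (Fin b → Env b) =>
        (q.1, q.2 i) := by fun_prop
      have h2 := (measurable_mul_apply (measurable_approx (ν := ν) d) i).comp h1
      exact h2
    have h := hQ.integral_root_subtree hν 0 hF
      ((hQ.memLp_approx hν hV (d + 1)).integrable one_le_two)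
    refine Eq.trans h ?_
    have h2 : ∀ p : (Fin b → ℝ) × (Fin b → ℕ), ∫ T : Fin b → Env b,
        (∑ i, p.1 i * approx ν d (T i) + cost ν p.1)
          ∂(Measure.pi fun i => Q.map (SplitTree.subtree i)) = cost ν p.1 := fun p =>
      integral_pi_sum (Z := fun i W => p.1 i * approx ν d W) (fun i =>
        (((hQ.subtree hν i).memLp_approx hν hV d).integrable one_le_two).const_mul _)
        (fun i => by rw [integral_const_mul, ih (hQ.subtree hν i), mul_zero]) _
    simp only [h2]
    rw [integral_throwLaw_vector hν 0 measurable_cost (abs_cost_le hν hV), integral_cost hν hV]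

lemma integral_sum_sq_throwLaw (hν : IsSplitLaw ν) (m : ℕ) :
    ∫ p, ∑ i, p.1 i ^ 2 ∂throwLaw ν m = ∫ v, ∑ i, v i ^ 2 ∂ν :=
  integral_throwLaw_vector hν m (g := fun v => ∑ i, v i ^ 2) (by fun_prop) abs_sum_sq_le

lemma isTame_sum_sq : IsTame fun p : (Fin b → ℝ) × (Fin b → ℕ) => ∑ i, p.1 i ^ 2 :=
  IsTame.sum fun i => (isTame_coord i).pow 2

lemma IsEnvLaw.integral_incr (hν : IsSplitLaw ν) (hV : ν {v | ∃ i, v i = 1} < 1) (d : ℕ)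
    {Q : Measure (Env b)} (hQ : IsEnvLaw ν Q) : ∫ W, incr ν d W ∂Q = 0 := by
  have hP := hQ.isProbabilityMeasure hν
  simp only [incr]
  rw [integral_sub ((hQ.memLp_approx hν hV _).integrable one_le_two)
    ((hQ.memLp_approx hν hV _).integrable one_le_two), hQ.integral_approx hν hV,
    hQ.integral_approx hν hV, sub_zero]

/-- The increments decay geometrically in mean square. -/
lemma IsEnvLaw.integral_incr_sq_le (hν : IsSplitLaw ν) (hV : ν {v | ∃ i, v i = 1} < 1) (d : ℕ) :
    ∀ {Q : Measure (Env b)}, IsEnvLaw ν Q → ∫ W, incr ν d W ^ 2 ∂Q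
      ≤ (∫ v, ∑ i, v i ^ 2 ∂ν) ^ d * (1 + (meanLog ν)⁻¹ * b) ^ 2 := by
  induction d with
  | zero =>
    intro Q hQ
    have hP := hQ.isProbabilityMeasure hν
    rw [pow_zero, one_mul]
    refine (integral_mono_ae (hQ.memLp_incr hν hV 0).integrable_sq (integrable_const
      ((1 + (meanLog ν)⁻¹ * b) ^ 2)) ?_).trans_eq (by simp)
    filter_upwards [hQ.ae_valid hν] with W hW
    rw [← sq_abs]
    exact pow_le_pow_left₀ (abs_nonneg _)
      (abs_incr_le (abs_cost_le hν hV) 0 W fun u => (hW u).1) 2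
  | succ d ih =>
    intro Q hQ
    have h1 : ∀ W : Env b, incr ν (d + 1) W
        = ∑ i, (W []).1 i * incr ν d (SplitTree.subtree i W) + 0 := fun W => by
      rw [incr_succ, add_zero]
    have hmem := hQ.memLp_incr hν hV (d + 1)
    rw [show incr (b := b) ν (d + 1) = fun W => ∑ i, (W []).1 i
      * incr ν d (SplitTree.subtree i W) + 0 from funext h1] at hmem
    have h := hQ.integral_sum_sq hν 0 (Z := fun p i W => p.1 i * incr ν d W) (c := fun _ => 0)
      (fun i => measurable_mul_apply (measurable_incr d) i) measurable_const
      (Eventually.of_forall fun p i => ⟨((hQ.subtree hν i).memLp_incr hν hV d).const_mul _, by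
        rw [integral_const_mul, (hQ.subtree hν i).integral_incr hν hV, mul_zero]⟩) hmem
    simp only [h1]
    rw [h, pow_succ' (∫ v, ∑ i, v i ^ 2 ∂ν) d, mul_assoc]
    have hS := isTame_sum_sq (b := b)
    refine (integral_mono_of_nonneg (Eventually.of_forall fun p => ?_)
      ((hS.integrable hν 0).mul_const _) (Eventually.of_forall fun p => ?_)).trans_eq
      ((integral_mul_const _ _).trans (by rw [integral_sum_sq_throwLaw hν]))
    · exact add_nonneg (Finset.sum_nonneg fun i _ => integral_nonneg fun W => sq_nonneg _)
        (sq_nonneg _)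
    · simp only [mul_pow, integral_const_mul]
      rw [zero_pow two_ne_zero, add_zero, Finset.sum_mul]
      exact Finset.sum_le_sum fun i _ => mul_le_mul_of_nonneg_left (ih (hQ.subtree hν i))
        (sq_nonneg _)

lemma IsEnvLaw.integral_approx_sq_le (hν : IsSplitLaw ν) (hV : ν {v | ∃ i, v i = 1} < 1) (d : ℕ) :
    ∀ {Q : Measure (Env b)}, IsEnvLaw ν Q → ∫ W, approx ν d W ^ 2 ∂Q
      ≤ (1 + (meanLog ν)⁻¹ * b) ^ 2 / (1 - ∫ v, ∑ i, v i ^ 2 ∂ν) := by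
  have hρ := integral_sum_sq_lt_one hν hV
  set c := 1 + (meanLog ν)⁻¹ * b with hc
  set ρ := ∫ v, ∑ i, v i ^ 2 ∂ν with hρd
  have hB : 0 ≤ c ^ 2 / (1 - ρ) := div_nonneg (sq_nonneg _) (by linarith)
  induction d with
  | zero => intro Q _; simpa [approx] using hB
  | succ d ih =>
    intro Q hQ
    have h := hQ.integral_sum_sq hν 0 (Z := fun p i W => p.1 i * approx ν d W)
      (c := fun p => cost ν p.1)
      (fun i => measurable_mul_apply (measurable_approx d) i) (measurable_cost.comp measurable_fst)
      (Eventually.of_forall fun p i => ⟨((hQ.subtree hν i).memLp_approx hν hV d).const_mul _, by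
        rw [integral_const_mul, (hQ.subtree hν i).integral_approx hν hV, mul_zero]⟩)
      (hQ.memLp_approx hν hV (d + 1))
    refine (Eq.trans_le h ?_)
    have hS := isTame_sum_sq (b := b)
    have hP := isProbabilityMeasure_throwLaw hν 0
    refine (integral_mono_of_nonneg (Eventually.of_forall fun p => ?_)
      (((hS.integrable hν 0).mul_const (c ^ 2 / (1 - ρ))).add (integrable_const (c ^ 2))) ?_).trans ?_
    · exact add_nonneg (Finset.sum_nonneg fun i _ => integral_nonneg fun W => sq_nonneg _)
        (sq_nonneg _)
    · filter_upwards [ae_throwLaw hν 0] with p hp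
      simp only [mul_pow, integral_const_mul, Pi.add_apply]
      refine add_le_add ?_ ?_
      · rw [Finset.sum_mul]
        exact Finset.sum_le_sum fun i _ => mul_le_mul_of_nonneg_left (ih (hQ.subtree hν i))
          (sq_nonneg _)
      · rw [← sq_abs]
        exact pow_le_pow_left₀ (abs_nonneg _) (abs_cost_le hν hV _ hp.1) 2
    · simp only [Pi.add_apply]
      rw [integral_add ((hS.integrable hν 0).mul_const _) (integrable_const _), integral_mul_const,
        integral_sum_sq_throwLaw hν, ← hρd]
      have : 1 - ρ ≠ 0 := by linarith
      refine le_of_eq ?_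
      simp
      field_simp
      ring

lemma sq_integral_abs_le {Ω : Type*} [MeasurableSpace Ω] {P : Measure Ω} [IsProbabilityMeasure P]
    {f : Ω → ℝ} (hf : MemLp f 2 P) : (∫ ω, |f ω| ∂P) ^ 2 ≤ ∫ ω, f ω ^ 2 ∂P := by
  have h1 := variance_eq_sub hf.abs
  have h2 := variance_nonneg |f| P
  simp only [Pi.pow_apply, Pi.abs_apply, sq_abs] at h1
  linarith

/-- The limit of the iterates, on the event where it exists. -/
def limitVar {b : ℕ} (ν : Measure (Fin b → ℝ)) (W : Env b) : ℝ :=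
  limUnder atTop fun d => approx ν d W

lemma measurable_limitVar : Measurable (limitVar (b := b) ν) :=
  (StronglyMeasurable.limUnder fun d => (measurable_approx (ν := ν) d).stronglyMeasurable).measurable

lemma IsEnvLaw.summable_integral_incr (hν : IsSplitLaw ν) (hV : ν {v | ∃ i, v i = 1} < 1)
    {Q : Measure (Env b)} (hQ : IsEnvLaw ν Q) : Summable fun d => ∫ W, ‖incr ν d W‖ ∂Q := by
  have hP := hQ.isProbabilityMeasure hν
  have hρ := integral_sum_sq_lt_one hν hV
  have hρ0 := integral_sum_sq_nonneg (ν := ν)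
  set c := 1 + (meanLog ν)⁻¹ * b with hc
  have hc0 : 0 ≤ c := by have := inv_pos.2 (meanLog_pos hν hV); positivity
  set ρ := ∫ v, ∑ i, v i ^ 2 ∂ν with hρd
  have hr : Real.sqrt ρ < 1 := by rw [Real.sqrt_lt' one_pos]; simpa using hρ
  refine Summable.of_nonneg_of_le (fun d => integral_nonneg fun W => norm_nonneg _) (fun d => ?_)
    ((summable_geometric_of_lt_one (Real.sqrt_nonneg ρ) hr).mul_right c)
  refine le_of_sq_le_sq ?_ (by positivity)
  have h1 := (sq_integral_abs_le (hQ.memLp_incr hν hV d)).trans (hQ.integral_incr_sq_le hν hV d)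
  rw [mul_pow, ← pow_mul, mul_comm d 2, pow_mul, Real.sq_sqrt hρ0]
  exact h1

lemma IsEnvLaw.ae_tendsto_approx (hν : IsSplitLaw ν) (hV : ν {v | ∃ i, v i = 1} < 1)
    {Q : Measure (Env b)} (hQ : IsEnvLaw ν Q) :
    ∀ᵐ W ∂Q, HasSum (fun d => incr ν d W) (limitVar ν W) ∧
      Tendsto (fun d => approx ν d W) atTop (𝓝 (limitVar ν W)) := by
  have hP := hQ.isProbabilityMeasure hν
  have hint : ∀ d, Integrable (incr ν d) Q := fun d => (hQ.memLp_incr hν hV d).integrable one_le_two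
  have h1 : ∫⁻ W, ∑' d, ‖incr ν d W‖ₑ ∂Q ≠ ⊤ := by
    rw [lintegral_tsum fun d => (measurable_incr d).enorm.aemeasurable]
    simp only [← ofReal_integral_norm_eq_lintegral_enorm (hint _)]
    exact (hQ.summable_integral_incr hν hV).tsum_ofReal_ne_top
  filter_upwards [ae_lt_top (Measurable.tsum fun d => (measurable_incr d).enorm) h1]
    with W hW
  have h2 : Summable fun d => incr ν d W := by
    refine Summable.of_norm ?_
    have := ENNReal.summable_toReal hW.ne
    simpa using this
  have h3 := h2.hasSum.tendsto_sum_nat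
  simp only [sum_incr] at h3
  have h4 : limitVar ν W = ∑' d, incr ν d W := h3.limUnder_eq
  rw [h4]
  exact ⟨h2.hasSum, h3⟩

lemma IsEnvLaw.integral_limitVar (hν : IsSplitLaw ν) (hV : ν {v | ∃ i, v i = 1} < 1)
    {Q : Measure (Env b)} (hQ : IsEnvLaw ν Q) : ∫ W, limitVar ν W ∂Q = 0 := by
  have hP := hQ.isProbabilityMeasure hν
  have h := hasSum_integral_of_summable_integral_norm (F := fun d W => incr ν d W)
    (fun d => (hQ.memLp_incr hν hV d).integrable one_le_two) (hQ.summable_integral_incr hν hV)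
  simp only [hQ.integral_incr hν hV] at h
  rw [integral_congr_ae ((hQ.ae_tendsto_approx hν hV).mono fun W hW => hW.1.tsum_eq.symm)]
  exact h.unique hasSum_zero

/-- The second moment of the limit is bounded uniformly in the environment. -/
lemma IsEnvLaw.lintegral_limitVar_sq_le (hν : IsSplitLaw ν) (hV : ν {v | ∃ i, v i = 1} < 1)
    {Q : Measure (Env b)} (hQ : IsEnvLaw ν Q) : ∫⁻ W, ENNReal.ofReal (limitVar ν W ^ 2) ∂Q
      ≤ ENNReal.ofReal ((1 + (meanLog ν)⁻¹ * b) ^ 2 / (1 - ∫ v, ∑ i, v i ^ 2 ∂ν)) := by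
  have h3 : ∫⁻ W, ENNReal.ofReal (limitVar ν W ^ 2) ∂Q
      = ∫⁻ W, liminf (fun d => ENNReal.ofReal (approx ν d W ^ 2)) atTop ∂Q := by
    refine lintegral_congr_ae ?_
    filter_upwards [hQ.ae_tendsto_approx hν hV] with W hW
    exact (Tendsto.liminf_eq (ENNReal.tendsto_ofReal (hW.2.pow 2))).symm
  rw [h3]
  refine (lintegral_liminf_le fun d => ((measurable_approx d).pow_const 2).ennreal_ofReal).trans ?_
  refine liminf_le_of_le (by isBoundedDefault) fun a ha => ?_
  obtain ⟨d, hd⟩ := ha.exists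
  refine hd.trans ?_
  rw [← ofReal_integral_eq_lintegral_ofReal (hQ.memLp_approx hν hV d).integrable_sq
    (Eventually.of_forall fun _ => sq_nonneg _)]
  exact ENNReal.ofReal_le_ofReal (hQ.integral_approx_sq_le hν hV d)

lemma memLp_two_of_lintegral_sq {Ω : Type*} [MeasurableSpace Ω] {P : Measure Ω} {f : Ω → ℝ}
    (hf : Measurable f) (h : ∫⁻ ω, ENNReal.ofReal (f ω ^ 2) ∂P < ⊤) : MemLp f 2 P := by
  rw [memLp_two_iff_integrable_sq hf.aestronglyMeasurable]
  refine ⟨(hf.pow_const 2).aestronglyMeasurable, ?_⟩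
  rw [hasFiniteIntegral_iff_ofReal (Eventually.of_forall fun _ => sq_nonneg _)]
  exact h

lemma IsEnvLaw.memLp_limitVar (hν : IsSplitLaw ν) (hV : ν {v | ∃ i, v i = 1} < 1)
    {Q : Measure (Env b)} (hQ : IsEnvLaw ν Q) : MemLp (limitVar ν) 2 Q :=
  memLp_two_of_lintegral_sq measurable_limitVar
    ((hQ.lintegral_limitVar_sq_le hν hV).trans_lt ENNReal.ofReal_lt_top)

lemma IsEnvLaw.integral_limitVar_sq_le (hν : IsSplitLaw ν) (hV : ν {v | ∃ i, v i = 1} < 1)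
    {Q : Measure (Env b)} (hQ : IsEnvLaw ν Q) : ∫ W, limitVar ν W ^ 2 ∂Q
      ≤ (1 + (meanLog ν)⁻¹ * b) ^ 2 / (1 - ∫ v, ∑ i, v i ^ 2 ∂ν) := by
  have h := hQ.lintegral_limitVar_sq_le hν hV
  rw [← ofReal_integral_eq_lintegral_ofReal (hQ.memLp_limitVar hν hV).integrable_sq
    (Eventually.of_forall fun _ => sq_nonneg _)] at h
  have hρ := integral_sum_sq_lt_one hν hV
  exact (ENNReal.ofReal_le_ofReal_iff (div_nonneg (sq_nonneg _) (by linarith))).1 h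

/-- The limit solves the fixed point equation along the tree. -/
lemma IsEnvLaw.ae_limitVar_eq (hν : IsSplitLaw ν) (hV : ν {v | ∃ i, v i = 1} < 1)
    {Q : Measure (Env b)} (hQ : IsEnvLaw ν Q) : ∀ᵐ W ∂Q, limitVar ν W
      = ∑ i, (W []).1 i * limitVar ν (SplitTree.subtree i W) + cost ν (W []).1 := by
  have h1 : ∀ i, ∀ᵐ W ∂Q, Tendsto (fun d => approx ν d (SplitTree.subtree i W)) atTop
      (𝓝 (limitVar ν (SplitTree.subtree i W))) := fun i =>
    ae_of_ae_map (measurable_subtree i).aemeasurable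
      (((hQ.subtree hν i).ae_tendsto_approx hν hV).mono fun W hW => hW.2)
  filter_upwards [hQ.ae_tendsto_approx hν hV, ae_all_iff.2 h1] with W hW hsub
  refine tendsto_nhds_unique (hW.2.comp (tendsto_add_atTop_nat 1)) ?_
  exact (tendsto_finsetSum _ fun i _ => (hsub i).const_mul _).add tendsto_const_nhds

end

/-! ### Convergence in mean square to the limit variable -/

section

variable {b s s₀ s₁ : ℕ} {ν : Measure (Fin b → ℝ)}

/-- The normalized path length as a function of the environment. -/
def normPath (s s₀ s₁ : ℕ) {b : ℕ} (ν : Measure (Fin b → ℝ)) (n : ℕ) (W : Env b) : ℝ :=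
  (path s s₀ s₁ W n - meanPath s s₀ s₁ ν n) / n

lemma measurable_normPath_apply (n : ℕ) : Measurable (normPath (b := b) s s₀ s₁ ν n) :=
  ((measurable_path_apply n).sub_const _).div_const _

lemma measurable_normPath :
    Measurable fun q : ℕ × Env b => normPath s s₀ s₁ ν q.1 q.2 := by
  refine measurable_from_prod_countable_right fun n => ?_
  exact measurable_normPath_apply n

/-- For `n = 0` both sides vanish, so the division by `n` is harmless. -/
lemma natCast_mul_normPath (n : ℕ) (W : Env b) :
    n * normPath s s₀ s₁ ν n W = path s s₀ s₁ W n - meanPath s s₀ s₁ ν n := by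
  rcases Nat.eq_zero_or_pos n with rfl | hn
  · rw [path_of_le W (Nat.zero_le s), meanPath_of_le (Nat.zero_le s)]; simp
  · rw [normPath, mul_div_cancel₀]
    exact_mod_cast hn.ne'

lemma exists_pos_exp_mul_lt_one {p t : ℝ} (h : Real.exp t * p < 1) :
    ∃ t' > t, Real.exp t' * p < 1 := by
  have hc : ContinuousAt (fun x => Real.exp x * p) t := by fun_prop
  have h1 : ∀ᶠ x in 𝓝[>] t, Real.exp x * p < 1 :=
    (hc.tendsto.eventually_lt_const h).filter_mono nhdsWithin_le_nhds
  obtain ⟨t', h2, h3⟩ := (h1.and self_mem_nhdsWithin).exists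
  exact ⟨t', h3, h2⟩

lemma toReal_lt_one (hV : ν {v | ∃ i, v i = 1} < 1) : (ν {v | ∃ i, v i = 1}).toReal < 1 := by
  have := (ENNReal.toReal_lt_toReal hV.ne_top ENNReal.one_ne_top).2 hV
  simpa using this

/-- Second moments of the normalized path lengths are bounded, from exponential moments at `±θ`
with `θ` of order `1/n`. -/
lemma exists_lintegral_normPath_sq_le (hs : IsAdmissible b s s₀ s₁) (hν : IsSplitLaw ν)
    (hV : ν {v | ∃ i, v i = 1} < 1) : ∃ B : ℝ, 0 < B ∧ ∀ {Q : Measure (Env b)}, IsEnvLaw ν Q →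
      ∀ n, ∫⁻ W, ENNReal.ofReal (normPath s s₀ s₁ ν n W ^ 2) ∂Q ≤ ENNReal.ofReal B := by
  obtain ⟨t, ht, htp⟩ := exists_pos_exp_mul_lt_one (t := 0)
    (p := (ν {v | ∃ i, v i = 1}).toReal) (by simpa using toReal_lt_one hV)
  obtain ⟨K, hK, n₀, H⟩ := exists_lintegral_exp_path_le hs hν hV (neg_nonpos.2 ht.le) ht.le htp
  set N : ℝ := n₀ + 1 with hN
  have hN0 : 0 < N := by positivity
  refine ⟨2 * (N / t) ^ 2 * (2 * Real.exp (K * t ^ 2)), by positivity, fun {Q} hQ n => ?_⟩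
  rcases Nat.eq_zero_or_pos n with rfl | hn
  · simp [normPath]
  have hn0 : (0 : ℝ) < n := by exact_mod_cast hn
  have hm0 : (0 : ℝ) < (max n n₀ : ℕ) := by exact_mod_cast lt_max_of_lt_left hn
  have hnm : (n : ℝ) ≤ (max n n₀ : ℕ) := by exact_mod_cast le_max_left _ _
  have hmN : ((max n n₀ : ℕ) : ℝ) ≤ N * n := by
    rw [Nat.cast_max, max_le_iff, hN]
    have : (1 : ℝ) ≤ n := by exact_mod_cast hn
    have h0 : (0 : ℝ) ≤ n₀ := Nat.cast_nonneg _
    constructor <;> nlinarith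
  set θ := t / (max n n₀ : ℕ) with hθ
  have hθ0 : 0 < θ := div_pos ht hm0
  have hθm : θ * (max n n₀ : ℕ) = t := div_mul_cancel₀ _ hm0.ne'
  have hθn : θ * n ≤ t := hθm ▸ mul_le_mul_of_nonneg_left hnm hθ0.le
  have hθN : t ≤ N * (θ * n) := by
    rw [← hθm]
    calc θ * (max n n₀ : ℕ) ≤ θ * (N * n) := mul_le_mul_of_nonneg_left hmN hθ0.le
      _ = N * (θ * n) := by ring
  have hKθ : K * θ ^ 2 * n ^ 2 ≤ K * t ^ 2 := by
    rw [mul_assoc, ← mul_pow]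
    exact mul_le_mul_of_nonneg_left (pow_le_pow_left₀ (by positivity) hθn 2) hK
  have hp1 := H hQ n θ (by rw [hθm]; linarith) hθm.le
  have hp2 := H hQ n (-θ) (by rw [neg_mul, hθm]) (by rw [neg_mul, hθm]; linarith)
  rw [neg_sq] at hp2
  set y : Env b → ℝ := fun W => path s s₀ s₁ W n - meanPath s s₀ s₁ ν n with hy
  have hym : Measurable y := (measurable_path_apply n).sub_const _
  -- this rests on `x ^ 2 ≤ 2 * (exp x + exp (-x))`
  have hpt : ∀ W, normPath s s₀ s₁ ν n W ^ 2
      ≤ 2 * (N / t) ^ 2 * (Real.exp (θ * y W) + Real.exp (-θ * y W)) := by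
    intro W
    have h1 : normPath s s₀ s₁ ν n W ^ 2 ≤ (N / t) ^ 2 * (θ * y W) ^ 2 := by
      have h2 : normPath s s₀ s₁ ν n W = y W / n := rfl
      rw [← mul_pow, h2, sq_le_sq, abs_mul, abs_mul, abs_div, abs_of_pos hn0, abs_of_pos hθ0,
        abs_of_pos (div_pos hN0 ht), div_le_iff₀ hn0]
      have h3 : 1 ≤ N / t * (θ * n) := by
        rw [div_mul_eq_mul_div, one_le_div ht]; exact hθN
      calc |y W| = 1 * |y W| := (one_mul _).symm
        _ ≤ N / t * (θ * n) * |y W| := mul_le_mul_of_nonneg_right h3 (abs_nonneg _)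
        _ = _ := by ring
    rw [mul_comm 2, mul_assoc]
    refine h1.trans (mul_le_mul_of_nonneg_left ?_ (by positivity))
    set x := θ * y W with hx
    rw [neg_mul, ← hx]
    have hp1 := Real.exp_pos x
    have hp2 := Real.exp_pos (-x)
    rcases le_total 0 x with h | h
    · have := Real.quadratic_le_exp_of_nonneg h
      linarith
    · have := Real.quadratic_le_exp_of_nonneg (neg_nonneg.2 h)
      rw [neg_sq] at this
      linarith
  refine (lintegral_mono fun W => ENNReal.ofReal_le_ofReal (hpt W)).trans ?_
  simp only [ENNReal.ofReal_mul (by positivity : 0 ≤ 2 * (N / t) ^ 2),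
    ENNReal.ofReal_add (Real.exp_pos _).le (Real.exp_pos _).le]
  rw [lintegral_const_mul _ (by fun_prop), lintegral_add_left (by fun_prop)]
  refine mul_le_mul_right ?_ _
  rw [two_mul, ENNReal.ofReal_add (Real.exp_pos _).le (Real.exp_pos _).le]
  exact add_le_add (hp1.trans (ENNReal.ofReal_le_ofReal (Real.exp_le_exp.2 hKθ)))
    (hp2.trans (ENNReal.ofReal_le_ofReal (Real.exp_le_exp.2 hKθ)))

lemma IsEnvLaw.memLp_normPath (hs : IsAdmissible b s s₀ s₁) (hν : IsSplitLaw ν)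
    (hV : ν {v | ∃ i, v i = 1} < 1) {Q : Measure (Env b)} (hQ : IsEnvLaw ν Q) (n : ℕ) :
    MemLp (normPath s s₀ s₁ ν n) 2 Q := by
  obtain ⟨B, _, H⟩ := exists_lintegral_normPath_sq_le hs hν hV
  exact memLp_two_of_lintegral_sq (measurable_normPath_apply n)
    ((H hQ n).trans_lt ENNReal.ofReal_lt_top)

lemma IsEnvLaw.integrable_path (hs : IsAdmissible b s s₀ s₁) (hν : IsSplitLaw ν)
    (hV : ν {v | ∃ i, v i = 1} < 1) {Q : Measure (Env b)} (hQ : IsEnvLaw ν Q) (n : ℕ) :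
    Integrable (fun W => path s s₀ s₁ W n) Q := by
  refine ⟨(measurable_path_apply n).aestronglyMeasurable, ?_⟩
  rw [hasFiniteIntegral_iff_ofReal (Eventually.of_forall fun W => path_nonneg W n),
    hQ.lintegral_path hs hν hV]
  exact ENNReal.ofReal_lt_top

lemma IsEnvLaw.integral_normPath (hs : IsAdmissible b s s₀ s₁) (hν : IsSplitLaw ν)
    (hV : ν {v | ∃ i, v i = 1} < 1) {Q : Measure (Env b)} (hQ : IsEnvLaw ν Q) (n : ℕ) :
    ∫ W, normPath s s₀ s₁ ν n W ∂Q = 0 := by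
  have hP := hQ.isProbabilityMeasure hν
  simp only [normPath]
  rw [integral_div, integral_sub (hQ.integrable_path hs hν hV n) (integrable_const _),
    hQ.integral_path hs hν hV]
  simp

lemma IsEnvLaw.ae_normPath_eq (hs : IsAdmissible b s s₀ s₁) (hν : IsSplitLaw ν)
    (hV : ν {v | ∃ i, v i = 1} < 1) {Q : Measure (Env b)} (hQ : IsEnvLaw ν Q) {n : ℕ}
    (hn : s < n) : ∀ᵐ W ∂Q, normPath s s₀ s₁ ν n W
      = ∑ i, (((W []).2 (n - s₀ - b * s₁) i + s₁ : ℕ) : ℝ) / n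
        * normPath s s₀ s₁ ν ((W []).2 (n - s₀ - b * s₁) i + s₁) (SplitTree.subtree i W)
        + toll s s₀ s₁ ν n ((W []).2 (n - s₀ - b * s₁)) := by
  filter_upwards [hQ.ae_path_eq hs hν hV hn] with W hW
  simp only [div_mul_eq_mul_div, natCast_mul_normPath]
  rw [normPath, hW, toll, ← Finset.sum_div, ← add_div]
  congr 1
  rw [Finset.sum_sub_distrib, Finset.sum_add_distrib, Finset.sum_add_distrib]
  ring

/-- One step of the contraction: the distance to the limit at the root, in terms of the distances
in the subtrees. -/
lemma IsEnvLaw.integral_sq_sub_eq (hs : IsAdmissible b s s₀ s₁) (hν : IsSplitLaw ν)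
    (hV : ν {v | ∃ i, v i = 1} < 1) {Q : Measure (Env b)} (hQ : IsEnvLaw ν Q) {n : ℕ}
    (hn : s < n) : ∫ W, (normPath s s₀ s₁ ν n W - limitVar ν W) ^ 2 ∂Q
      = ∫ p, (∑ i, ∫ W, (((p.2 i + s₁ : ℕ) : ℝ) / n * normPath s s₀ s₁ ν (p.2 i + s₁) W
        - p.1 i * limitVar ν W) ^ 2 ∂Q.map (SplitTree.subtree i)
        + (toll s s₀ s₁ ν n p.2 - cost ν p.1) ^ 2) ∂throwLaw ν (n - s₀ - b * s₁) := by
  have heq : ∀ᵐ W ∂Q, normPath s s₀ s₁ ν n W - limitVar ν W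
      = ∑ i, ((((W []).2 (n - s₀ - b * s₁) i + s₁ : ℕ) : ℝ) / n
        * normPath s s₀ s₁ ν ((W []).2 (n - s₀ - b * s₁) i + s₁) (SplitTree.subtree i W)
        - (W []).1 i * limitVar ν (SplitTree.subtree i W))
        + (toll s s₀ s₁ ν n ((W []).2 (n - s₀ - b * s₁)) - cost ν (W []).1) := by
    filter_upwards [hQ.ae_normPath_eq hs hν hV hn, hQ.ae_limitVar_eq hν hV] with W h1 h2
    rw [h1, h2, Finset.sum_sub_distrib]
    ring
  have hmem := ((hQ.memLp_normPath hs hν hV n).sub (hQ.memLp_limitVar hν hV)).ae_eq heq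
  have hm : ∀ i, Measurable fun q : ((Fin b → ℝ) × (Fin b → ℕ)) × Env b =>
      ((q.1.2 i + s₁ : ℕ) : ℝ) / n * normPath s s₀ s₁ ν (q.1.2 i + s₁) q.2
        - q.1.1 i * limitVar ν q.2 := by
    intro i
    have h1 : Measurable fun q : ((Fin b → ℝ) × (Fin b → ℕ)) × Env b =>
      (q.1.2 i + s₁, q.2) := by fun_prop
    have h2 := (measurable_normPath (s := s) (s₀ := s₀) (s₁ := s₁) (ν := ν)).comp h1
    have h3 : Measurable fun q : ((Fin b → ℝ) × (Fin b → ℕ)) × Env b =>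
      ((q.1.2 i + s₁ : ℕ) : ℝ) := measurable_from_top.comp h1.fst
    exact ((h3.div_const _).mul h2).sub (measurable_mul_apply measurable_limitVar i)
  rw [integral_congr_ae (heq.mono fun W hW => congrArg (· ^ 2) hW)]
  refine hQ.integral_sum_sq hν (n - s₀ - b * s₁) (Z := fun p i W =>
    ((p.2 i + s₁ : ℕ) : ℝ) / n * normPath s s₀ s₁ ν (p.2 i + s₁) W - p.1 i * limitVar ν W)
    (c := fun p => toll s s₀ s₁ ν n p.2 - cost ν p.1) hm ?_ (Eventually.of_forall fun p i => ?_) hmem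
  · exact (isTame_throw (b := b) (toll s s₀ s₁ ν n)).measurable.sub
      (measurable_cost.comp measurable_fst)
  · have h1 := ((hQ.subtree hν i).memLp_normPath hs hν hV (p.2 i + s₁)).const_mul
      (((p.2 i + s₁ : ℕ) : ℝ) / n)
    have h2 := ((hQ.subtree hν i).memLp_limitVar hν hV).const_mul (p.1 i)
    have hPi := (hQ.subtree hν i).isProbabilityMeasure hν
    refine ⟨h1.sub h2, ?_⟩
    rw [integral_sub (h1.integrable one_le_two) (h2.integrable one_le_two), integral_const_mul,
      integral_const_mul, (hQ.subtree hν i).integral_normPath hs hν hV,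
      (hQ.subtree hν i).integral_limitVar hν hV]
    simp

/-- The inequality of Young for `a y - v x = a (y - x) + (a - v) x`. -/
lemma sq_mul_add_mul_le {ε : ℝ} (hε : 0 < ε) (a v x y : ℝ) :
    (a * y - v * x) ^ 2 ≤ (1 + ε) * (a ^ 2 * (y - x) ^ 2) + (1 + ε⁻¹) * ((a - v) ^ 2 * x ^ 2) := by
  have h1 : 0 ≤ ε⁻¹ * (ε * (a * (y - x)) - (a - v) * x) ^ 2 := by positivity
  have h2 : ε⁻¹ * (ε * (a * (y - x)) - (a - v) * x) ^ 2
      = ε * (a ^ 2 * (y - x) ^ 2) + ε⁻¹ * ((a - v) ^ 2 * x ^ 2)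
        - 2 * (a * (y - x)) * ((a - v) * x) := by
    field_simp
    ring
  nlinarith

/-- The normalized path lengths converge to the limit in mean square, uniformly over the laws of
the environment. -/
lemma exists_integral_sq_sub_le (hs : IsAdmissible b s s₀ s₁) (hν : IsSplitLaw ν)
    (hV : ν {v | ∃ i, v i = 1} < 1) {δ : ℝ} (hδ : 0 < δ) : ∃ N, ∀ n ≥ N,
      ∀ {Q : Measure (Env b)}, IsEnvLaw ν Q →
        ∫ W, (normPath s s₀ s₁ ν n W - limitVar ν W) ^ 2 ∂Q ≤ δ := by
  have hρ := integral_sum_sq_lt_one hν hV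
  have hρ0 := integral_sum_sq_nonneg (ν := ν)
  set r := 1 - (1 - ∫ v, ∑ i, v i ^ 2 ∂ν) / 4 with hr
  have hr0 : 0 < r := by rw [hr]; linarith
  have hr1 : r < 1 := by rw [hr]; linarith
  obtain ⟨B₁, hB₁, H₁⟩ := exists_lintegral_normPath_sq_le hs hν hV
  set B₂ := (1 + (meanLog ν)⁻¹ * b) ^ 2 / (1 - ∫ v, ∑ i, v i ^ 2 ∂ν) with hB₂
  have hB₂0 : 0 ≤ B₂ := div_nonneg (sq_nonneg _) (by linarith)
  set A := 2 * B₁ + 2 * B₂ with hA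
  have hA0 : 0 < A := by positivity
  -- the factor gained in each step, after `ε` has been spent on the cross terms
  set ε := (1 - r) / (2 * r) with hε
  have hε0 : 0 < ε := div_pos (by linarith) (by linarith)
  have hεr : (1 + ε) * r = (1 + r) / 2 := by rw [hε]; field_simp; ring
  set q := (3 + r) / 4 with hq
  have hq0 : 0 < q := by rw [hq]; linarith
  have hq1 : q < 1 := by rw [hq]; linarith
  have hbase : ∀ n, ∀ {Q : Measure (Env b)}, IsEnvLaw ν Q →
      ∫ W, (normPath s s₀ s₁ ν n W - limitVar ν W) ^ 2 ∂Q ≤ A := by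
    intro n Q hQ
    have hY := hQ.memLp_normPath hs hν hV n
    have hX := hQ.memLp_limitVar hν hV
    have h1 : ∫ W, normPath s s₀ s₁ ν n W ^ 2 ∂Q ≤ B₁ := by
      have h := H₁ hQ n
      rw [← ofReal_integral_eq_lintegral_ofReal hY.integrable_sq
        (Eventually.of_forall fun _ => sq_nonneg _)] at h
      exact (ENNReal.ofReal_le_ofReal_iff hB₁.le).1 h
    have h2 := hQ.integral_limitVar_sq_le hν hV
    calc ∫ W, (normPath s s₀ s₁ ν n W - limitVar ν W) ^ 2 ∂Q
        ≤ ∫ W, (2 * normPath s s₀ s₁ ν n W ^ 2 + 2 * limitVar ν W ^ 2) ∂Q := by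
          refine integral_mono (hY.sub hX).integrable_sq
            ((hY.integrable_sq.const_mul 2).add (hX.integrable_sq.const_mul 2)) fun W => ?_
          have := sq_nonneg (normPath s s₀ s₁ ν n W + limitVar ν W)
          nlinarith
      _ ≤ A := by
          rw [integral_add (hY.integrable_sq.const_mul 2) (hX.integrable_sq.const_mul 2),
            integral_const_mul, integral_const_mul]
          linarith
  -- by induction, the distance is eventually at most `A q ^ j`; children smaller than the previous
  -- threshold `N` contribute `O(N² / n²)`
  have hiter : ∀ j : ℕ, ∃ N, ∀ n ≥ N, ∀ {Q : Measure (Env b)}, IsEnvLaw ν Q →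
      ∫ W, (normPath s s₀ s₁ ν n W - limitVar ν W) ^ 2 ∂Q ≤ A * q ^ j := by
    intro j
    induction j with
    | zero => exact ⟨0, fun n _ Q hQ => by rw [pow_zero, mul_one]; exact hbase n hQ⟩
    | succ j ih =>
      obtain ⟨N, hN⟩ := ih
      set K₀ : ℝ := b * (2 + 2 * (s₁ + (s₀ + b * s₁)) ^ 2) with hK₀
      have hrest : Tendsto (fun n : ℕ => (1 + ε) * (A * (b * N ^ 2)) * ((n : ℝ) ^ 2)⁻¹
          + (1 + ε⁻¹) * B₂ * (K₀ / n)
          + ∫ p, (toll s s₀ s₁ ν n p.2 - cost ν p.1) ^ 2 ∂throwLaw ν (n - s₀ - b * s₁)) atTop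
          (𝓝 0) := by
        have h1 : Tendsto (fun n : ℕ => ((n : ℝ) ^ 2)⁻¹) atTop (𝓝 0) :=
          tendsto_inv_atTop_zero.comp
            ((tendsto_pow_atTop two_ne_zero).comp tendsto_natCast_atTop_atTop)
        have h2 := ((h1.const_mul ((1 + ε) * (A * (b * N ^ 2)))).add
          ((tendsto_const_div_atTop_nhds_zero_nat K₀).const_mul ((1 + ε⁻¹) * B₂))).add
          (tendsto_integral_toll_sub_cost_sq hs hν hV)
        simpa using h2
      have hgap : 0 < A * q ^ j * (q - (1 + r) / 2) :=
        mul_pos (by positivity) (by rw [hq]; linarith)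
      obtain ⟨N', hN'⟩ := eventually_atTop.1 ((hrest.eventually_lt_const hgap).and
        (eventually_gt_atTop s))
      refine ⟨N', fun n hn Q hQ => ?_⟩
      obtain ⟨hn1, hns⟩ := hN' n hn
      have hn0 : (0 : ℝ) < n := by exact_mod_cast (by omega : 0 < n)
      rw [hQ.integral_sq_sub_eq hs hν hV hns]
      set m := n - s₀ - b * s₁ with hm
      have hP := isProbabilityMeasure_throwLaw hν m
      have t1 : IsTame fun p : (Fin b → ℝ) × (Fin b → ℕ) => ∑ i, ((p.2 i + s₁ : ℕ) : ℝ) ^ 2 :=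
        isTame_throw fun k => ∑ i, ((k i + s₁ : ℕ) : ℝ) ^ 2
      have t2 : IsTame fun p : (Fin b → ℝ) × (Fin b → ℕ) =>
          ∑ i, (((p.2 i + s₁ : ℕ) : ℝ) / n - p.1 i) ^ 2 := IsTame.sum fun i =>
        ((isTame_throw fun k => ((k i + s₁ : ℕ) : ℝ) / n).sub (isTame_coord i)).pow 2
      have t3 : IsTame fun p : (Fin b → ℝ) × (Fin b → ℕ) =>
          (toll s s₀ s₁ ν n p.2 - cost ν p.1) ^ 2 :=
        ((isTame_throw (toll s s₀ s₁ ν n)).sub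
          (isTame_vector measurable_cost (abs_cost_le hν hV))).pow 2
      have t4 : IsTame fun p : (Fin b → ℝ) × (Fin b → ℕ) =>
          (1 + ε) * (A * q ^ j) * ((n : ℝ) ^ 2)⁻¹ * ∑ i, ((p.2 i + s₁ : ℕ) : ℝ) ^ 2
          + (1 + ε) * (A * (b * N ^ 2)) * ((n : ℝ) ^ 2)⁻¹ :=
        (t1.const_mul _).add (isTame_const _)
      have t5 := t4.add (t2.const_mul ((1 + ε⁻¹) * B₂))
      have hle : ∫ p, (∑ i, ∫ W, (((p.2 i + s₁ : ℕ) : ℝ) / n * normPath s s₀ s₁ ν (p.2 i + s₁) W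
          - p.1 i * limitVar ν W) ^ 2 ∂Q.map (SplitTree.subtree i)
          + (toll s s₀ s₁ ν n p.2 - cost ν p.1) ^ 2) ∂throwLaw ν m
          ≤ ∫ p, ((1 + ε) * (A * q ^ j) * ((n : ℝ) ^ 2)⁻¹ * ∑ i, ((p.2 i + s₁ : ℕ) : ℝ) ^ 2
          + (1 + ε) * (A * (b * N ^ 2)) * ((n : ℝ) ^ 2)⁻¹
          + (1 + ε⁻¹) * B₂ * ∑ i, (((p.2 i + s₁ : ℕ) : ℝ) / n - p.1 i) ^ 2
          + (toll s s₀ s₁ ν n p.2 - cost ν p.1) ^ 2) ∂throwLaw ν m := by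
        refine integral_mono_of_nonneg (Eventually.of_forall fun p => add_nonneg
          (Finset.sum_nonneg fun i _ => integral_nonneg fun W => sq_nonneg _) (sq_nonneg _))
          ((t5.add t3).integrable hν m) (Eventually.of_forall fun p => ?_)
        refine add_le_add ?_ le_rfl
        have hi : ∀ i, ∫ W, (((p.2 i + s₁ : ℕ) : ℝ) / n * normPath s s₀ s₁ ν (p.2 i + s₁) W
            - p.1 i * limitVar ν W) ^ 2 ∂Q.map (SplitTree.subtree i)
            ≤ (1 + ε) * (A * q ^ j) * ((n : ℝ) ^ 2)⁻¹ * ((p.2 i + s₁ : ℕ) : ℝ) ^ 2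
            + (1 + ε) * (A * N ^ 2) * ((n : ℝ) ^ 2)⁻¹
            + (1 + ε⁻¹) * B₂ * (((p.2 i + s₁ : ℕ) : ℝ) / n - p.1 i) ^ 2 := by
          intro i
          have hQi := hQ.subtree hν i
          have hY := hQi.memLp_normPath hs hν hV (p.2 i + s₁)
          have hX := hQi.memLp_limitVar hν hV
          have hD : Integrable (fun W => (normPath s s₀ s₁ ν (p.2 i + s₁) W - limitVar ν W) ^ 2)
              (Q.map (SplitTree.subtree i)) := (hY.sub hX).integrable_sq
          have e1 := integral_mono (μ := Q.map (SplitTree.subtree i))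
            ((hY.const_mul (((p.2 i + s₁ : ℕ) : ℝ) / n)).sub (hX.const_mul (p.1 i))).integrable_sq
            (((hD.const_mul _).const_mul _).add
              ((hX.integrable_sq.const_mul _).const_mul _))
            (fun W => sq_mul_add_mul_le hε0 (((p.2 i + s₁ : ℕ) : ℝ) / n) (p.1 i) (limitVar ν W)
              (normPath s s₀ s₁ ν (p.2 i + s₁) W))
          refine e1.trans ?_
          simp only [Pi.add_apply]
          rw [integral_add ((hD.const_mul _).const_mul _)
              ((hX.integrable_sq.const_mul _).const_mul _)]
          simp only [integral_const_mul]
          refine add_le_add ?_ ?_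
          · have e2 : ((p.2 i + s₁ : ℕ) : ℝ) ^ 2 * ∫ W, (normPath s s₀ s₁ ν (p.2 i + s₁) W
                - limitVar ν W) ^ 2 ∂Q.map (SplitTree.subtree i)
                ≤ A * q ^ j * ((p.2 i + s₁ : ℕ) : ℝ) ^ 2 + A * N ^ 2 := by
              rcases le_or_gt N (p.2 i + s₁) with h | h
              · have := mul_le_mul_of_nonneg_left (hN _ h hQi)
                  (sq_nonneg ((p.2 i + s₁ : ℕ) : ℝ))
                have h0 : 0 ≤ A * (N : ℝ) ^ 2 := by positivity
                linarith
              · have h1 := mul_le_mul_of_nonneg_left (hbase (p.2 i + s₁) hQi)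
                  (sq_nonneg ((p.2 i + s₁ : ℕ) : ℝ))
                have h2 : ((p.2 i + s₁ : ℕ) : ℝ) ^ 2 ≤ (N : ℝ) ^ 2 :=
                  pow_le_pow_left₀ (Nat.cast_nonneg _) (by exact_mod_cast h.le) 2
                have h3 := mul_le_mul_of_nonneg_left h2 hA0.le
                have h0 : 0 ≤ A * q ^ j * ((p.2 i + s₁ : ℕ) : ℝ) ^ 2 := by positivity
                linarith
            have e3 := mul_le_mul_of_nonneg_left e2
              (by positivity : 0 ≤ (1 + ε) * ((n : ℝ) ^ 2)⁻¹)
            rw [div_pow, div_eq_mul_inv]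
            refine le_trans (le_of_eq ?_) (e3.trans (le_of_eq ?_)) <;> ring
          · rw [mul_assoc]
            refine mul_le_mul_of_nonneg_left ?_ (by positivity)
            rw [mul_comm B₂]
            exact mul_le_mul_of_nonneg_left (hQi.integral_limitVar_sq_le hν hV) (sq_nonneg _)
        refine (Finset.sum_le_sum fun i _ => hi i).trans (le_of_eq ?_)
        rw [Finset.sum_add_distrib, Finset.sum_add_distrib, Finset.sum_const, Finset.card_univ,
          Fintype.card_fin, nsmul_eq_mul, ← Finset.mul_sum, ← Finset.mul_sum]
        ring
      refine hle.trans ?_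
      rw [t5.integral_add hν t3, t4.integral_add hν (t2.const_mul _),
        (t1.const_mul _).integral_add hν (isTame_const _), integral_const, probReal_univ,
        one_smul, integral_const_mul, integral_const_mul, pow_succ q j]
      have e1 := integral_child_sq_le hs hν hV hns
      have e2 := integral_child_sub_sq_le hs hν hns
      rw [← hm, ← hr] at e1
      rw [← hm, ← hK₀] at e2
      have e3 := mul_le_mul_of_nonneg_left e1
        (by positivity : 0 ≤ (1 + ε) * (A * q ^ j) * ((n : ℝ) ^ 2)⁻¹)
      have e4 := mul_le_mul_of_nonneg_left e2 (by positivity : 0 ≤ (1 + ε⁻¹) * B₂)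
      have e5 : (1 + ε) * (A * q ^ j) * ((n : ℝ) ^ 2)⁻¹ * (r * (n : ℝ) ^ 2)
          = A * q ^ j * ((1 + r) / 2) := by
        rw [← hεr]
        field_simp
      rw [e5] at e3
      have e6 : A * q ^ j * (q - (1 + r) / 2) = A * (q ^ j * q) - A * q ^ j * ((1 + r) / 2) := by
        ring
      rw [e6] at hn1
      linarith
  have hlim : Tendsto (fun j : ℕ => A * q ^ j) atTop (𝓝 (A * 0)) :=
    (tendsto_pow_atTop_nhds_zero_of_lt_one hq0.le hq1).const_mul A
  rw [mul_zero] at hlim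
  obtain ⟨j, hj⟩ := (hlim.eventually_lt_const hδ).exists
  obtain ⟨N, hN⟩ := hiter j
  exact ⟨N, fun n hn Q hQ => (hN n hn hQ).trans hj.le⟩

end

/-! ### Uniqueness of the solution of the fixed point equation -/

section

variable {b : ℕ} {ν : Measure (Fin b → ℝ)}

/-- The law of `∑ V_k X⁽ᵏ⁾ + C(𝒱)` for independent `X⁽ᵏ⁾` with laws `ψ k`. -/
def mixMap {b : ℕ} (ν : Measure (Fin b → ℝ)) (ψ : Fin b → Measure ℝ) : Measure ℝ :=
  (ν.prod (Measure.pi ψ)).map fun p => ∑ k, p.1 k * p.2 k + cost ν p.1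

lemma measurable_sum_mul_add_cost : Measurable fun p : (Fin b → ℝ) × (Fin b → ℝ) =>
    ∑ k, p.1 k * p.2 k + cost ν p.1 :=
  Measurable.add (by fun_prop) (measurable_cost.comp measurable_fst)

lemma norm_exp_sub_le (x : ℝ) :
    ‖Complex.exp (x * Complex.I) - 1 - x * Complex.I‖ ≤ 3 * x ^ 2 := by
  have hx : ‖(x : ℂ) * Complex.I‖ = |x| := by simp
  rcases le_total |x| 1 with h | h
  · refine (Complex.norm_exp_sub_one_sub_id_le (hx.le.trans h)).trans ?_
    rw [hx, sq_abs]
    nlinarith [sq_nonneg x]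
  · have h1 : ‖Complex.exp (x * Complex.I) - 1 - x * Complex.I‖ ≤ 1 + 1 + |x| := by
      refine (norm_sub_le _ _).trans (add_le_add ((norm_sub_le _ _).trans ?_) hx.le)
      rw [Complex.norm_exp_ofReal_mul_I, norm_one]
    have h2 : |x| ≤ x ^ 2 := by rw [← sq_abs]; nlinarith
    have h3 : 1 ≤ x ^ 2 := h.trans h2
    linarith

lemma norm_charFun_sub_one_le {φ : Measure ℝ} [IsProbabilityMeasure φ]
    (h2 : MemLp (fun x : ℝ => x) 2 φ) (h0 : ∫ x, x ∂φ = 0) {B : ℝ} (hB : ∫ x, x ^ 2 ∂φ ≤ B) (t : ℝ) :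
    ‖charFun φ t - 1‖ ≤ 3 * B * t ^ 2 := by
  have hi : Integrable (fun x : ℝ => Complex.exp (t * x * Complex.I)) φ := by
    refine Integrable.of_bound (by fun_prop) 1 (Eventually.of_forall fun x => ?_)
    rw [← Complex.ofReal_mul, Complex.norm_exp_ofReal_mul_I]
  have hx : Integrable (fun x : ℝ => (t * x * Complex.I : ℂ)) φ :=
    ((h2.integrable one_le_two).ofReal.const_mul (t : ℂ)).mul_const Complex.I
  have h1 : charFun φ t - 1 = ∫ x : ℝ, (Complex.exp ((t * x : ℝ) * Complex.I) - 1
      - (t * x : ℝ) * Complex.I) ∂φ := by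
    push_cast
    have e1 : Integrable (fun x : ℝ => Complex.exp (t * x * Complex.I) - 1) φ :=
      hi.sub (integrable_const _)
    have e2 : ∫ x : ℝ, (t * x * Complex.I : ℂ) ∂φ = 0 := by
      have e3 : ∫ x : ℝ, (x : ℂ) ∂φ = ((∫ x, x ∂φ : ℝ) : ℂ) := integral_ofReal
      rw [integral_mul_const, integral_const_mul, e3, h0]
      simp
    rw [charFun_apply_real, integral_sub e1 hx, e2, integral_sub hi (integrable_const _)]
    simp
  rw [h1]
  refine (norm_integral_le_of_norm_le (h2.integrable_sq.const_mul (3 * t ^ 2))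
    (Eventually.of_forall fun x => (norm_exp_sub_le (t * x)).trans_eq ?_)).trans ?_
  · ring
  · rw [integral_const_mul]
    nlinarith [mul_le_mul_of_nonneg_left hB (sq_nonneg t)]

/-- Conditionally on the split vector, the characteristic function is a product. -/
lemma charFun_mixMap (hν : IsSplitLaw ν) (ψ : Fin b → Measure ℝ) [∀ k, IsProbabilityMeasure (ψ k)]
    (t : ℝ) : charFun (mixMap ν ψ) t = ∫ v, Complex.exp (t * cost ν v * Complex.I)
      * ∏ k, charFun (ψ k) (t * v k) ∂ν := by
  have hP := hν.isProbabilityMeasure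
  rw [charFun_apply_real, mixMap, integral_map measurable_sum_mul_add_cost.aemeasurable
    (by fun_prop)]
  have hm := measurable_sum_mul_add_cost (ν := ν)
  have hi : Integrable (fun p : (Fin b → ℝ) × (Fin b → ℝ) => Complex.exp
      (t * (∑ k, p.1 k * p.2 k + cost ν p.1 : ℝ) * Complex.I)) (ν.prod (Measure.pi ψ)) := by
    refine Integrable.of_bound (((Complex.measurable_ofReal.comp hm).const_mul (t : ℂ)).mul_const
      Complex.I).cexp.aestronglyMeasurable 1 (Eventually.of_forall fun x => ?_)
    rw [← Complex.ofReal_mul, Complex.norm_exp_ofReal_mul_I]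
  rw [integral_prod _ hi]
  refine integral_congr_ae (Eventually.of_forall fun v => ?_)
  simp only [charFun_apply_real]
  rw [← integral_fintype_prod_eq_prod (f := fun k (x : ℝ) =>
    Complex.exp ((t * v k : ℝ) * x * Complex.I)), ← integral_const_mul]
  refine integral_congr_ae (Eventually.of_forall fun x => ?_)
  simp only
  rw [← Complex.exp_sum, ← Complex.exp_add]
  congr 1
  push_cast
  rw [mul_add, add_mul, add_comm, Finset.mul_sum, Finset.sum_mul]
  congr 1
  exact Finset.sum_congr rfl fun k _ => by ring

lemma norm_prod_sub_prod_le {ι : Type*} (s : Finset ι) {x y : ι → ℂ} (hx : ∀ i, ‖x i‖ ≤ 1)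
    (hy : ∀ i, ‖y i‖ ≤ 1) : ‖∏ i ∈ s, x i - ∏ i ∈ s, y i‖ ≤ ∑ i ∈ s, ‖x i - y i‖ := by
  classical
  induction s using Finset.induction_on with
  | empty => simp
  | insert i s hi ih =>
    rw [Finset.prod_insert hi, Finset.prod_insert hi, Finset.sum_insert hi]
    have h1 : x i * ∏ i ∈ s, x i - y i * ∏ i ∈ s, y i
        = (x i - y i) * ∏ i ∈ s, x i + y i * (∏ i ∈ s, x i - ∏ i ∈ s, y i) := by ring
    have h2 : ‖∏ i ∈ s, x i‖ ≤ 1 := by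
      rw [norm_prod]
      exact Finset.prod_le_one (fun i _ => norm_nonneg _) fun i _ => hx i
    rw [h1]
    refine (norm_add_le _ _).trans (add_le_add ?_ ?_)
    · rw [norm_mul]
      exact mul_le_of_le_one_right (norm_nonneg _) h2
    · rw [norm_mul]
      exact (mul_le_of_le_one_left (norm_nonneg _) (hy i)).trans ih

/-- A class of centred laws with bounded second moments that is closed under passing to the laws on
the right-hand side of the fixed point equation has at most one element: one step of the equation
contracts `|charFun φ t - charFun φ' t| / t ^ 2` by the factor `E ∑ V_i ^ 2 < 1`. -/
lemma eq_of_mixMap_class (hν : IsSplitLaw ν) (hV : ν {v | ∃ i, v i = 1} < 1)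
    {𝒞 : Set (Measure ℝ)} {B : ℝ}
    (hprob : ∀ φ ∈ 𝒞, IsProbabilityMeasure φ)
    (hmom : ∀ φ ∈ 𝒞, MemLp (fun x : ℝ => x) 2 φ ∧ ∫ x, x ∂φ = 0 ∧ ∫ x, x ^ 2 ∂φ ≤ B)
    (hmix : ∀ φ ∈ 𝒞, ∃ ψ : Fin b → Measure ℝ, (∀ k, ψ k ∈ 𝒞) ∧ φ = mixMap ν ψ)
    {φ φ' : Measure ℝ} (hφ : φ ∈ 𝒞) (hφ' : φ' ∈ 𝒞) : φ = φ' := by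
  have hP := hν.isProbabilityMeasure
  have hρ := integral_sum_sq_lt_one hν hV
  have hρ0 := integral_sum_sq_nonneg (ν := ν)
  set ρ := ∫ v, ∑ i, v i ^ 2 ∂ν with hρd
  have hiter : ∀ j : ℕ, ∀ φ ∈ 𝒞, ∀ φ' ∈ 𝒞, ∀ t : ℝ,
      ‖charFun φ t - charFun φ' t‖ ≤ 6 * B * ρ ^ j * t ^ 2 := by
    intro j
    induction j with
    | zero =>
      intro φ hφ φ' hφ' t
      have := hprob φ hφ
      have := hprob φ' hφ'
      obtain ⟨a1, a2, a3⟩ := hmom φ hφ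
      obtain ⟨b1, b2, b3⟩ := hmom φ' hφ'
      have h1 := norm_charFun_sub_one_le a1 a2 a3 t
      have h2 := norm_charFun_sub_one_le b1 b2 b3 t
      rw [show charFun φ t - charFun φ' t = (charFun φ t - 1) - (charFun φ' t - 1) by ring]
      refine (norm_sub_le _ _).trans ((add_le_add h1 h2).trans_eq ?_)
      ring
    | succ j ih =>
      intro φ hφ φ' hφ' t
      obtain ⟨ψ, hψ, rfl⟩ := hmix φ hφ
      obtain ⟨ψ', hψ', rfl⟩ := hmix φ' hφ'
      have hp := fun k => hprob _ (hψ k)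
      have hp' := fun k => hprob _ (hψ' k)
      rw [charFun_mixMap hν, charFun_mixMap hν]
      have hint : ∀ χ : Fin b → Measure ℝ, (∀ k, IsProbabilityMeasure (χ k)) →
          Integrable (fun v => Complex.exp (t * cost ν v * Complex.I)
            * ∏ k, charFun (χ k) (t * v k)) ν := by
        intro χ hχ
        have hcm := measurable_cost (ν := ν)
        have hm : ∀ k, Measurable (charFun (χ k)) := fun k => continuous_charFun.measurable
        refine Integrable.of_bound (Measurable.aestronglyMeasurable ?_) 1
          (Eventually.of_forall fun v => ?_)
        · exact Measurable.mul (by fun_prop) (Finset.measurable_prod _ fun k _ =>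
            (hm k).comp (by fun_prop))
        · rw [norm_mul, ← Complex.ofReal_mul, Complex.norm_exp_ofReal_mul_I, one_mul, norm_prod]
          exact Finset.prod_le_one (fun i _ => norm_nonneg _) fun i _ => norm_charFun_le_one _
      rw [← integral_sub (hint ψ hp) (hint ψ' hp')]
      have hS : Integrable (fun v : Fin b → ℝ => ∑ i, v i ^ 2) ν :=
        integrable_vector hν (by fun_prop) abs_sum_sq_le
      refine (norm_integral_le_of_norm_le (hS.const_mul (6 * B * ρ ^ j * t ^ 2))
        (Eventually.of_forall fun v => ?_)).trans_eq ?_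
      · rw [← mul_sub, norm_mul, ← Complex.ofReal_mul, Complex.norm_exp_ofReal_mul_I, one_mul]
        refine (norm_prod_sub_prod_le _ (fun k => norm_charFun_le_one _)
          fun k => norm_charFun_le_one _).trans ?_
        rw [Finset.mul_sum]
        refine Finset.sum_le_sum fun k _ => (ih _ (hψ k) _ (hψ' k) _).trans_eq ?_
        ring
      · rw [integral_const_mul, ← hρd]
        ring
  have := hprob φ hφ
  have := hprob φ' hφ'
  refine Measure.ext_of_charFun (funext fun t => ?_)
  rw [← sub_eq_zero, ← norm_eq_zero]
  refine le_antisymm (ge_of_tendsto' (x := atTop) ?_ fun j => hiter j φ hφ φ' hφ' t) (norm_nonneg _)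
  have h := ((tendsto_pow_atTop_nhds_zero_of_lt_one hρ0 hρ).const_mul (6 * B)).mul_const (t ^ 2)
  simpa using h

lemma map_fst_throwLaw {Q : Measure (Env b)} (hQ : IsEnvLaw ν Q) (m : ℕ) :
    (throwLaw ν m).map Prod.fst = ν := by
  have h1 := IsSplitRandomness.map_throw hQ [] m
  rw [← h1, Measure.map_map measurable_fst (by fun_prop)]
  exact hQ.law_vector []

lemma IsEnvLaw.map_limitVar (hν : IsSplitLaw ν) (hV : ν {v | ∃ i, v i = 1} < 1)
    {Q : Measure (Env b)} (hQ : IsEnvLaw ν Q) : Q.map (limitVar ν)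
      = mixMap ν fun i => (Q.map (SplitTree.subtree i)).map (limitVar ν) := by
  have hPi := fun i => (hQ.subtree hν i).isProbabilityMeasure hν
  have hP := isProbabilityMeasure_throwLaw hν 0
  have hX := measurable_limitVar (ν := ν)
  have hsm : Measurable fun (W : Env b) i => SplitTree.subtree i W :=
    measurable_pi_iff.2 fun i => measurable_subtree i
  have hg : Measurable fun W : Env b => (((W []).1, (W []).2 0), fun i => SplitTree.subtree i W) :=
    Measurable.prodMk (by fun_prop) hsm
  have hXi : Measurable fun (T : Fin b → Env b) i => limitVar ν (T i) :=
    measurable_pi_iff.2 fun i => hX.comp (measurable_pi_apply i)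
  have hmap : ∀ i, IsProbabilityMeasure ((Q.map (SplitTree.subtree i)).map (limitVar ν)) :=
    fun i => Measure.isProbabilityMeasure_map hX.aemeasurable
  have h1 : ν.prod (Measure.pi fun i => (Q.map (SplitTree.subtree i)).map (limitVar ν))
      = Q.map (Prod.map Prod.fst (fun (T : Fin b → Env b) i => limitVar ν (T i))
        ∘ fun W => (((W []).1, (W []).2 0), fun i => SplitTree.subtree i W)) := by
    rw [← Measure.map_map (measurable_fst.prodMap hXi) hg, hQ.map_root_subtree hν 0,
      ← Measure.map_prod_map _ _ measurable_fst hXi, map_fst_throwLaw hQ 0,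
      Measure.pi_map_pi fun i => hX.aemeasurable]
  rw [Measure.map_congr (hQ.ae_limitVar_eq hν hV), mixMap, h1,
    Measure.map_map measurable_sum_mul_add_cost ((measurable_fst.prodMap hXi).comp hg)]
  rfl

lemma integral_map_limitVar {Q : Measure (Env b)} {f : ℝ → ℝ} (hf : Measurable f) :
    ∫ x, f x ∂Q.map (limitVar ν) = ∫ W, f (limitVar ν W) ∂Q :=
  integral_map measurable_limitVar.aemeasurable hf.aestronglyMeasurable

lemma IsEnvLaw.moments_map_limitVar (hν : IsSplitLaw ν) (hV : ν {v | ∃ i, v i = 1} < 1)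
    {Q : Measure (Env b)} (hQ : IsEnvLaw ν Q) : MemLp (fun x : ℝ => x) 2 (Q.map (limitVar ν)) ∧
      ∫ x, x ∂Q.map (limitVar ν) = 0 ∧ ∫ x, x ^ 2 ∂Q.map (limitVar ν)
        ≤ (1 + (meanLog ν)⁻¹ * b) ^ 2 / (1 - ∫ v, ∑ i, v i ^ 2 ∂ν) := by
  refine ⟨?_, ?_, ?_⟩
  · rw [memLp_map_measure_iff (by fun_prop) measurable_limitVar.aemeasurable]
    exact hQ.memLp_limitVar hν hV
  · rw [integral_map_limitVar measurable_id', hQ.integral_limitVar hν hV]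
  · rw [integral_map_limitVar (f := fun x => x ^ 2) (measurable_id.pow_const 2)]
    exact hQ.integral_limitVar_sq_le hν hV

/-- The law of the limit variable does not depend on the law of the environment, and it is the
only centred solution of the fixed point equation. -/
lemma IsEnvLaw.eq_map_limitVar (hν : IsSplitLaw ν) (hV : ν {v | ∃ i, v i = 1} < 1)
    {Q : Measure (Env b)} (hQ : IsEnvLaw ν Q) :
    (∀ {Q' : Measure (Env b)}, IsEnvLaw ν Q' → Q'.map (limitVar ν) = Q.map (limitVar ν)) ∧
    ∀ φ : ProbabilityMeasure ℝ, IsCenteredSolution ν φ → (φ : Measure ℝ) = Q.map (limitVar ν) := by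
  set B := (1 + (meanLog ν)⁻¹ * b) ^ 2 / (1 - ∫ v, ∑ i, v i ^ 2 ∂ν) with hB
  have hprob : ∀ {Q : Measure (Env b)}, IsEnvLaw ν Q → IsProbabilityMeasure (Q.map (limitVar ν)) :=
    fun {Q} hQ => by
      have := hQ.isProbabilityMeasure hν
      exact Measure.isProbabilityMeasure_map measurable_limitVar.aemeasurable
  refine ⟨fun {Q'} hQ' => ?_, fun φ hφ => ?_⟩
  · refine eq_of_mixMap_class hν hV (B := B)
      (𝒞 := {μ | ∃ Q : Measure (Env b), IsEnvLaw ν Q ∧ μ = Q.map (limitVar ν)}) ?_ ?_ ?_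
      ⟨Q', hQ', rfl⟩ ⟨Q, hQ, rfl⟩
    · rintro _ ⟨R, hR, rfl⟩
      exact hprob hR
    · rintro _ ⟨R, hR, rfl⟩
      exact hR.moments_map_limitVar hν hV
    · rintro _ ⟨R, hR, rfl⟩
      exact ⟨_, fun k => ⟨_, hR.subtree hν k, rfl⟩, hR.map_limitVar hν hV⟩
  · refine eq_of_mixMap_class hν hV (B := max B (∫ x, x ^ 2 ∂(φ : Measure ℝ)))
      (𝒞 := {μ | μ = φ ∨ ∃ Q : Measure (Env b), IsEnvLaw ν Q ∧ μ = Q.map (limitVar ν)}) ?_ ?_ ?_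
      (Or.inl rfl) (Or.inr ⟨Q, hQ, rfl⟩)
    · rintro _ (rfl | ⟨R, hR, rfl⟩)
      · infer_instance
      · exact hprob hR
    · rintro _ (rfl | ⟨R, hR, rfl⟩)
      · exact ⟨hφ.finite_variance, hφ.mean_zero, le_max_right _ _⟩
      · obtain ⟨h1, h2, h3⟩ := hR.moments_map_limitVar hν hV
        exact ⟨h1, h2, h3.trans (le_max_left _ _)⟩
    · rintro _ (rfl | ⟨R, hR, rfl⟩)
      · exact ⟨fun _ => φ, fun k => Or.inl rfl, hφ.fixed.symm⟩
      · exact ⟨_, fun k => Or.inr ⟨_, hR.subtree hν k, rfl⟩, hR.map_limitVar hν hV⟩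

/-- The laws of the limits in the subtrees agree with that at the root, so the equation along the
tree is the fixed point equation. -/
lemma IsEnvLaw.fixedPointMap_map_limitVar (hν : IsSplitLaw ν) (hV : ν {v | ∃ i, v i = 1} < 1)
    {Q : Measure (Env b)} (hQ : IsEnvLaw ν Q) :
    fixedPointMap ν (Q.map (limitVar ν)) = Q.map (limitVar ν) := by
  conv_rhs => rw [hQ.map_limitVar hν hV]
  have h : (fun i => (Q.map (SplitTree.subtree i)).map (limitVar ν))
      = fun _ : Fin b => Q.map (limitVar ν) :=
    funext fun i => (hQ.eq_map_limitVar hν hV).1 (hQ.subtree hν i)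
  rw [h]
  rfl

end

/-! ### Convergence of exponential moments -/

section

open scoped ENNReal BoundedContinuousFunction

lemma lintegral_exp_le_liminf {ψ : ℕ → ProbabilityMeasure ℝ} {φ : ProbabilityMeasure ℝ}
    (h : Tendsto ψ atTop (𝓝 φ)) (t : ℝ) :
    ∫⁻ x, ENNReal.ofReal (Real.exp (t * x)) ∂(φ : Measure ℝ)
      ≤ liminf (fun n => ∫⁻ x, ENNReal.ofReal (Real.exp (t * x)) ∂(ψ n : Measure ℝ)) atTop := by
  have hc : Continuous fun x : ℝ => Real.exp (t * x) := by fun_prop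
  exact lintegral_le_liminf_lintegral_of_forall_isOpen_measure_le_liminf_measure hc
    (fun x => (Real.exp_pos _).le)
    fun G hG => ProbabilityMeasure.le_liminf_measure_open_of_tendsto h hG

lemma exp_le_min_add {t η : ℝ} (hη : 0 < η) (L x : ℝ) :
    Real.exp (t * x) ≤ min (Real.exp (t * x)) (Real.exp L)
      + Real.exp (-(η * L)) * Real.exp ((1 + η) * t * x) := by
  rcases le_total (t * x) L with h | h
  · rw [min_eq_left (Real.exp_le_exp.2 h)]
    have := mul_pos (Real.exp_pos (-(η * L))) (Real.exp_pos ((1 + η) * t * x))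
    linarith
  · have h1 : Real.exp (t * x) ≤ Real.exp (-(η * L)) * Real.exp ((1 + η) * t * x) := by
      rw [← Real.exp_add]
      refine Real.exp_le_exp.2 ?_
      nlinarith [mul_le_mul_of_nonneg_left h hη.le]
    have h2 : 0 < min (Real.exp (t * x)) (Real.exp L) := lt_min (Real.exp_pos _) (Real.exp_pos _)
    linarith

/-- A slightly larger exponential moment that stays bounded makes `e^{tx}` uniformly integrable. -/
lemma tendsto_lintegral_exp_of_bound {ψ : ℕ → ProbabilityMeasure ℝ} {φ : ProbabilityMeasure ℝ}
    (h : Tendsto ψ atTop (𝓝 φ)) {t η : ℝ} (hη : 0 < η) {B : ℝ≥0∞} (hB : B ≠ ⊤)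
    (hb : ∀ᶠ n in atTop,
      ∫⁻ x, ENNReal.ofReal (Real.exp ((1 + η) * t * x)) ∂(ψ n : Measure ℝ) ≤ B) :
    Tendsto (fun n => ∫⁻ x, ENNReal.ofReal (Real.exp (t * x)) ∂(ψ n : Measure ℝ)) atTop
      (𝓝 (∫⁻ x, ENNReal.ofReal (Real.exp (t * x)) ∂(φ : Measure ℝ))) := by
  refine tendsto_of_le_liminf_of_limsup_le (lintegral_exp_le_liminf h t) ?_
  have key : ∀ L : ℝ, limsup (fun n => ∫⁻ x, ENNReal.ofReal (Real.exp (t * x)) ∂(ψ n : Measure ℝ))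
      atTop ≤ ∫⁻ x, ENNReal.ofReal (Real.exp (t * x)) ∂(φ : Measure ℝ)
        + ENNReal.ofReal (Real.exp (-(η * L))) * B := by
    intro L
    let g : ℝ →ᵇ NNReal := BoundedContinuousFunction.mkOfBound
      ⟨fun x => Real.toNNReal (min (Real.exp (t * x)) (Real.exp L)), by fun_prop⟩ (Real.exp L)
      (by
        intro x y
        have hx : ∀ z : ℝ, (Real.toNNReal (min (Real.exp (t * z)) (Real.exp L)) : ℝ)
            = min (Real.exp (t * z)) (Real.exp L) := fun z =>
          Real.coe_toNNReal _ (le_min (Real.exp_pos _).le (Real.exp_pos _).le)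
        rw [NNReal.dist_eq]
        simp only [ContinuousMap.coe_mk]
        rw [hx, hx, abs_le]
        have h1 := min_le_right (Real.exp (t * x)) (Real.exp L)
        have h2 := min_le_right (Real.exp (t * y)) (Real.exp L)
        have h3 : 0 ≤ min (Real.exp (t * x)) (Real.exp L) :=
          le_min (Real.exp_pos _).le (Real.exp_pos _).le
        have h4 : 0 ≤ min (Real.exp (t * y)) (Real.exp L) :=
          le_min (Real.exp_pos _).le (Real.exp_pos _).le
        constructor <;> linarith)
    have hg : ∀ x, (g x : ℝ≥0∞) = ENNReal.ofReal (min (Real.exp (t * x)) (Real.exp L)) :=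
      fun x => rfl
    have ht := (ProbabilityMeasure.tendsto_iff_forall_lintegral_tendsto.1 h) g
    have ht' : Tendsto (fun n => ∫⁻ x, g x ∂(ψ n : Measure ℝ)
        + ENNReal.ofReal (Real.exp (-(η * L))) * B) atTop
        (𝓝 (∫⁻ x, g x ∂(φ : Measure ℝ) + ENNReal.ofReal (Real.exp (-(η * L))) * B)) :=
      ht.add_const _
    have h1 : ∀ᶠ n in atTop, ∫⁻ x, ENNReal.ofReal (Real.exp (t * x)) ∂(ψ n : Measure ℝ)
        ≤ ∫⁻ x, g x ∂(ψ n : Measure ℝ) + ENNReal.ofReal (Real.exp (-(η * L))) * B := by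
      filter_upwards [hb] with n hn
      calc ∫⁻ x, ENNReal.ofReal (Real.exp (t * x)) ∂(ψ n : Measure ℝ)
          ≤ ∫⁻ x, (g x + ENNReal.ofReal (Real.exp (-(η * L)))
              * ENNReal.ofReal (Real.exp ((1 + η) * t * x))) ∂(ψ n : Measure ℝ) := by
            refine lintegral_mono fun x => ?_
            rw [hg, ← ENNReal.ofReal_mul (Real.exp_pos _).le,
              ← ENNReal.ofReal_add (le_min (Real.exp_pos _).le (Real.exp_pos _).le) (by positivity)]
            exact ENNReal.ofReal_le_ofReal (exp_le_min_add hη L x)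
        _ = ∫⁻ x, g x ∂(ψ n : Measure ℝ) + ENNReal.ofReal (Real.exp (-(η * L)))
              * ∫⁻ x, ENNReal.ofReal (Real.exp ((1 + η) * t * x)) ∂(ψ n : Measure ℝ) := by
            have hm : Measurable fun x : ℝ => ENNReal.ofReal (Real.exp ((1 + η) * t * x)) := by
              fun_prop
            rw [lintegral_add_right _ (hm.const_mul _), lintegral_const_mul _ hm]
        _ ≤ _ := by gcongr
    calc _ ≤ limsup (fun n => ∫⁻ x, g x ∂(ψ n : Measure ℝ)
          + ENNReal.ofReal (Real.exp (-(η * L))) * B) atTop := limsup_le_limsup h1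
      _ = ∫⁻ x, g x ∂(φ : Measure ℝ) + ENNReal.ofReal (Real.exp (-(η * L))) * B := ht'.limsup_eq
      _ ≤ _ := by
        gcongr with x
        rw [hg]
        exact ENNReal.ofReal_le_ofReal (min_le_left _ _)
  have h0 : Tendsto (fun L : ℝ => ENNReal.ofReal (Real.exp (-(η * L)))) atTop (𝓝 0) := by
    rw [← ENNReal.ofReal_zero]
    refine ENNReal.tendsto_ofReal (Real.tendsto_exp_neg_atTop_nhds_zero.comp ?_)
    exact tendsto_id.const_mul_atTop hη
  have h2 := (ENNReal.Tendsto.mul_const h0 (Or.inr hB)).const_add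
    (∫⁻ x, ENNReal.ofReal (Real.exp (t * x)) ∂(φ : Measure ℝ))
  rw [zero_mul, add_zero] at h2
  exact ge_of_tendsto' h2 key

end

section

variable {b : ℕ} {ν : Measure (Fin b → ℝ)}

/-- If all mass goes to one child with probability `p`, then the cost of the split is `1` there, so
the exponential moment `J` of a fixed point satisfies `J ≥ e^t p J + ε` for some `ε > 0`. -/
lemma lintegral_exp_eq_top (hν : IsSplitLaw ν) (hV : ν {v | ∃ i, v i = 1} < 1) {φ : Measure ℝ}
    [IsProbabilityMeasure φ] (hφ : fixedPointMap ν φ = φ) {t : ℝ}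
    (ht : 1 ≤ Real.exp t * (ν {v | ∃ i, v i = 1}).toReal) :
    ∫⁻ x, ENNReal.ofReal (Real.exp (t * x)) ∂φ = ⊤ := by
  have := hν.isProbabilityMeasure
  set A : Set (Fin b → ℝ) := {v | ∃ i, v i = 1} with hA
  have mA : MeasurableSet A := measurableSet_exists_eq_one
  set J := ∫⁻ x, ENNReal.ofReal (Real.exp (t * x)) ∂φ with hJ
  have hm0 : Measurable fun x : ℝ => ENNReal.ofReal (Real.exp (t * x)) := by fun_prop
  have hmeas : Measurable fun p : (Fin b → ℝ) × (Fin b → ℝ) =>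
      ENNReal.ofReal (Real.exp (t * (∑ k, p.1 k * p.2 k + cost ν p.1))) := by
    have h := hm0.comp (measurable_sum_mul_add_cost (ν := ν))
    exact h
  let I : (Fin b → ℝ) → ENNReal := fun v => ∫⁻ x, ENNReal.ofReal
    (Real.exp (t * (∑ k, v k * x k + cost ν v))) ∂(Measure.pi fun _ : Fin b => φ)
  have hI : Measurable I := hmeas.lintegral_prod_right'
  have hJI : J = ∫⁻ v, I v ∂ν := by
    rw [hJ]
    nth_rw 1 [← hφ]
    rw [fixedPointMap, lintegral_map hm0 measurable_sum_mul_add_cost,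
      lintegral_prod _ hmeas.aemeasurable]
  -- where `v i = 1`, the equation reads `X = X⁽ⁱ⁾ + 1`
  have hIA : ∫⁻ v in A, I v ∂ν = ENNReal.ofReal (Real.exp t) * J * ν A := by
    rw [← setLIntegral_const]
    refine setLIntegral_congr_fun_ae mA ?_
    filter_upwards [hν.mem_simplex] with v hv hvA
    obtain ⟨i, hi⟩ := hvA
    have hsum : ∀ x : Fin b → ℝ, ∑ k, v k * x k = x i := by
      intro x
      rw [Finset.sum_eq_single i]
      · rw [hi, one_mul]
      · intro j _ hj
        rw [eq_zero_of_eq_one hv hi hj, zero_mul]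
      · simp
    have hcost : cost ν v = 1 := cost_eq_one hv ⟨i, hi⟩
    have hme := (measurePreserving_eval (fun _ : Fin b => φ) i).lintegral_comp hm0
    calc I v = ∫⁻ x, ENNReal.ofReal (Real.exp t) * ENNReal.ofReal (Real.exp (t * x i))
          ∂(Measure.pi fun _ : Fin b => φ) := by
          refine lintegral_congr fun x => ?_
          rw [hsum, hcost, ← ENNReal.ofReal_mul (Real.exp_pos _).le, ← Real.exp_add]
          ring_nf
      _ = ENNReal.ofReal (Real.exp t) * J := by
          rw [lintegral_const_mul _ (by fun_prop)]
          congr 1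
  have hpos : 0 < ∫⁻ v in Aᶜ, I v ∂ν := by
    have hIpos : ∀ v, I v ≠ 0 := by
      intro v h0
      have hmv : Measurable fun x : Fin b → ℝ =>
          ENNReal.ofReal (Real.exp (t * (∑ k, v k * x k + cost ν v))) := by fun_prop
      have h1 := (lintegral_eq_zero_iff hmv).1 h0
      obtain ⟨x, hx⟩ := h1.exists
      exact (ENNReal.ofReal_pos.2 (Real.exp_pos _)).ne' hx
    rw [setLIntegral_pos_iff hI]
    have hsupp : Function.support I = Set.univ := by
      ext v
      simp [hIpos v]
    rw [hsupp, Set.univ_inter]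
    exact measure_not_exists_pos hν hV
  have h1 : (1 : ENNReal) ≤ ENNReal.ofReal (Real.exp t) * ν A := by
    rw [← ENNReal.ofReal_toReal (measure_ne_top ν A), ← ENNReal.ofReal_mul (Real.exp_pos _).le]
    exact ENNReal.one_le_ofReal.2 ht
  by_contra hne
  have h2 : J + ∫⁻ v in Aᶜ, I v ∂ν ≤ J := by
    calc J + ∫⁻ v in Aᶜ, I v ∂ν ≤ ENNReal.ofReal (Real.exp t) * J * ν A
          + ∫⁻ v in Aᶜ, I v ∂ν := by
          gcongr
          calc J = 1 * J := (one_mul J).symm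
            _ ≤ ENNReal.ofReal (Real.exp t) * ν A * J := by gcongr
            _ = _ := by ring
      _ = ∫⁻ v, I v ∂ν := by rw [← hIA, lintegral_add_compl _ mA]
      _ = J := hJI.symm
  exact absurd h2 (not_le.2 (ENNReal.lt_add_right hne hpos.ne'))

end

section

variable {b s s₀ s₁ : ℕ} {ν : Measure (Fin b → ℝ)}

/-- The law of the normalized path length under a law `Q` of the environment. -/
def normPathLaw (s s₀ s₁ : ℕ) (ν : Measure (Fin b → ℝ)) (Q : Measure (Env b))
    [IsProbabilityMeasure Q] (n : ℕ) : ProbabilityMeasure ℝ :=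
  ⟨Q.map (normPath s s₀ s₁ ν n),
    Measure.isProbabilityMeasure_map (measurable_normPath_apply n).aemeasurable⟩

/-- The law of the limit variable under a law `Q` of the environment. -/
def limitLaw (ν : Measure (Fin b → ℝ)) (Q : Measure (Env b)) [IsProbabilityMeasure Q] :
    ProbabilityMeasure ℝ :=
  ⟨Q.map (limitVar ν), Measure.isProbabilityMeasure_map measurable_limitVar.aemeasurable⟩

/-- On the canonical space the normalized path lengths converge in probability. -/
lemma tendstoInMeasure_normPath (hs : IsAdmissible b s s₀ s₁) (hν : IsSplitLaw ν)
    (hV : ν {v | ∃ i, v i = 1} < 1) {Q : Measure (Env b)} (hQ : IsEnvLaw ν Q) :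
    TendstoInMeasure Q (normPath s s₀ s₁ ν) atTop (limitVar ν) := by
  have := hQ.isProbabilityMeasure hν
  refine tendstoInMeasure_of_tendsto_eLpNorm two_ne_zero
    (fun n => (measurable_normPath_apply n).aestronglyMeasurable)
    measurable_limitVar.aestronglyMeasurable ?_
  have hmem : ∀ n, MemLp (normPath s s₀ s₁ ν n - limitVar ν) 2 Q := fun n =>
    (hQ.memLp_normPath hs hν hV n).sub (hQ.memLp_limitVar hν hV)
  have h0 : Tendsto (fun n => ∫ W, (normPath s s₀ s₁ ν n W - limitVar ν W) ^ 2 ∂Q) atTop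
      (𝓝 0) := by
    rw [Metric.tendsto_atTop]
    intro ε hε
    obtain ⟨N, hN⟩ := exists_integral_sq_sub_le hs hν hV (half_pos hε)
    refine ⟨N, fun n hn => ?_⟩
    rw [Real.dist_eq, sub_zero, abs_of_nonneg (integral_nonneg fun W => sq_nonneg _)]
    exact (hN n hn hQ).trans_lt (half_lt_self hε)
  have h1 : ∀ n, eLpNorm (normPath s s₀ s₁ ν n - limitVar ν) 2 Q
      = ENNReal.ofReal ((∫ W, (normPath s s₀ s₁ ν n W - limitVar ν W) ^ 2 ∂Q) ^ (2⁻¹ : ℝ)) := by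
    intro n
    rw [(hmem n).eLpNorm_eq_integral_rpow_norm two_ne_zero ENNReal.ofNat_ne_top]
    simp
  simp_rw [h1]
  rw [← ENNReal.ofReal_zero]
  refine ENNReal.tendsto_ofReal ?_
  have h2 := h0.rpow_const (p := (2⁻¹ : ℝ)) (Or.inr (by norm_num))
  rwa [Real.zero_rpow (by norm_num)] at h2

lemma tendsto_normPathLaw (hs : IsAdmissible b s s₀ s₁) (hν : IsSplitLaw ν)
    (hV : ν {v | ∃ i, v i = 1} < 1) {Q : Measure (Env b)} [IsProbabilityMeasure Q]
    (hQ : IsEnvLaw ν Q) :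
    Tendsto (normPathLaw s s₀ s₁ ν Q) atTop (𝓝 (limitLaw ν Q)) :=
  ((tendstoInMeasure_normPath hs hν hV hQ).tendstoInDistribution_of_aemeasurable
    (fun n => (measurable_normPath_apply n).aemeasurable) measurable_limitVar.aemeasurable).tendsto

lemma lintegral_normPathLaw {Q : Measure (Env b)} [IsProbabilityMeasure Q] (n : ℕ) (t : ℝ) :
    ∫⁻ x, ENNReal.ofReal (Real.exp (t * x)) ∂(normPathLaw s s₀ s₁ ν Q n : Measure ℝ)
      = ∫⁻ W, ENNReal.ofReal (Real.exp (t * normPath s s₀ s₁ ν n W)) ∂Q := by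
  have hm0 : Measurable fun x : ℝ => ENNReal.ofReal (Real.exp (t * x)) := by fun_prop
  exact lintegral_map hm0 (measurable_normPath_apply n)

/-- Exponential moments of the normalized path length are bounded below the critical exponent. -/
lemma IsEnvLaw.exists_lintegral_exp_normPath_le (hs : IsAdmissible b s s₀ s₁) (hν : IsSplitLaw ν)
    (hV : ν {v | ∃ i, v i = 1} < 1) {Q : Measure (Env b)} (hQ : IsEnvLaw ν Q) {t : ℝ}
    (ht : Real.exp t * (ν {v | ∃ i, v i = 1}).toReal < 1) :
    ∃ B : ENNReal, B ≠ ⊤ ∧ ∀ᶠ n in atTop,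
      ∫⁻ W, ENNReal.ofReal (Real.exp (t * normPath s s₀ s₁ ν n W)) ∂Q ≤ B := by
  have hp : Real.exp (max t 0) * (ν {v | ∃ i, v i = 1}).toReal < 1 := by
    rcases le_total t 0 with h | h
    · rw [max_eq_right h, Real.exp_zero, one_mul]
      exact toReal_lt_one hV
    · rwa [max_eq_left h]
  obtain ⟨K, hK, n₀, h⟩ := exists_lintegral_exp_path_le hs hν hV (min_le_right t 0)
    (le_max_right t 0) hp
  refine ⟨ENNReal.ofReal (Real.exp (K * t ^ 2)), ENNReal.ofReal_ne_top, ?_⟩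
  filter_upwards [eventually_ge_atTop (max n₀ 1)] with n hn
  have hn0 : n₀ ≤ n := (le_max_left _ _).trans hn
  have hn1 : (n : ℝ) ≠ 0 := by
    have : 1 ≤ n := (le_max_right _ _).trans hn
    positivity
  have e : t / n * ((max n n₀ : ℕ) : ℝ) = t := by
    rw [max_eq_left hn0]
    field_simp
  have h1 := h hQ n (t / n) (by rw [e]; exact min_le_left _ _) (by rw [e]; exact le_max_left _ _)
  have e2 : K * (t / n) ^ 2 * (n : ℝ) ^ 2 = K * t ^ 2 := by field_simp
  rw [e2] at h1
  refine le_trans (le_of_eq (lintegral_congr fun W => ?_)) h1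
  rw [normPath]
  congr 2
  ring

lemma IsEnvLaw.tendsto_lintegral_exp_normPath_of_lt (hs : IsAdmissible b s s₀ s₁)
    (hν : IsSplitLaw ν) (hV : ν {v | ∃ i, v i = 1} < 1) {Q : Measure (Env b)}
    [IsProbabilityMeasure Q] (hQ : IsEnvLaw ν Q) {t : ℝ}
    (ht : Real.exp t * (ν {v | ∃ i, v i = 1}).toReal < 1) :
    Tendsto (fun n => ∫⁻ W, ENNReal.ofReal (Real.exp (t * normPath s s₀ s₁ ν n W)) ∂Q) atTop
      (𝓝 (∫⁻ x, ENNReal.ofReal (Real.exp (t * x)) ∂(limitLaw ν Q : Measure ℝ))) := by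
  -- the condition on `t` is open, so it leaves room for a larger exponent
  obtain ⟨η, hη, hη1⟩ : ∃ η : ℝ, 0 < η ∧
      Real.exp ((1 + η) * t) * (ν {v | ∃ i, v i = 1}).toReal < 1 := by
    have hc : ContinuousAt (fun η : ℝ =>
        Real.exp ((1 + η) * t) * (ν {v | ∃ i, v i = 1}).toReal) 0 := by fun_prop
    have h0 : ∀ᶠ η : ℝ in 𝓝 0, Real.exp ((1 + η) * t) * (ν {v | ∃ i, v i = 1}).toReal < 1 :=
      hc.eventually (gt_mem_nhds (by simpa using ht))
    obtain ⟨η, h1, h2⟩ := ((h0.filter_mono nhdsWithin_le_nhds).and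
      (self_mem_nhdsWithin : Set.Ioi (0 : ℝ) ∈ 𝓝[>] 0)).exists
    exact ⟨η, h2, h1⟩
  obtain ⟨B, hB, hb⟩ := hQ.exists_lintegral_exp_normPath_le hs hν hV hη1
  have h := tendsto_lintegral_exp_of_bound (tendsto_normPathLaw hs hν hV hQ) (t := t) hη hB (by
    filter_upwards [hb] with n hn
    rwa [lintegral_normPathLaw])
  simpa only [lintegral_normPathLaw] using h

/-- Above the critical exponent both sides are infinite: the limit by `lintegral_exp_eq_top`, and
then the sequence by lower semicontinuity. -/
lemma IsEnvLaw.tendsto_lintegral_exp_normPath (hs : IsAdmissible b s s₀ s₁)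
    (hν : IsSplitLaw ν) (hV : ν {v | ∃ i, v i = 1} < 1) {Q : Measure (Env b)}
    [IsProbabilityMeasure Q] (hQ : IsEnvLaw ν Q) (t : ℝ) :
    Tendsto (fun n => ∫⁻ W, ENNReal.ofReal (Real.exp (t * normPath s s₀ s₁ ν n W)) ∂Q) atTop
      (𝓝 (∫⁻ x, ENNReal.ofReal (Real.exp (t * x)) ∂(limitLaw ν Q : Measure ℝ))) := by
  rcases lt_or_ge (Real.exp t * (ν {v | ∃ i, v i = 1}).toReal) 1 with ht | ht
  · exact hQ.tendsto_lintegral_exp_normPath_of_lt hs hν hV ht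
  · have h1 := lintegral_exp_eq_top hν hV (φ := (limitLaw ν Q : Measure ℝ))
      (hQ.fixedPointMap_map_limitVar hν hV) ht
    have h2 := lintegral_exp_le_liminf (tendsto_normPathLaw hs hν hV hQ) t
    simp only [lintegral_normPathLaw] at h2
    rw [h1] at h2 ⊢
    exact tendsto_of_le_liminf_of_limsup_le h2 le_top

/-- Below the critical exponent the exponential moments of the limit are finite, by Fatou. -/
lemma IsEnvLaw.lintegral_exp_limitLaw_lt_top (hs : IsAdmissible b s s₀ s₁)
    (hν : IsSplitLaw ν) (hV : ν {v | ∃ i, v i = 1} < 1) {Q : Measure (Env b)}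
    [IsProbabilityMeasure Q] (hQ : IsEnvLaw ν Q) {t : ℝ}
    (ht : Real.exp t * (ν {v | ∃ i, v i = 1}).toReal < 1) :
    ∫⁻ x, ENNReal.ofReal (Real.exp (t * x)) ∂(limitLaw ν Q : Measure ℝ) < ⊤ := by
  obtain ⟨B, hB, hb⟩ := hQ.exists_lintegral_exp_normPath_le hs hν hV ht
  exact (le_of_tendsto (hQ.tendsto_lintegral_exp_normPath hs hν hV t) hb).trans_lt hB.lt_top

end

section

variable {b s s₀ s₁ : ℕ} {ν : Measure (Fin b → ℝ)}

lemma integrable_and_integral_eq {Ω : Type*} [MeasurableSpace Ω] {P : Measure Ω} {f : Ω → ℝ}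
    (hf : AEMeasurable f P) (h : ∫⁻ ω, ENNReal.ofReal (Real.exp (f ω)) ∂P < ⊤) :
    Integrable (fun ω => Real.exp (f ω)) P ∧
      ∫ ω, Real.exp (f ω) ∂P = (∫⁻ ω, ENNReal.ofReal (Real.exp (f ω)) ∂P).toReal := by
  have hm : AEStronglyMeasurable (fun ω => Real.exp (f ω)) P :=
    (Real.measurable_exp.comp_aemeasurable hf).aestronglyMeasurable
  refine ⟨⟨hm, ?_⟩, integral_eq_lintegral_of_nonneg_ae
    (Eventually.of_forall fun ω => (Real.exp_pos _).le) hm⟩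
  rw [hasFiniteIntegral_iff_ofReal (Eventually.of_forall fun ω => (Real.exp_pos _).le)]
  exact h

end

/-! ### Transfer to an arbitrary probability space -/

section

variable {b s s₀ s₁ : ℕ} {ν : Measure (Fin b → ℝ)} {Ω : Type*} [MeasurableSpace Ω] {P : Measure Ω}
  {𝒱 : Node b → Ω → (Fin b → ℝ)} {M : Node b → ℕ → Ω → (Fin b → ℕ)}

/-- All the randomness at once, as a point of the canonical space. -/
def toEnv (𝒱 : Node b → Ω → (Fin b → ℝ)) (M : Node b → ℕ → Ω → (Fin b → ℕ)) (ω : Ω) : Env b :=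
  fun u => (𝒱 u ω, fun m => M u m ω)

lemma IsSplitRandomness.measurable_toEnv (hM : IsSplitRandomness P ν 𝒱 M) :
    Measurable (toEnv 𝒱 M) :=
  hM.measurable_env id

lemma IsSplitRandomness.isEnvLaw (hν : IsSplitLaw ν) (hM : IsSplitRandomness P ν 𝒱 M) :
    IsEnvLaw ν (P.map (toEnv 𝒱 M)) :=
  hM.isEnvLaw_map hν Function.injective_id

lemma IsSplitRandomness.ae_pathLength_eq (hs : IsAdmissible b s s₀ s₁) (hν : IsSplitLaw ν)
    (hV : ν {v | ∃ i, v i = 1} < 1) (hM : IsSplitRandomness P ν 𝒱 M) (n : ℕ) :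
    ∀ᵐ ω ∂P, pathLength s s₀ s₁ (fun u m => M u m ω) n
      = ENNReal.ofReal (path s s₀ s₁ (toEnv 𝒱 M ω) n) := by
  filter_upwards [ae_of_ae_map hM.measurable_toEnv.aemeasurable
    ((hM.isEnvLaw hν).ae_path hs hν hV n)] with ω hω
  exact hω.1

lemma IsSplitRandomness.lintegral_pathLength (hs : IsAdmissible b s s₀ s₁) (hν : IsSplitLaw ν)
    (hV : ν {v | ∃ i, v i = 1} < 1) (hM : IsSplitRandomness P ν 𝒱 M) (n : ℕ) :
    ∫⁻ ω, pathLength s s₀ s₁ (fun u m => M u m ω) n ∂P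
      = ENNReal.ofReal (meanPath s s₀ s₁ ν n) := by
  rw [lintegral_congr_ae (hM.ae_pathLength_eq hs hν hV n),
    ← (hM.isEnvLaw hν).lintegral_path hs hν hV n]
  exact (lintegral_map (measurable_path_apply n).ennreal_ofReal hM.measurable_toEnv).symm

lemma IsSplitRandomness.normalizedPathLength_ae_eq (hs : IsAdmissible b s s₀ s₁)
    (hν : IsSplitLaw ν) (hV : ν {v | ∃ i, v i = 1} < 1) (hM : IsSplitRandomness P ν 𝒱 M) (n : ℕ) :
    normalizedPathLength P s s₀ s₁ M n =ᵐ[P] fun ω => normPath s s₀ s₁ ν n (toEnv 𝒱 M ω) := by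
  have h : ∀ᵐ ω ∂P, (pathLength s s₀ s₁ (fun u m => M u m ω) n).toReal
      = path s s₀ s₁ (toEnv 𝒱 M ω) n := by
    filter_upwards [hM.ae_pathLength_eq hs hν hV n] with ω hω
    rw [hω, ENNReal.toReal_ofReal (path_nonneg _ n)]
  have hi : ∫ ω, (pathLength s s₀ s₁ (fun u m => M u m ω) n).toReal ∂P
      = meanPath s s₀ s₁ ν n := by
    rw [integral_congr_ae h, ← (hM.isEnvLaw hν).integral_path hs hν hV n]
    exact (integral_map hM.measurable_toEnv.aemeasurable
      (measurable_path_apply n).aestronglyMeasurable).symm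
  filter_upwards [h] with ω hω
  rw [normalizedPathLength, normPath, hω, hi]

lemma IsSplitRandomness.aemeasurable_normalizedPathLength (hs : IsAdmissible b s s₀ s₁)
    (hν : IsSplitLaw ν) (hV : ν {v | ∃ i, v i = 1} < 1) (hM : IsSplitRandomness P ν 𝒱 M) (n : ℕ) :
    AEMeasurable (normalizedPathLength P s s₀ s₁ M n) P :=
  ((measurable_normPath_apply n).comp hM.measurable_toEnv).aemeasurable.congr
    (hM.normalizedPathLength_ae_eq hs hν hV n).symm

lemma IsSplitRandomness.map_normalizedPathLength (hs : IsAdmissible b s s₀ s₁)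
    (hν : IsSplitLaw ν) (hV : ν {v | ∃ i, v i = 1} < 1) (hM : IsSplitRandomness P ν 𝒱 M) (n : ℕ) :
    P.map (normalizedPathLength P s s₀ s₁ M n)
      = (P.map (toEnv 𝒱 M)).map (normPath s s₀ s₁ ν n) := by
  rw [Measure.map_map (measurable_normPath_apply n) hM.measurable_toEnv]
  exact Measure.map_congr (hM.normalizedPathLength_ae_eq hs hν hV n)

lemma IsSplitRandomness.lintegral_exp_normalizedPathLength (hs : IsAdmissible b s s₀ s₁)
    (hν : IsSplitLaw ν) (hV : ν {v | ∃ i, v i = 1} < 1) (hM : IsSplitRandomness P ν 𝒱 M) (n : ℕ)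
    (t : ℝ) :
    ∫⁻ ω, ENNReal.ofReal (Real.exp (t * normalizedPathLength P s s₀ s₁ M n ω)) ∂P
      = ∫⁻ W, ENNReal.ofReal (Real.exp (t * normPath s s₀ s₁ ν n W)) ∂(P.map (toEnv 𝒱 M)) := by
  have hm0 : Measurable fun x : ℝ => ENNReal.ofReal (Real.exp (t * x)) := by fun_prop
  have h1 := lintegral_map' (μ := P) hm0.aemeasurable
    (hM.aemeasurable_normalizedPathLength hs hν hV n)
  rw [← h1, hM.map_normalizedPathLength hs hν hV, lintegral_map hm0 (measurable_normPath_apply n)]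

end

end SplitTree

end

theorem theorem2p1 {b s s₀ s₁ : ℕ} (hs : SplitTree.IsAdmissible b s s₀ s₁)
    {ν : Measure (Fin b → ℝ)} (hν : SplitTree.IsSplitLaw ν)
    (hV : ν {v | ∃ i, v i = 1} < 1)
    (hC : 0 < ν {v | SplitTree.cost ν v ≠ 0})
    {Ω : Type*} [MeasurableSpace Ω] {P : Measure Ω} [IsProbabilityMeasure P]
    {𝒱 : SplitTree.Node b → Ω → (Fin b → ℝ)} {M : SplitTree.Node b → ℕ → Ω → (Fin b → ℕ)}
    (hM : SplitTree.IsSplitRandomness P ν 𝒱 M) :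
    (∀ n, ∫⁻ ω, SplitTree.pathLength s s₀ s₁ (fun u m => M u m ω) n ∂P < ⊤) ∧
    ∃ φ : ProbabilityMeasure ℝ,
      SplitTree.IsCenteredSolution ν φ ∧
      (∀ φ' : ProbabilityMeasure ℝ, SplitTree.IsCenteredSolution ν φ' → φ' = φ) ∧
      TendstoInDistribution (fun n => SplitTree.normalizedPathLength P s s₀ s₁ M n) atTop
        (fun x : ℝ => x) (fun _ => P) (φ : Measure ℝ) ∧
      (∀ t : ℝ, Tendsto
        (fun n => ∫⁻ ω,
          ENNReal.ofReal (Real.exp (t * SplitTree.normalizedPathLength P s s₀ s₁ M n ω)) ∂P)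
        atTop (𝓝 (∫⁻ x, ENNReal.ofReal (Real.exp (t * x)) ∂(φ : Measure ℝ)))) ∧
      (∀ t : ℝ, Real.exp t * (ν {v | ∃ i, v i = 1}).toReal < 1 →
        Integrable (fun x : ℝ => Real.exp (t * x)) (φ : Measure ℝ) ∧
        (∀ᶠ n in atTop, Integrable
          (fun ω => Real.exp (t * SplitTree.normalizedPathLength P s s₀ s₁ M n ω)) P) ∧
        Tendsto
          (fun n => ∫ ω, Real.exp (t * SplitTree.normalizedPathLength P s s₀ s₁ M n ω) ∂P)
          atTop (𝓝 (∫ x, Real.exp (t * x) ∂(φ : Measure ℝ)))) := by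
  have hQ := hM.isEnvLaw hν
  have : IsProbabilityMeasure (P.map (SplitTree.toEnv 𝒱 M)) := hQ.isProbabilityMeasure hν
  set Q := P.map (SplitTree.toEnv 𝒱 M) with hQdef
  have hmom := hQ.moments_map_limitVar hν hV
  have hexp : ∀ t : ℝ, Tendsto
      (fun n => ∫⁻ ω,
        ENNReal.ofReal (Real.exp (t * SplitTree.normalizedPathLength P s s₀ s₁ M n ω)) ∂P)
      atTop (𝓝 (∫⁻ x, ENNReal.ofReal (Real.exp (t * x))
        ∂(SplitTree.limitLaw ν Q : Measure ℝ))) := by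
    intro t
    simp_rw [hM.lintegral_exp_normalizedPathLength hs hν hV]
    exact hQ.tendsto_lintegral_exp_normPath hs hν hV t
  refine ⟨fun n => ?_, SplitTree.limitLaw ν Q,
    ⟨hQ.fixedPointMap_map_limitVar hν hV, hmom.1, hmom.2.1⟩, fun φ' hφ' => ?_,
    ⟨hM.aemeasurable_normalizedPathLength hs hν hV, aemeasurable_id, ?_⟩, hexp, fun t ht => ?_⟩
  · rw [hM.lintegral_pathLength hs hν hV]
    exact ENNReal.ofReal_lt_top
  · exact Subtype.ext ((hQ.eq_map_limitVar hν hV).2 φ' hφ')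
  · have e1 : ∀ n, (⟨P.map (SplitTree.normalizedPathLength P s s₀ s₁ M n),
        Measure.isProbabilityMeasure_map (hM.aemeasurable_normalizedPathLength hs hν hV n)⟩ :
        ProbabilityMeasure ℝ) = SplitTree.normPathLaw s s₀ s₁ ν Q n := fun n =>
      Subtype.ext (hM.map_normalizedPathLength hs hν hV n)
    have e2 : (⟨(SplitTree.limitLaw ν Q : Measure ℝ).map (fun x : ℝ => x),
        Measure.isProbabilityMeasure_map aemeasurable_id⟩ : ProbabilityMeasure ℝ)
        = SplitTree.limitLaw ν Q := Subtype.ext Measure.map_id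
    simp_rw [e1]
    rw [e2]
    exact SplitTree.tendsto_normPathLaw hs hν hV hQ
  · have hlt := hQ.lintegral_exp_limitLaw_lt_top hs hν hV ht
    have hlim := SplitTree.integrable_and_integral_eq (f := fun x : ℝ => t * x)
      (by fun_prop) hlt
    have hev := (hexp t).eventually (gt_mem_nhds hlt)
    have hn := hev.mono fun n h => SplitTree.integrable_and_integral_eq
      ((hM.aemeasurable_normalizedPathLength hs hν hV n).const_mul t) h
    refine ⟨hlim.1, hn.mono fun n h => h.1, ?_⟩
    rw [hlim.2]
    exact ((ENNReal.tendsto_toReal hlt.ne).comp (hexp t)).congr' (hn.mono fun n h => h.2.symm)
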